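/- Let $0<\lambda<\lambda^*:=3(2-\sqrt3)/2^{1/3}\simeq 0.638$ and, for $x<1/\lambda$, put $$F(x)=\frac{1-\lambda x/3}{(1-\lambda x)^{1/3}},\qquad S(x)=(1-\lambda x)^{2/3},\qquad W(x)=\frac{x^2-F(x)^2}{S(x)^2}.$$ Consider the nakedly singular self-similar Tolman–Bondi spacetime, i.e. the region $R>0$, $x:=t/R<1/\lambda$, with metric $$-dt^2+F(x)^2dR^2+r^2(d\vartheta^2+\sin^2\vartheta\,d\varphi^2),\qquad r=R\,S(x),$$ which has a regular center at $R=0$, $t<0$; the central singularity is the point $(t,R)=(0,0)$. For an event $(t,R)$ of this spacetime (on the equatorial plane) and an angle $\alpha$, the null geodesic with incidence angle $\alpha$ at the event is the future directed null geodesic in the equatorial plane through it whose four-momentum there is $A(e_0-\cos\alpha\,e_1+\sin\alpha\,e_3)$ for some $A>0$, where $e_0=\partial_t$, $e_1=F^{-1}\partial_R$, $e_3=r^{-1}\partial_\varphi$ is the frame of the comoving free-falling observer (constant $R$). It *emanates from the central singularity* if it can be followed into the past so that $(t,R)\to(0,0)$. It *originates from the far past* if it can be followed into the past so that $t\to-\infty$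 and $r\to\infty$, where a radial geodesic which reaches the regular center at some $t_c<0$ is continued through it to the opposite side. A number $a\in[0,\pi]$ is called a *critical angle* at the event if all null geodesics with incidence angle $\alpha\in(a,2\pi-a)$ emanate from the central singularity and all those with $\alpha\in[0,a)\cup(2\pi-a,2\pi]$ originate from the far past. Then $W$ has on $(-\infty,1/\lambda)$ exactly three zeros $J_0<J_1<J_2$ and exactly one local maximum point $x_c$, and $$J_0<0<J_1<x_c<J_2<1/\lambda,\qquad W(x_c)>0.$$ Put $\beta_c:=1/\sqrt{W(x_c)}$, $Q_{\beta_c}(x):=\sqrt{1-\beta_c^2W(x)}$, and $$\hat\alpha(x):=\begin{cases}\pi,& x<J_1,\\[2pt] \arccos\left(-\dfrac{F(x)+xQ_{\beta_c}(x)}{x+F(x)Q_{\beta_c}(x)}\right),& J_1\le x<x_c,\\[8pt] \arccos\left(-\dfrac{F(x)-xQ_{\beta_c}(x)}{x-F(x)Q_{\beta_c}(x)}\right),& x_c\le x<1/\lambda,\ x\ne J_2.\end{cases}$$ The following hold. 1. At every event with $x=t/R<1/\lambda$, $x\neq J_2$, there is exactly one critical angle, and it equals $\hat\alpha(x)$.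 2. If $x<J_1$, then every null geodesic through the event in the equatorial plane originates from the far past and none emanates from the central singularity. 3. $\hat\alpha$ is continuous on $(-\infty,1/\lambda)\setminus\{J_2\}$, in particular at $J_1$ and $x_c$. 4. As $x\to J_2$ (from both sides), $$-\frac{F(x)-xQ_{\beta_c}(x)}{x-F(x)Q_{\beta_c}(x)}\longrightarrow L:=\frac{1-\beta_c^2J_2^2/S(J_2)^2}{1+\beta_c^2J_2^2/S(J_2)^2},$$ so that $\hat\alpha(x)\to\arccos L$; and at events with $x=J_2$, where the formula for $\hat\alpha$ reads $0/0$, there is exactly one critical angle, and it equals $\arccos L$. -/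

import Mathlib

open Filter Topology

namespace SelfSimilarDust

noncomputable section

/-- The threshold `λ* = 3 (2 - √3) / 2^(1/3) ≃ 0.638` of the parameter `λ`. -/
def lambdaStar : ℝ := 3 * (2 - Real.sqrt 3) / (2 : ℝ) ^ (1 / 3 : ℝ)

/-- The metric function `F(x) = (1 - λ x / 3) / (1 - λ x)^(1/3)`. -/
def F (lam x : ℝ) : ℝ := (1 - lam * x / 3) / (1 - lam * x) ^ (1 / 3 : ℝ)

/-- The metric function `S(x) = (1 - λ x)^(2/3)`. -/
def S (lam x : ℝ) : ℝ := (1 - lam * x) ^ (2 / 3 : ℝ)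

/-- The effective potential `W = (x² - F²) / S²`. -/
def W (lam x : ℝ) : ℝ := (x ^ 2 - F lam x ^ 2) / S lam x ^ 2

/-- `Q_β(x) = √(1 - β² W(x))`. -/
def Q (lam β x : ℝ) : ℝ := Real.sqrt (1 - β ^ 2 * W lam x)

/-! The spacetime is the region `R > 0`, `t / R < 1 / λ`, with the metric
`- dt² + e^{2Ψ} dR² + r² (dϑ² + sin² ϑ dφ²)`, where `e^Ψ = F(t/R)` and `r = R S(t/R)`. -/

/-- The metric coefficient `e^Ψ`. -/
def expPsi (lam t R : ℝ) : ℝ := F lam (t / R)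

/-- The areal radius `r`. -/
def areal (lam t R : ℝ) : ℝ := R * S lam (t / R)

/-- `s ↦ (t s, R s, φ s)`, `s ∈ I`, is an affinely parametrized, future directed null geodesic in
the equatorial plane with momenta `π^t = pt`, `π^R = pR` (that is, `dt/ds = pt` and
`e^{2Ψ} dR/ds = pR`) and angular momentum `r² dφ/ds = ell`. The equations for `pt` and `pR` are
the Euler-Lagrange equations of `(1/2) (- (dt/ds)² + e^{2Ψ} (dR/ds)² + r² (dφ/ds)²)`. -/
structure IsNullGeodesic (lam : ℝ) (I : Set ℝ) (t R φ pt pR : ℝ → ℝ) (ell : ℝ) : Prop where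
  isOpen : IsOpen I
  ordConnected : I.OrdConnected
  nonempty : I.Nonempty
  R_pos : ∀ s ∈ I, 0 < R s
  x_lt : ∀ s ∈ I, t s / R s < 1 / lam
  deriv_t : ∀ s ∈ I, HasDerivAt t (pt s) s
  deriv_R : ∀ s ∈ I, HasDerivAt R (pR s / expPsi lam (t s) (R s) ^ 2) s
  deriv_phi : ∀ s ∈ I, HasDerivAt φ (ell / areal lam (t s) (R s) ^ 2) s
  deriv_pt : ∀ s ∈ I, HasDerivAt pt
    (-(deriv (fun τ => expPsi lam τ (R s)) (t s) / expPsi lam (t s) (R s) ^ 3 * pR s ^ 2)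
      - ell ^ 2 / areal lam (t s) (R s) ^ 3 * deriv (fun τ => areal lam τ (R s)) (t s)) s
  deriv_pR : ∀ s ∈ I, HasDerivAt pR
    (deriv (fun ρ => expPsi lam (t s) ρ) (R s) / expPsi lam (t s) (R s) ^ 3 * pR s ^ 2
      + ell ^ 2 / areal lam (t s) (R s) ^ 3 * deriv (fun ρ => areal lam (t s) ρ) (R s)) s
  null : ∀ s ∈ I, -(pt s) ^ 2 + pR s ^ 2 / expPsi lam (t s) (R s) ^ 2
    + ell ^ 2 / areal lam (t s) (R s) ^ 2 = 0
  future : ∀ s ∈ I, 0 < pt s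

/-- The null geodesic is, at parameter value `0`, at the event `(t₀, R₀)`, where the comoving
observer measures the incidence angle `α`: its four-momentum there is
`A (e₀ - cos α e₁ + sin α e₃)` with some `A > 0`, in the orthonormal frame
`e₀ = ∂_t`, `e₁ = e^{-Ψ} ∂_R`, `e₃ = r⁻¹ ∂_φ` (on the equatorial plane). -/
structure IsRegistered (lam : ℝ) (I : Set ℝ) (t R φ pt pR : ℝ → ℝ) (ell t₀ R₀ α : ℝ) :
    Prop where
  geodesic : IsNullGeodesic lam I t R φ pt pR ell
  mem : (0 : ℝ) ∈ I
  t_zero : t 0 = t₀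
  R_zero : R 0 = R₀
  momentum : ∃ A : ℝ, 0 < A ∧ pt 0 = A ∧ pR 0 / expPsi lam t₀ R₀ = -(A * Real.cos α) ∧
    ell / areal lam t₀ R₀ = A * Real.sin α

/-- The null geodesic through the event `(t₀, R₀)` with incidence angle `α` emanates from the
central singularity `(t, R) = (0, 0)`. -/
def EmanatesFromSingularity (lam t₀ R₀ α : ℝ) : Prop :=
  ∃ (I : Set ℝ) (t R φ pt pR : ℝ → ℝ) (ell : ℝ),
    IsRegistered lam I t R φ pt pR ell t₀ R₀ α ∧
    Tendsto (fun s : I => (t s, R s)) atBot (𝓝 (0, 0))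

/-- Towards its past end, the curve has `t → -∞` and `r → ∞`. -/
def ComesFromInfinity (lam : ℝ) (I : Set ℝ) (t R : ℝ → ℝ) : Prop :=
  Tendsto (fun s : I => t s) atBot atBot ∧
  Tendsto (fun s : I => areal lam (t s) (R s)) atBot atTop

/-- Towards its past end, the curve arrives at a point `(t_c, 0)`, `t_c < 0`, of the regular
center, and it continues a null geodesic which comes from infinity and runs into `(t_c, 0)` from
the opposite side of the center. (The condition on the angles forces both parts to be radial.) -/
def ComesFromInfinityThroughCenter (lam : ℝ) (I : Set ℝ) (t R φ : ℝ → ℝ) : Prop :=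
  ∃ tc : ℝ, tc < 0 ∧ Tendsto (fun s : I => (t s, R s)) atBot (𝓝 (tc, 0)) ∧
    ∃ (I' : Set ℝ) (t' R' φ' pt' pR' : ℝ → ℝ) (ell' : ℝ),
      IsNullGeodesic lam I' t' R' φ' pt' pR' ell' ∧
      Tendsto (fun s : I' => (t' s, R' s)) atTop (𝓝 (tc, 0)) ∧
      (∀ s ∈ I, ∀ s' ∈ I', φ' s' = φ s + Real.pi) ∧
      ComesFromInfinity lam I' t' R'

/-- The null geodesic through the event `(t₀, R₀)` with incidence angle `α` originates from the
far past (past null infinity), possibly after having crossed the regular center. -/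
def OriginatesFromFarPast (lam t₀ R₀ α : ℝ) : Prop :=
  ∃ (I : Set ℝ) (t R φ pt pR : ℝ → ℝ) (ell : ℝ),
    IsRegistered lam I t R φ pt pR ell t₀ R₀ α ∧
    (ComesFromInfinity lam I t R ∨ ComesFromInfinityThroughCenter lam I t R φ)

/-- `a` is a critical angle of incidence at the event `(t₀, R₀)`: it separates the null geodesics
emanating from the central singularity from those originating from the far past. -/
def IsCriticalAngle (lam t₀ R₀ a : ℝ) : Prop :=
  a ∈ Set.Icc 0 Real.pi ∧
  (∀ α ∈ Set.Ioo a (2 * Real.pi - a), EmanatesFromSingularity lam t₀ R₀ α) ∧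
  (∀ α ∈ Set.Icc 0 (2 * Real.pi), α ∉ Set.Icc a (2 * Real.pi - a) →
    OriginatesFromFarPast lam t₀ R₀ α)

/-- `β_c = 1 / √W(x_c)`. -/
def betaC (lam xc : ℝ) : ℝ := 1 / Real.sqrt (W lam xc)

/-- `-(F + x Q) / (x + F Q)` at the critical impact parameter. -/
def cosUpper (lam xc x : ℝ) : ℝ :=
  -((F lam x + x * Q lam (betaC lam xc) x) / (x + F lam x * Q lam (betaC lam xc) x))

/-- `-(F - x Q) / (x - F Q)` at the critical impact parameter. -/
def cosLower (lam xc x : ℝ) : ℝ :=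
  -((F lam x - x * Q lam (betaC lam xc) x) / (x - F lam x * Q lam (betaC lam xc) x))

/-- The piecewise formula for the critical angle (at `x = J₂` the quotient in it reads `0 / 0`). -/
def alphaHat (lam J₁ xc x : ℝ) : ℝ :=
  if x < J₁ then Real.pi
  else if x < xc then Real.arccos (cosUpper lam xc x)
  else Real.arccos (cosLower lam xc x)

/-- The limit of the cosine of the critical angle at `J₂`. -/
def cosLimit (lam xc J₂ : ℝ) : ℝ :=
  (1 - betaC lam xc ^ 2 * (J₂ ^ 2 / S lam J₂ ^ 2)) /
    (1 + betaC lam xc ^ 2 * (J₂ ^ 2 / S lam J₂ ^ 2))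

end

end SelfSimilarDust

/-! The metric is self-similar, so a null geodesic conserves not only its angular momentum but also
its product with the homothetic field `t ∂_t + R ∂_R`. The ratio of the two fixes an impact
parameter β. With b = β², the motion of x = t/R is that of a particle in a potential: (normalized
velocity)² = 1 - b W (`radial_sq`). For λ < λ* the potential is positive between J₁ and J₂, with a
barrier whose top is at x_c.

Rays are followed into the past. Those that move to smaller x with b W(x_c) < 1 pass the barrier and
come from the far past. Those that approach it from x > x_c with b W(x_c) > 1 are reflected and end
in the singularity. On the other side of the barrier, for J₁ < x < x_c, the roles are exchanged:
only rays that move to larger x with b W(x_c) < 1 cross and reach the singularity. The separating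
rays have b = 1/W(x_c) = β_c². This is a quadratic equation for cos α, whose solution is `critCos`;
the sign of its root changes at x_c, where the root vanishes. The dichotomy is
`collapses_of_lt_critCos` and `escapes_of_critCos_lt`. For x < J₁ nothing can hold a ray back, and
every ray escapes (`escapes_of_gt`), apart from the radially outgoing one, which meets the regular
center and is continued there (`originates_of_outgoing`).

The coordinate u = (1 - λx)^(1/3) makes all of this polynomial: with P = `polyP` and Q = `polyQ` one
has F = P/(3λu) and x = Q/(3λu), and x decreases as u increases. With a suitable parameter θ,
increasing towards the past, (log u, α) obeys an autonomous system with bounded right-hand side, so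
all trajectories are global, and log R and log(dt/ds) follow by quadrature. Asymptotics come from
compactness: a quantity with positive continuous drift on a compact set tends to infinity
(`tendsto_atTop_of_drift`).

Emanating and originating are existence statements about geodesics on arbitrary intervals. That they
exclude each other (`not_originates_of_emanates`) rests on uniqueness for the geodesic equations,
and it yields uniqueness of the critical angle. -/

namespace SelfSimilarDust

open Set

/-! ### Tools for ordinary differential equations. -/

/-- A bounded `C¹` vector field has a global integral curve through every point. -/
theorem exists_global_integralCurve {E : Type*} [NormedAddCommGroup E] [NormedSpace ℝ E]
    [ProperSpace E] [CompleteSpace E] {f : E → E} (hf : ContDiff ℝ 1 f) {M : ℝ}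
    (hM : ∀ z, ‖f z‖ ≤ M) (z₀ : E) :
    ∃ γ : ℝ → E, γ 0 = z₀ ∧ ∀ θ, HasDerivAt γ (f (γ θ)) θ := by
  have hM0 : 0 ≤ M := (norm_nonneg _).trans (hM z₀)
  -- The existence time `1 / (M + 1)` is the same for every starting point: at speed at most `M` a
  -- solution stays in the unit ball that long. A uniform time is what allows local solutions to be
  -- glued into a global one.
  have hlocal : ∀ z : E, ∃ γ : ℝ → E, γ 0 = z ∧
      IsMIntegralCurveOn (I := modelWithCornersSelf ℝ E) γ f (Ioo (-(1 / (M + 1))) (1 / (M + 1))) := by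
    intro z
    obtain ⟨K, hK⟩ := (hf.locallyLipschitz.locallyLipschitzOn
      (s := Metric.closedBall z 1)).exists_lipschitzOnWith_of_compact
      (isCompact_closedBall z 1)
    have hpos : 0 < 1 / (M + 1) := by positivity
    have hPL : IsPicardLindelof (fun _ ↦ f) (tmin := -(1 / (M + 1))) (tmax := 1 / (M + 1))
        ⟨0, by constructor <;> linarith⟩ z 1 0 ⟨M, hM0⟩ K := by
      refine IsPicardLindelof.of_time_independent (fun x _ => hM x) (by simpa using hK) ?_
      simp only [sub_zero, zero_sub, neg_neg, max_self, NNReal.coe_one, NNReal.coe_zero]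
      change M * (1 / (M + 1)) ≤ 1
      rw [mul_one_div, div_le_one (by positivity)]
      linarith
    obtain ⟨γ, h0, hγ⟩ := hPL.exists_eq_forall_mem_Icc_hasDerivWithinAt₀
    refine ⟨γ, h0, fun t ht => ?_⟩
    have := (hγ t (Ioo_subset_Icc_self ht)).mono Ioo_subset_Icc_self
    exact this.hasFDerivWithinAt.hasMFDerivWithinAt
  obtain ⟨γ, h0, hγ⟩ := exists_isMIntegralCurve_of_isMIntegralCurveOn
    (I := modelWithCornersSelf ℝ E) (v := f)
    (contMDiff_vectorSpace_iff_contDiff.2 hf)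
    (by positivity : 0 < 1 / (M + 1)) hlocal z₀
  refine ⟨γ, h0, fun θ => ?_⟩
  have := (hγ θ).hasFDerivAt
  exact hasDerivAt_iff_hasFDerivAt.2 this

theorem exists_antideriv {f : ℝ → ℝ} (hf : Continuous f) (c : ℝ) :
    ∃ g : ℝ → ℝ, g 0 = c ∧ ∀ θ, HasDerivAt g (f θ) θ := by
  refine ⟨fun θ => c + ∫ τ in (0 : ℝ)..θ, f τ, by simp, fun θ => ?_⟩
  exact (intervalIntegral.integral_hasDerivAt_right (hf.intervalIntegrable _ _)
    (hf.stronglyMeasurableAtFilter _ _) hf.continuousAt).const_add c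

/-- A differentiable function whose derivative is positive whenever it takes the value `a` cannot
drop below `a`. -/
theorem le_of_deriv_pos_of_eq {f f' : ℝ → ℝ} {a θ₀ : ℝ} (hf : ∀ θ, HasDerivAt f (f' θ) θ)
    (h₀ : a ≤ f θ₀) (h : ∀ θ, θ₀ ≤ θ → f θ = a → 0 < f' θ) : ∀ θ, θ₀ ≤ θ → a ≤ f θ := by
  intro θ hθ
  have := image_le_of_deriv_right_lt_deriv_boundary (f := fun τ => -f τ) (f' := fun τ => -f' τ)
    (a := θ₀) (b := θ) (B := fun _ => -a) (B' := fun _ => 0)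
    (fun τ _ => (hf τ).continuousAt.neg.continuousWithinAt)
    (fun τ _ => (hf τ).neg.hasDerivWithinAt) (by linarith)
    (fun τ => hasDerivAt_const _ _)
    (fun τ hτ e => by have := h τ hτ.1 (by linarith); linarith) ⟨hθ, le_rfl⟩
  linarith

theorem exists_first_zero {f : ℝ → ℝ} (hf : Continuous f) {θ₀ θ₁ : ℝ} (h01 : θ₀ ≤ θ₁)
    (h₀ : 0 < f θ₀) (h₁ : f θ₁ ≤ 0) :
    ∃ T, θ₀ < T ∧ T ≤ θ₁ ∧ f T = 0 ∧ ∀ θ, θ₀ ≤ θ → θ < T → 0 < f θ := by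
  have hne : (Icc θ₀ θ₁ ∩ f ⁻¹' {0}).Nonempty := by
    obtain ⟨z, hz, hz0⟩ := intermediate_value_Icc' h01 hf.continuousOn ⟨h₁, h₀.le⟩
    exact ⟨z, hz, hz0⟩
  have hcomp : IsCompact (Icc θ₀ θ₁ ∩ f ⁻¹' {0}) :=
    isCompact_Icc.inter_right (isClosed_singleton.preimage hf)
  obtain ⟨T, ⟨hT, hT0⟩, hmin⟩ := hcomp.exists_isLeast hne
  have hT0' : f T = 0 := hT0
  refine ⟨T, lt_of_le_of_ne hT.1 (fun e => by rw [← e] at hT0'; linarith), hT.2, hT0', ?_⟩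
  intro θ h1 h2
  by_contra hneg
  obtain ⟨z, hz, hz0⟩ := intermediate_value_Icc' h1 hf.continuousOn ⟨not_lt.mp hneg, h₀.le⟩
  have := hmin ⟨⟨hz.1, hz.2.trans (h2.le.trans hT.2)⟩, hz0⟩
  linarith [hz.2]

theorem tendsto_atTop_of_deriv_ge {f f' : ℝ → ℝ} (hf : ∀ θ, HasDerivAt f (f' θ) θ)
    {δ θ₀ : ℝ} (hδ : 0 < δ) (h : ∀ θ, θ₀ ≤ θ → δ ≤ f' θ) : Tendsto f atTop atTop := by
  have key : ∀ θ, θ₀ ≤ θ → f θ₀ + δ * (θ - θ₀) ≤ f θ := by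
    intro θ hθ
    have := (convex_Icc θ₀ θ).mul_sub_le_image_sub_of_le_deriv (f := f) (C := δ)
      (fun τ _ => (hf τ).continuousAt.continuousWithinAt)
      (fun τ _ => (hf τ).differentiableAt.differentiableWithinAt)
      (fun τ hτ => by
        rw [(hf τ).deriv]
        rw [interior_Icc] at hτ
        exact h τ hτ.1.le)
      θ₀ ⟨le_rfl, hθ⟩ θ ⟨hθ, le_rfl⟩ hθ
    linarith
  refine tendsto_atTop_mono' _ ((eventually_ge_atTop θ₀).mono key) ?_
  exact tendsto_atTop_add_const_left _ _
    ((tendsto_atTop_add_const_right _ _ tendsto_id).const_mul_atTop hδ)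

/-- A function driven by a positive continuous rate along a curve confined to a compact set tends
to infinity. -/
theorem tendsto_atTop_of_drift {f f' : ℝ → ℝ} (hf : ∀ θ, HasDerivAt f (f' θ) θ)
    {X : Type*} [TopologicalSpace X] {K : Set X} (hK : IsCompact K) {z : ℝ → X} {θ₀ : ℝ}
    (hz : ∀ θ, θ₀ ≤ θ → z θ ∈ K) {g : X → ℝ} (hg : ContinuousOn g K) (hpos : ∀ y ∈ K, 0 < g y)
    (h : ∀ θ, θ₀ ≤ θ → g (z θ) ≤ f' θ) : Tendsto f atTop atTop := by
  obtain ⟨y, hy, hmin⟩ := hK.exists_isMinOn ⟨_, hz θ₀ le_rfl⟩ hg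
  exact tendsto_atTop_of_deriv_ge hf (hpos y hy) fun θ hθ => (hmin (hz θ hθ)).trans (h θ hθ)

theorem monotoneOn_of_hasDerivAt_nonneg {f f' : ℝ → ℝ} {D : Set ℝ} (hD : Convex ℝ D)
    (hf : ∀ θ, HasDerivAt f (f' θ) θ) (h : ∀ θ ∈ interior D, 0 ≤ f' θ) : MonotoneOn f D :=
  monotoneOn_of_deriv_nonneg hD (fun τ _ => (hf τ).continuousAt.continuousWithinAt)
    (fun τ _ => (hf τ).differentiableAt.differentiableWithinAt)
    (fun τ hτ => by rw [(hf τ).deriv]; exact h τ hτ)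

theorem antitoneOn_of_hasDerivAt_nonpos {f f' : ℝ → ℝ} {D : Set ℝ} (hD : Convex ℝ D)
    (hf : ∀ θ, HasDerivAt f (f' θ) θ) (h : ∀ θ ∈ interior D, f' θ ≤ 0) : AntitoneOn f D :=
  antitoneOn_of_deriv_nonpos hD (fun τ _ => (hf τ).continuousAt.continuousWithinAt)
    (fun τ _ => (hf τ).differentiableAt.differentiableWithinAt)
    (fun τ hτ => by rw [(hf τ).deriv]; exact h τ hτ)

theorem const_of_hasDerivAt_zero {f f' : ℝ → ℝ} (hf : ∀ θ, HasDerivAt f (f' θ) θ)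
    (h : ∀ θ, f' θ = 0) (θ : ℝ) : f θ = f 0 :=
  is_const_of_deriv_eq_zero (fun τ => (hf τ).differentiableAt)
    (fun τ => by rw [(hf τ).deriv, h]) θ 0

/-- Inverse of a decreasing change of parameter. -/
theorem exists_decreasing_reparam {s s' : ℝ → ℝ} (hs : ∀ θ, HasDerivAt s (s' θ) θ)
    (hneg : ∀ θ, s' θ < 0) :
    IsOpen (range s) ∧ (range s).OrdConnected ∧ StrictAnti s ∧
      ∃ T : ℝ → ℝ, (∀ θ, T (s θ) = θ) ∧
        ∀ θ, HasDerivAt T (s' θ)⁻¹ (s θ) := by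
  have hanti : StrictAnti s := strictAnti_of_hasDerivAt_neg hs hneg
  have hcont : Continuous s := continuous_iff_continuousAt.2 fun θ => (hs θ).continuousAt
  have hord : (range s).OrdConnected := (isPreconnected_range hcont).ordConnected
  have hemb : ∀ θ, range s ∈ 𝓝 (s θ) := by
    intro θ
    have h1 : s (θ + 1) < s θ := hanti (by linarith)
    have h2 : s θ < s (θ - 1) := hanti (by linarith)
    exact mem_of_superset (Icc_mem_nhds h1 h2) (hord.out ⟨_, rfl⟩ ⟨_, rfl⟩)
  have hopen : IsOpen (range s) := by
    rw [isOpen_iff_mem_nhds]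
    rintro _ ⟨θ, rfl⟩
    exact hemb θ
  refine ⟨hopen, hord, hanti, Function.invFun s, Function.leftInverse_invFun hanti.injective, ?_⟩
  have hinv := Function.leftInverse_invFun hanti.injective
  intro θ
  refine HasDerivAt.of_local_left_inverse (f := s) ?_ ?_ (hneg θ).ne ?_
  · rw [ContinuousAt, hinv θ]
    refine tendsto_order.2 ⟨fun a ha => ?_, fun a ha => ?_⟩
    · filter_upwards [hemb θ, Iio_mem_nhds (hanti ha)] with y hy hya
      obtain ⟨τ, rfl⟩ := hy
      rw [hinv τ]
      exact hanti.lt_iff_gt.1 hya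
    · filter_upwards [hemb θ, Ioi_mem_nhds (hanti ha)] with y hy hya
      obtain ⟨τ, rfl⟩ := hy
      rw [hinv τ]
      exact hanti.lt_iff_gt.1 hya
  · rw [hinv θ]; exact hs θ
  · filter_upwards [hemb θ] with y hy
    obtain ⟨τ, rfl⟩ := hy
    rw [hinv τ]

/-- Two solutions of an autonomous `C¹` system that agree at one time agree on an interval. -/
theorem eqOn_of_ode {E : Type*} [NormedAddCommGroup E] [NormedSpace ℝ E] {v : E → E}
    {I : Set ℝ} (hI : I.OrdConnected) (hIo : IsOpen I) {f g : ℝ → E}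
    (hv : ∀ s ∈ I, ContDiffAt ℝ 1 v (f s))
    (hf : ∀ s ∈ I, HasDerivAt f (v (f s)) s) (hg : ∀ s ∈ I, HasDerivAt g (v (g s)) s)
    {s₀ : ℝ} (hs₀ : s₀ ∈ I) (h₀ : f s₀ = g s₀) : EqOn f g I := by
  have hloc : ∀ s ∈ I, f s = g s → f =ᶠ[𝓝 s] g := by
    intro s hs hfg
    obtain ⟨K, U, hU, hK⟩ := (hv s hs).exists_lipschitzOnWith
    have hI' := hIo.mem_nhds hs
    refine ODE_solution_unique_of_eventually (v := fun _ => v) (s := fun _ => U) (K := K)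
      (Eventually.of_forall fun _ => hK) ?_ ?_ hfg
    · filter_upwards [hI', (hf s hs).continuousAt hU] with τ hτ hτU using ⟨hf τ hτ, hτU⟩
    · rw [hfg] at hU
      filter_upwards [hI', (hg s hs).continuousAt hU] with τ hτ hτU using ⟨hg τ hτ, hτU⟩
  have hsub : I ⊆ {s | f =ᶠ[𝓝 s] g} := by
    refine hI.isPreconnected.subset_of_closure_inter_subset isOpen_setOfPred_eventually_nhds
      ⟨s₀, hs₀, hloc s₀ hs₀ h₀⟩ ?_
    rintro s ⟨hcl, hs⟩
    refine hloc s hs (tendsto_nhds_unique_of_frequently_eq (hf s hs).continuousAt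
      (hg s hs).continuousAt ?_)
    exact (mem_closure_iff_frequently.1 hcl).mono fun τ hτ => EventuallyEq.eq_of_nhds hτ
  exact fun s hs => EventuallyEq.eq_of_nhds (hsub hs)

/-! ### The shape of the potential in the coordinate u. -/

/-- `λ (2 + u³)`, which is `3 λ u F` for `u = (1 - λ x)^(1/3)`. -/
def polyP (lam u : ℝ) : ℝ := lam * (2 + u ^ 3)

/-- `3 u (1 - u³)`, which is `3 λ u x` for `u = (1 - λ x)^(1/3)`. -/
def polyQ (u : ℝ) : ℝ := 3 * u * (1 - u ^ 3)

/-- The effective potential as a function of `u = (1 - λ x)^(1/3)`. -/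
noncomputable def pot (lam u : ℝ) : ℝ := (polyQ u ^ 2 - polyP lam u ^ 2) / (9 * lam ^ 2 * u ^ 6)

/-- The derivative of `pot` is a negative multiple of this polynomial. -/
def slope (lam u : ℝ) : ℝ := 3 * u ^ 2 * (1 - u ^ 3) - 2 * lam ^ 2

theorem polyP_pos {lam u : ℝ} (hlam : 0 < lam) (hu : 0 < u) : 0 < polyP lam u := by
  unfold polyP; positivity

theorem polyQ_pos {u : ℝ} (h0 : 0 < u) (h1 : u < 1) : 0 < polyQ u := by
  have : u ^ 3 < 1 := pow_lt_one₀ h0.le h1 (by norm_num)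
  unfold polyQ
  exact mul_pos (by linarith) (by linarith)

theorem hasDerivAt_pot {lam u : ℝ} (hlam : lam ≠ 0) (hu : u ≠ 0) :
    HasDerivAt (pot lam) (-(2 * (2 + u ^ 3) * slope lam u / (3 * lam ^ 2 * u ^ 7))) u := by
  have h3 := hasDerivAt_pow 3 u
  have hp : HasDerivAt (polyP lam) (lam * (3 * u ^ 2)) u := 
    ((h3.const_add 2).const_mul lam).congr_deriv (by simp)
  have hq : HasDerivAt polyQ (3 - 12 * u ^ 3) u := by
    have := ((hasDerivAt_id u).const_mul 3).mul (h3.const_sub 1)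
    refine this.congr_deriv ?_
    simp; ring
  have hd : HasDerivAt (fun u : ℝ => 9 * lam ^ 2 * u ^ 6) (9 * lam ^ 2 * (6 * u ^ 5)) u := by
    simpa using (hasDerivAt_pow 6 u).const_mul (9 * lam ^ 2)
  have := ((hq.pow 2).sub (hp.pow 2)).div hd (by positivity)
  refine this.congr_deriv ?_
  simp only [polyP, polyQ, slope, Pi.pow_apply, Pi.sub_apply]
  field_simp
  ring

/-- The shape of the potential: `a₂ < u₁ < a₁ < a₀` are the values of `u` at the zeros `J₂`, `J₁`,
`J₀` of `W` and at its maximum point `x_c` (between the first two). -/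
structure Landscape (lam a₂ u₁ a₁ a₀ : ℝ) : Prop where
  lam_pos : 0 < lam
  lam_lt : 2 * lam < 3
  a₂_pos : 0 < a₂
  a₂_lt : a₂ < u₁
  u₁_lt : u₁ < a₁
  a₁_lt : a₁ < 1
  one_lt : 1 < a₀
  eq_a₂ : polyP lam a₂ = polyQ a₂
  eq_a₁ : polyP lam a₁ = polyQ a₁
  eq_a₀ : polyP lam a₀ = -polyQ a₀
  gt_of_lt : ∀ u, 0 < u → u < a₂ → polyQ u < polyP lam u
  lt_of_mem : ∀ u, a₂ < u → u < a₁ → polyP lam u < polyQ u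
  gt_of_gt : ∀ u, a₁ < u → polyQ u < polyP lam u
  add_pos : ∀ u, 0 < u → u < a₀ → 0 < polyP lam u + polyQ u
  add_neg : ∀ u, a₀ < u → polyP lam u + polyQ u < 0
  slope_neg : ∀ u, 0 < u → u < u₁ → slope lam u < 0
  slope_u₁ : slope lam u₁ = 0
  slope_pos : ∀ u, u₁ < u → u ≤ a₁ → 0 < slope lam u
  slope_neg_of_zero : ∀ u v, a₁ < u → slope lam u = 0 → u < v → slope lam v < 0

/-- The witness w = (√3 - 1)/2^(1/3) has w³ = 3√3 - 5, the positive root of y² + 10y = 2. It is the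
critical point on (0, 1) of 3u(1 - u³)/(2 + u³), whose value there is λ*; so λ < λ* says exactly
that P < Q at w. -/
theorem exists_polyP_lt_polyQ {lam : ℝ} (h : lam < lambdaStar) :
    ∃ u : ℝ, 0 < u ∧ u < 1 ∧ (u ^ 3) ^ 2 + 10 * u ^ 3 = 2 ∧ polyP lam u < polyQ u := by
  have h3 : (Real.sqrt 3) ^ 2 = 3 := Real.sq_sqrt (by norm_num)
  have h1 : 1 < Real.sqrt 3 := by
    rw [Real.lt_sqrt (by norm_num)]; norm_num
  have h2 : Real.sqrt 3 < 2 := by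
    rw [Real.sqrt_lt' (by norm_num)]; norm_num
  set r := Real.sqrt 3 with hr
  set c : ℝ := (2 : ℝ) ^ (1 / 3 : ℝ) with hc
  have hc0 : 0 < c := by positivity
  have hc3 : c ^ 3 = 2 := by
    rw [hc, ← Real.rpow_natCast, ← Real.rpow_mul (by norm_num)]; norm_num
  have hcub : ((r - 1) / c) ^ 3 = 3 * r - 5 := by
    rw [div_pow, hc3]; linear_combination ((r - 3) / 2 ) * h3
  have hu0 : 0 < (r - 1) / c := div_pos (by linarith) hc0
  refine ⟨(r - 1) / c, hu0, ?_, ?_, ?_⟩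
  · by_contra hge
    have : 1 ≤ ((r - 1) / c) ^ 3 := one_le_pow₀ (not_lt.1 hge)
    nlinarith
  · rw [hcub]; linear_combination 9 * h3
  · unfold polyP polyQ
    rw [hcub]
    have hl : lam < 3 * (2 - r) / c := h
    calc lam * (2 + (3 * r - 5)) < 3 * (2 - r) / c * (2 + (3 * r - 5)) :=
          mul_lt_mul_of_pos_right hl (by linarith)
      _ = 3 * ((r - 1) / c) * (1 - (3 * r - 5)) := by field_simp; ring

/-- The divided difference `e3` of the two equations eliminates the remaining coefficients. For
positive λ, a, b the quadratic cofactor is positive on u > 0, so the quartic P - Q has no further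
positive zeros. -/
theorem polyP_sub_polyQ_eq {lam a b : ℝ} (ha : polyP lam a = polyQ a) (hb : polyP lam b = polyQ b)
    (hab : b < a) (u : ℝ) : polyP lam u - polyQ u = (u - b) * (u - a) *
      (3 * u ^ 2 + (lam + 3 * (a + b)) * u + ((a + b) * lam + 3 * (a + b) ^ 2 - 3 * (a * b))) := by
  unfold polyP polyQ at *
  have e3 : 3 * (a ^ 3 + a ^ 2 * b + a * b ^ 2 + b ^ 3) + lam * (a ^ 2 + a * b + b ^ 2) - 3 = 0 := by
    apply mul_left_cancel₀ (sub_pos.2 hab).ne'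
    linear_combination ha - hb
  linear_combination (u - a) * e3 + ha

theorem polyP_sub_polyQ_cofactor_pos {lam a b u : ℝ} (hlam : 0 < lam) (ha : 0 < a) (hb : 0 < b)
    (hu : 0 < u) : 0 < 3 * u ^ 2 + (lam + 3 * (a + b)) * u +
      ((a + b) * lam + 3 * (a + b) ^ 2 - 3 * (a * b)) := by
  have h1 : 0 ≤ 3 * (a + b) ^ 2 - 3 * (a * b) := by nlinarith
  have h2 : 0 < (a + b) * lam := by positivity
  have h3 : 0 < 3 * u ^ 2 + (lam + 3 * (a + b)) * u := by positivity
  linarith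

/-- For positive a and λ the second factor is positive on u > 0, so P + Q changes sign only at a. -/
theorem polyP_add_polyQ_mul_eq {lam a : ℝ} (ha : polyP lam a = -polyQ a) (u : ℝ) :
    (polyP lam u + polyQ u) * a ^ 3 = (a - u) *
      (2 * lam * (a ^ 2 + a * u + u ^ 2) + 3 * u * a * (a + u) + 3 * u ^ 3 * a ^ 3) := by
  unfold polyP polyQ at *
  linear_combination u ^ 3 * ha

/-- At a zero of P - Q the parameter λ is a function of a. The sign of the slope for 0 < a < 1 is
then that of y² + 10y - 2 with y = a³: negative below the point w of `exists_polyP_lt_polyQ`,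
positive above it. -/
theorem slope_mul_eq {lam a : ℝ} (ha : polyP lam a = polyQ a) :
    slope lam a * (2 + a ^ 3) ^ 2 = 3 * a ^ 2 * (1 - a ^ 3) * ((a ^ 3) ^ 2 + 10 * a ^ 3 - 2) := by
  unfold polyP polyQ at ha
  unfold slope
  linear_combination (-2 * (lam * (2 + a ^ 3)) - 6 * a * (1 - a ^ 3)) * ha

/-- The factor of the slope besides `u - u₁`. -/
def slopeFactor (u₁ u : ℝ) : ℝ :=
  u + u₁ - (u ^ 4 + u ^ 3 * u₁ + u ^ 2 * u₁ ^ 2 + u * u₁ ^ 3 + u₁ ^ 4)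

theorem slope_eq {lam u₁ : ℝ} (h : slope lam u₁ = 0) (u : ℝ) :
    slope lam u = 3 * (u - u₁) * slopeFactor u₁ u := by
  unfold slope at *
  unfold slopeFactor
  linear_combination h

/-- Concavity, in the form of the chord inequality on [0, v]; `u₁ - u₁ ^ 4` is the value at 0. -/
theorem slopeFactor_concave {u₁ u v : ℝ} (h₁ : 0 < u₁) (hu : 0 < u) (huv : u ≤ v) :
    u * slopeFactor u₁ v + (v - u) * (u₁ - u₁ ^ 4) ≤ v * slopeFactor u₁ u := by
  have hv : 0 < v := hu.trans_le huv
  have h : u ^ 3 + u ^ 2 * u₁ + u * u₁ ^ 2 ≤ v ^ 3 + v ^ 2 * u₁ + v * u₁ ^ 2 := by gcongr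
  unfold slopeFactor
  nlinarith [mul_le_mul_of_nonneg_left h (mul_pos hu hv).le]

theorem slope_neg_of_eq {lam a w : ℝ} (h0 : 0 < a) (haw : a < w) (hw1 : w < 1)
    (hw : (w ^ 3) ^ 2 + 10 * w ^ 3 = 2) (ha : polyP lam a = polyQ a) : slope lam a < 0 := by
  have hlt : a ^ 3 < w ^ 3 := pow_lt_pow_left₀ haw h0.le (by norm_num)
  have hp : 0 < a ^ 3 := by positivity
  have h1' : a ^ 3 < 1 := pow_lt_one₀ h0.le (haw.trans hw1) (by norm_num)
  have hneg : (a ^ 3) ^ 2 + 10 * a ^ 3 - 2 < 0 := by nlinarith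
  have : 3 * a ^ 2 * (1 - a ^ 3) * ((a ^ 3) ^ 2 + 10 * a ^ 3 - 2) < 0 :=
    mul_neg_of_pos_of_neg (mul_pos (by positivity) (by linarith)) hneg
  rw [← slope_mul_eq ha] at this
  exact neg_of_mul_neg_left this (by positivity)

theorem slope_pos_of_eq {lam a w : ℝ} (h0 : 0 < w) (haw : w < a) (ha1 : a < 1)
    (hw : (w ^ 3) ^ 2 + 10 * w ^ 3 = 2) (ha : polyP lam a = polyQ a) : 0 < slope lam a := by
  have hlt : w ^ 3 < a ^ 3 := pow_lt_pow_left₀ haw h0.le (by norm_num)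
  have hp : 0 < w ^ 3 := by positivity
  have ha0 : 0 < a := h0.trans haw
  have h1' : a ^ 3 < 1 := pow_lt_one₀ ha0.le ha1 (by norm_num)
  have hpos : 0 < (a ^ 3) ^ 2 + 10 * a ^ 3 - 2 := by nlinarith
  have : 0 < 3 * a ^ 2 * (1 - a ^ 3) * ((a ^ 3) ^ 2 + 10 * a ^ 3 - 2) :=
    mul_pos (mul_pos (by positivity) (by linarith)) hpos
  rw [← slope_mul_eq ha] at this
  exact pos_of_mul_pos_left this (by positivity)

theorem landscape_of_zeros {lam a₂ u₁ a₁ a₀ : ℝ} (hlam : 0 < lam) (hl3 : 2 * lam < 3)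
    (h20 : 0 < a₂) (hu2 : a₂ < u₁) (hu1 : u₁ < a₁) (h11 : a₁ < 1) (h01 : 1 < a₀)
    (e2 : polyP lam a₂ = polyQ a₂) (e1 : polyP lam a₁ = polyQ a₁) (e0 : polyP lam a₀ = -polyQ a₀)
    (hu : slope lam u₁ = 0) (hs1 : 0 < slope lam a₁) : Landscape lam a₂ u₁ a₁ a₀ := by
  have h21 : a₂ < a₁ := hu2.trans hu1
  have h10 : 0 < a₁ := h20.trans h21
  have hu0 : 0 < u₁ := h20.trans hu2
  have ha0 : 0 < a₀ := by linarith
  have hfac := polyP_sub_polyQ_eq e1 e2 h21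
  have hfpos := fun (u : ℝ) (hu : 0 < u) => polyP_sub_polyQ_cofactor_pos hlam h10 h20 hu
  have hfac0 := polyP_add_polyQ_mul_eq e0
  have hsfac := slope_eq hu
  have hu14 : 0 < u₁ - u₁ ^ 4 := by
    have : u₁ ^ 3 < 1 := pow_lt_one₀ hu0.le (by linarith) (by norm_num)
    nlinarith
  have hb1 : 0 < slopeFactor u₁ a₁ := by
    rw [hsfac] at hs1
    exact pos_of_mul_pos_right hs1 (by linarith)
  -- The chord from 0 to `a₁` is positive at both ends.
  have hb : ∀ u, 0 < u → u ≤ a₁ → 0 < slopeFactor u₁ u := by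
    intro u h0 hua
    have h1 := slopeFactor_concave hu0 h0 hua
    have h2 : 0 < u * slopeFactor u₁ a₁ := mul_pos h0 hb1
    have h3 : 0 ≤ (a₁ - u) * (u₁ - u₁ ^ 4) := mul_nonneg (by linarith) hu14.le
    exact pos_of_mul_pos_right (a := a₁) (by linarith) h10.le
  refine ⟨hlam, hl3, h20, hu2, hu1, h11, h01, e2, e1, e0, ?_, ?_, ?_, ?_, ?_, ?_, hu, ?_, ?_⟩
  · intro u h0 hlt
    have := mul_pos (mul_pos_of_neg_of_neg (sub_neg.2 hlt) (sub_neg.2 (hlt.trans h21))) (hfpos u h0)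
    rw [← hfac u] at this; linarith
  · intro u h0 hlt
    have := mul_neg_of_neg_of_pos (mul_neg_of_pos_of_neg (sub_pos.2 h0) (sub_neg.2 hlt))
      (hfpos u (h20.trans h0))
    rw [← hfac u] at this; linarith
  · intro u h0
    have := mul_pos (mul_pos (sub_pos.2 (h21.trans h0)) (sub_pos.2 h0)) (hfpos u (h10.trans h0))
    rw [← hfac u] at this; linarith
  · intro u h0 hlt
    have : 0 < (polyP lam u + polyQ u) * a₀ ^ 3 := by
      rw [hfac0]; exact mul_pos (by linarith) (by positivity)
    exact pos_of_mul_pos_left this (by positivity)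
  · intro u h0
    have hup : 0 < u := ha0.trans h0
    have : (polyP lam u + polyQ u) * a₀ ^ 3 < 0 := by
      rw [hfac0]; exact mul_neg_of_neg_of_pos (by linarith) (by positivity)
    exact neg_of_mul_neg_left this (by positivity)
  · intro u h0 hlt
    rw [hsfac]
    exact mul_neg_of_neg_of_pos (by linarith) (hb u h0 (by linarith))
  · intro u hlt hle
    rw [hsfac]
    exact mul_pos (by linarith) (hb u (by linarith) hle)
  -- A zero beyond `a₁` is one of the cofactor. Since the cofactor is positive at 0, the chord
  -- inequality makes it negative after that zero. This will exclude further local maxima of W.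
  · intro u v hau hzero huv
    have hup : 0 < u := h10.trans hau
    have hbu : slopeFactor u₁ u = 0 := by
      rw [hsfac] at hzero
      exact (mul_eq_zero.1 hzero).resolve_left (by intro; linarith)
    rw [hsfac]
    refine mul_neg_of_pos_of_neg (by linarith) ?_
    refine neg_of_mul_neg_right (a := u) ?_ hup.le
    have h1 := slopeFactor_concave hu0 hup huv.le
    have h3 : 0 < (v - u) * (u₁ - u₁ ^ 4) := mul_pos (by linarith) hu14
    rw [hbu] at h1
    linarith

theorem exists_landscape {lam : ℝ} (hlam : 0 < lam) (h : lam < lambdaStar) :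
    ∃ a₂ u₁ a₁ a₀, Landscape lam a₂ u₁ a₁ a₀ := by
  obtain ⟨us, hus0, hus1, husw, huslt⟩ := exists_polyP_lt_polyQ h
  -- From λ(2 + w³) < 3w(1 - w³) < 3.
  have hl3 : 2 * lam < 3 := by
    unfold polyP polyQ at huslt
    have : 0 < us ^ 3 := by positivity
    nlinarith [mul_pos hlam this]
  have hcP : Continuous (polyP lam) := by unfold polyP; fun_prop
  have hcQ : Continuous polyQ := by unfold polyQ; fun_prop
  have hcf : Continuous fun u => polyP lam u - polyQ u := hcP.sub hcQ
  have hcs : Continuous (slope lam) := by unfold slope; fun_prop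
  obtain ⟨a₂, ⟨h20, h2s⟩, h2⟩ := intermediate_value_Ioo' hus0.le hcf.continuousOn
    (show (0 : ℝ) ∈ _ from ⟨by simpa using huslt, by simp [polyP, polyQ, hlam]⟩)
  obtain ⟨a₁, ⟨h1s, h11⟩, h1⟩ := intermediate_value_Ioo hus1.le hcf.continuousOn
    (show (0 : ℝ) ∈ _ from ⟨by simpa using huslt, by simp [polyP, polyQ]; linarith⟩)
  obtain ⟨a₀, ⟨h01, h02⟩, h0⟩ := intermediate_value_Ioo' (show (1 : ℝ) ≤ 2 by norm_num)
    (hcP.add hcQ).continuousOn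
    (show (0 : ℝ) ∈ _ from ⟨by simp [polyP, polyQ]; linarith, by simp [polyP, polyQ]; linarith⟩)
  have e2 : polyP lam a₂ = polyQ a₂ := sub_eq_zero.1 h2
  have e1 : polyP lam a₁ = polyQ a₁ := sub_eq_zero.1 h1
  have e0 : polyP lam a₀ = -polyQ a₀ := eq_neg_of_add_eq_zero_left h0
  have hs1 : 0 < slope lam a₁ := slope_pos_of_eq hus0 h1s h11 husw e1
  obtain ⟨u₁, ⟨hu2, hu1⟩, hu⟩ := intermediate_value_Ioo (h2s.trans h1s).le hcs.continuousOn
    (show (0 : ℝ) ∈ _ from ⟨slope_neg_of_eq h20 h2s hus1 husw e2, hs1⟩)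
  exact ⟨a₂, u₁, a₁, a₀, landscape_of_zeros hlam hl3 h20 hu2 hu1 h11 h01 e2 e1 e0 hu hs1⟩

namespace Landscape

variable {lam a₂ u₁ a₁ a₀ : ℝ}

theorem u₁_pos (H : Landscape lam a₂ u₁ a₁ a₀) : 0 < u₁ := H.a₂_pos.trans H.a₂_lt

theorem a₁_pos (H : Landscape lam a₂ u₁ a₁ a₀) : 0 < a₁ := H.u₁_pos.trans H.u₁_lt

theorem pot_strictMonoOn (H : Landscape lam a₂ u₁ a₁ a₀) : StrictMonoOn (pot lam) (Ioc 0 u₁) := by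
  have hl := H.lam_pos
  refine strictMonoOn_of_deriv_pos (convex_Ioc _ _) (fun u hu =>
    (hasDerivAt_pot hl.ne' hu.1.ne').continuousAt.continuousWithinAt) fun u hu => ?_
  rw [interior_Ioc] at hu
  rw [(hasDerivAt_pot hl.ne' hu.1.ne').deriv, neg_pos]
  have h0 := hu.1
  exact div_neg_of_neg_of_pos (mul_neg_of_pos_of_neg (by positivity) (H.slope_neg u hu.1 hu.2))
    (by positivity)

theorem pot_strictAntiOn (H : Landscape lam a₂ u₁ a₁ a₀) : StrictAntiOn (pot lam) (Icc u₁ a₁) := by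
  have hl := H.lam_pos
  have h1 := H.u₁_pos
  refine strictAntiOn_of_deriv_neg (convex_Icc _ _) (fun u hu =>
    (hasDerivAt_pot hl.ne' (h1.trans_le hu.1).ne').continuousAt.continuousWithinAt) fun u hu => ?_
  rw [interior_Icc] at hu
  have h0 : 0 < u := h1.trans hu.1
  rw [(hasDerivAt_pot hl.ne' h0.ne').deriv, neg_neg_iff_pos]
  exact div_pos (mul_pos (by positivity) (H.slope_pos u hu.1 hu.2.le)) (by positivity)

end Landscape

/-! ### Null geodesics as a flow in (u, α). -/

/-- Null geodesics in the variables `u = (1 - λ t / R)^(1/3)`, the angle `α` of incidence,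
`ρ = log R` and `Λ = log (dt/ds)`, as functions of a parameter which increases towards the past. -/
structure PastFlow (lam : ℝ) (u α ρ Λ : ℝ → ℝ) : Prop where
  u_pos : ∀ θ, 0 < u θ
  deriv_u : ∀ θ, HasDerivAt u
    (u θ * (polyP lam (u θ) + polyQ (u θ) * Real.cos (α θ)) / (1 + u θ ^ 4)) θ
  deriv_α : ∀ θ, HasDerivAt α
    (-(3 * Real.sin (α θ) * (u θ * (u θ ^ 3 + 2) + 2 * lam * Real.cos (α θ)) / (1 + u θ ^ 4))) θ
  deriv_ρ : ∀ θ, HasDerivAt ρ (9 * u θ ^ 4 * Real.cos (α θ) / (1 + u θ ^ 4)) θ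
  deriv_Λ : ∀ θ, HasDerivAt Λ
    (2 * lam * (3 * Real.cos (α θ) ^ 2 - 2 - u θ ^ 3) / (1 + u θ ^ 4)) θ

theorem exists_pastFlow {lam : ℝ} (hlam : 0 < lam) {u₀ : ℝ} (hu₀ : 0 < u₀) (α₀ ρ₀ Λ₀ : ℝ) :
    ∃ u α ρ Λ : ℝ → ℝ, PastFlow lam u α ρ Λ ∧ u 0 = u₀ ∧ α 0 = α₀ ∧ ρ 0 = ρ₀ ∧ Λ 0 = Λ₀ := by
  -- The unknowns are log u and α. This keeps u positive, and the denominator 1 + u⁴ bounds the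
  -- field, so no solution ends at a finite θ.
  let f : ℝ × ℝ → ℝ × ℝ := fun z =>
    ((lam * (2 + Real.exp z.1 ^ 3) + 3 * Real.exp z.1 * (1 - Real.exp z.1 ^ 3) * Real.cos z.2) /
      (1 + Real.exp z.1 ^ 4),
     -(3 * Real.sin z.2 * (Real.exp z.1 * (Real.exp z.1 ^ 3 + 2) + 2 * lam * Real.cos z.2) /
      (1 + Real.exp z.1 ^ 4)))
  have hne : ∀ z : ℝ × ℝ, 1 + Real.exp z.1 ^ 4 ≠ 0 := fun z => by positivity
  have hf : ContDiff ℝ 1 f := by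
    refine ContDiff.prodMk (ContDiff.div ?_ ?_ hne) (ContDiff.neg (ContDiff.div ?_ ?_ hne)) <;>
      fun_prop
  have hM : ∀ z, ‖f z‖ ≤ 9 + 6 * lam := by
    intro z
    have hx := Real.exp_pos z.1
    set x := Real.exp z.1
    have h4 : 0 < 1 + x ^ 4 := by positivity
    have h1 : x ≤ 1 + x ^ 4 := by nlinarith [sq_nonneg (x - 1), sq_nonneg (x ^ 2 - 1)]
    have h3 : x ^ 3 ≤ 1 + x ^ 4 := by nlinarith [sq_nonneg (x - 1), sq_nonneg (x ^ 2 - x), sq_nonneg (x ^ 2 - 1)]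
    have hc := Real.abs_cos_le_one z.2
    have hs := Real.abs_sin_le_one z.2
    rw [Prod.norm_def]
    refine max_le ?_ ?_
    · change |_ / _| ≤ _
      rw [abs_div, abs_of_pos h4, div_le_iff₀ h4]
      calc |lam * (2 + x ^ 3) + 3 * x * (1 - x ^ 3) * Real.cos z.2|
          ≤ |lam * (2 + x ^ 3)| + |3 * x * (1 - x ^ 3)| * |Real.cos z.2| := by
            rw [← abs_mul]; exact abs_add_le _ _
        _ ≤ lam * (2 + x ^ 3) + 3 * (x + x ^ 4) * 1 := by
            refine add_le_add (abs_of_pos (by positivity)).le (mul_le_mul ?_ hc (abs_nonneg _)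
              (by positivity))
            rw [abs_le]
            constructor <;> nlinarith [pow_pos hx 4]
        _ ≤ (9 + 6 * lam) * (1 + x ^ 4) := by nlinarith [mul_le_mul_of_nonneg_left h3 hlam.le, pow_pos hx 4, mul_pos hlam (pow_pos hx 4)]
    · change |-(_ / _)| ≤ _
      rw [abs_neg, abs_div, abs_of_pos h4, div_le_iff₀ h4]
      calc |3 * Real.sin z.2 * (x * (x ^ 3 + 2) + 2 * lam * Real.cos z.2)|
          = 3 * |Real.sin z.2| * |x * (x ^ 3 + 2) + 2 * lam * Real.cos z.2| := by
            rw [abs_mul, abs_mul, abs_of_pos (by norm_num : (0 : ℝ) < 3)]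
        _ ≤ 3 * 1 * (x * (x ^ 3 + 2) + 2 * lam) := by
            refine mul_le_mul (by linarith) ?_ (abs_nonneg _) (by norm_num)
            have hp : 0 < x * (x ^ 3 + 2) := by positivity
            rw [abs_le]
            have := abs_le.1 hc
            constructor <;> nlinarith [mul_le_mul_of_nonneg_left this.1 hlam.le,
              mul_le_mul_of_nonneg_left this.2 hlam.le]
        _ ≤ (9 + 6 * lam) * (1 + x ^ 4) := by nlinarith [pow_pos hx 4, mul_pos hlam (pow_pos hx 4)]
  obtain ⟨γ, h0, hγ⟩ := exists_global_integralCurve hf hM (Real.log u₀, α₀)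
  have hv : ∀ θ, HasDerivAt (fun θ => (γ θ).1) (f (γ θ)).1 θ := fun θ => (hγ θ).fst
  have hα : ∀ θ, HasDerivAt (fun θ => (γ θ).2) (f (γ θ)).2 θ := fun θ => (hγ θ).snd
  have hcv : Continuous fun θ => (γ θ).1 := continuous_iff_continuousAt.2 fun θ => (hv θ).continuousAt
  have hcα : Continuous fun θ => (γ θ).2 := continuous_iff_continuousAt.2 fun θ => (hα θ).continuousAt
  have hne' : ∀ θ : ℝ, 1 + Real.exp (γ θ).1 ^ 4 ≠ 0 := fun θ => hne _
  obtain ⟨ρ, hρ0, hρ⟩ := exists_antideriv (f := fun θ => 9 * Real.exp (γ θ).1 ^ 4 *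
    Real.cos (γ θ).2 / (1 + Real.exp (γ θ).1 ^ 4)) (Continuous.div (by fun_prop) (by fun_prop) hne') ρ₀
  obtain ⟨Λ, hΛ0, hΛ⟩ := exists_antideriv (f := fun θ => 2 * lam * (3 * Real.cos (γ θ).2 ^ 2 - 2 -
    Real.exp (γ θ).1 ^ 3) / (1 + Real.exp (γ θ).1 ^ 4))
    (Continuous.div (by fun_prop) (by fun_prop) hne') Λ₀
  refine ⟨fun θ => Real.exp (γ θ).1, fun θ => (γ θ).2, ρ, Λ, ⟨fun θ => Real.exp_pos _, fun θ => ?_,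
    hα, hρ, hΛ⟩, ?_, ?_, hρ0, hΛ0⟩
  · refine (hv θ).exp.congr_deriv ?_
    simp only [f, polyP, polyQ]
    ring
  · simp [h0, Real.exp_log hu₀]
  · simp [h0]

/-! ### Conserved quantities. -/

/-- The potential momentum `P + Q cos α`; its sign is that of `du/dθ`. -/
def radial (lam u c : ℝ) : ℝ := polyP lam u + polyQ u * c

/-- `Q + P cos α`, a negative multiple of the conserved quantity of the homothety. -/
def homothetic (lam u c : ℝ) : ℝ := polyQ u + polyP lam u * c

theorem continuous_polyP (lam : ℝ) : Continuous (polyP lam) := by unfold polyP; fun_prop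

theorem continuous_polyQ : Continuous polyQ := by unfold polyQ; fun_prop

theorem hasDerivAt_polyP (lam u : ℝ) : HasDerivAt (polyP lam) (3 * lam * u ^ 2) u :=
  (((hasDerivAt_pow 3 u).const_add 2).const_mul lam).congr_deriv (by simp; ring)

theorem hasDerivAt_polyQ (u : ℝ) : HasDerivAt polyQ (3 - 12 * u ^ 3) u := by
  have := ((hasDerivAt_id u).const_mul 3).mul ((hasDerivAt_pow 3 u).const_sub 1)
  refine this.congr_deriv ?_
  simp; ring

namespace PastFlow

variable {lam : ℝ} {u α ρ Λ : ℝ → ℝ}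

theorem continuous_u (H : PastFlow lam u α ρ Λ) : Continuous u :=
  continuous_iff_continuousAt.2 fun θ => (H.deriv_u θ).continuousAt

theorem deriv_cos (H : PastFlow lam u α ρ Λ) (θ : ℝ) : HasDerivAt (fun θ => Real.cos (α θ))
    (3 * (1 - Real.cos (α θ) ^ 2) * (u θ * (u θ ^ 3 + 2) + 2 * lam * Real.cos (α θ)) /
      (1 + u θ ^ 4)) θ := by
  refine (H.deriv_α θ).cos.congr_deriv ?_
  rw [← Real.sin_sq]
  ring

theorem deriv_radial (H : PastFlow lam u α ρ Λ) (θ : ℝ) :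
    HasDerivAt (fun θ => radial lam (u θ) (Real.cos (α θ)))
      (3 * lam * u θ ^ 2 * (u θ * radial lam (u θ) (Real.cos (α θ)) / (1 + u θ ^ 4)) +
        ((3 - 12 * u θ ^ 3) * (u θ * radial lam (u θ) (Real.cos (α θ)) / (1 + u θ ^ 4)) *
          Real.cos (α θ) + polyQ (u θ) * (3 * (1 - Real.cos (α θ) ^ 2) *
            (u θ * (u θ ^ 3 + 2) + 2 * lam * Real.cos (α θ)) / (1 + u θ ^ 4)))) θ :=
  ((hasDerivAt_polyP lam (u θ)).comp θ (H.deriv_u θ)).add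
    (((hasDerivAt_polyQ (u θ)).comp θ (H.deriv_u θ)).mul (H.deriv_cos θ))

theorem deriv_homothetic (H : PastFlow lam u α ρ Λ) (θ : ℝ) :
    HasDerivAt (fun θ => homothetic lam (u θ) (Real.cos (α θ)))
      ((3 - 12 * u θ ^ 3) * (u θ * radial lam (u θ) (Real.cos (α θ)) / (1 + u θ ^ 4)) +
        (3 * lam * u θ ^ 2 * (u θ * radial lam (u θ) (Real.cos (α θ)) / (1 + u θ ^ 4)) *
          Real.cos (α θ) + polyP lam (u θ) * (3 * (1 - Real.cos (α θ) ^ 2) *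
            (u θ * (u θ ^ 3 + 2) + 2 * lam * Real.cos (α θ)) / (1 + u θ ^ 4)))) θ :=
  ((hasDerivAt_polyQ (u θ)).comp θ (H.deriv_u θ)).add
    (((hasDerivAt_polyP lam (u θ)).comp θ (H.deriv_u θ)).mul (H.deriv_cos θ))

theorem deriv_exp (H : PastFlow lam u α ρ Λ) (θ : ℝ) :
    HasDerivAt (fun θ => Real.exp (ρ θ + Λ θ)) (Real.exp (ρ θ + Λ θ) *
      (9 * u θ ^ 4 * Real.cos (α θ) / (1 + u θ ^ 4) +
        2 * lam * (3 * Real.cos (α θ) ^ 2 - 2 - u θ ^ 3) / (1 + u θ ^ 4))) θ :=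
  ((H.deriv_ρ θ).add (H.deriv_Λ θ)).exp

/-- This is the angular momentum r² dφ/ds. -/
theorem angular_const (H : PastFlow lam u α ρ Λ) (θ : ℝ) :
    Real.exp (ρ θ + Λ θ) * u θ ^ 2 * Real.sin (α θ) =
      Real.exp (ρ 0 + Λ 0) * u 0 ^ 2 * Real.sin (α 0) := by
  refine const_of_hasDerivAt_zero
    (f := fun θ => Real.exp (ρ θ + Λ θ) * u θ ^ 2 * Real.sin (α θ))
    (fun θ => ((H.deriv_exp θ).mul ((H.deriv_u θ).pow 2)).mul (H.deriv_α θ).sin) (fun θ => ?_) θ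
  have h4 : 1 + u θ ^ 4 ≠ 0 := by positivity
  simp only [Pi.mul_apply, Pi.pow_apply, polyP, polyQ]
  field_simp
  ring

/-- Up to the factor -1/(3λ) this is the product of the four-momentum with `t ∂_t + R ∂_R`, which is
constant along null geodesics. -/
theorem homothetic_const (H : PastFlow lam u α ρ Λ) (θ : ℝ) :
    Real.exp (ρ θ + Λ θ) * homothetic lam (u θ) (Real.cos (α θ)) / u θ =
      Real.exp (ρ 0 + Λ 0) * homothetic lam (u 0) (Real.cos (α 0)) / u 0 := by
  refine const_of_hasDerivAt_zero
    (f := fun θ => Real.exp (ρ θ + Λ θ) * homothetic lam (u θ) (Real.cos (α θ)) / u θ)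
    (fun θ => ((H.deriv_exp θ).mul (H.deriv_homothetic θ)).div (H.deriv_u θ) (H.u_pos θ).ne')
    (fun θ => ?_) θ
  have h4 : 1 + u θ ^ 4 ≠ 0 := by positivity
  have := (H.u_pos θ).ne'
  simp only [Pi.mul_apply, polyP, polyQ, homothetic, radial]
  field_simp
  ring

/-- Both conservation laws contain the factor exp(ρ + Λ). Absorbing its ratio into `k` leaves
relations between u and α alone. -/
theorem homothetic_eq (H : PastFlow lam u α ρ Λ) (θ₀ θ : ℝ) :
    ∃ k : ℝ, 0 < k ∧ homothetic lam (u θ) (Real.cos (α θ)) =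
      k * homothetic lam (u θ₀) (Real.cos (α θ₀)) ∧
      u θ₀ ^ 6 * Real.sin (α θ₀) ^ 2 * k ^ 2 = u θ ^ 6 * Real.sin (α θ) ^ 2 := by
  have h1 := (H.homothetic_const θ).trans (H.homothetic_const θ₀).symm
  have h2 := (H.angular_const θ).trans (H.angular_const θ₀).symm
  have hu := H.u_pos θ
  have hu0 := H.u_pos θ₀
  have hB := Real.exp_pos (ρ θ + Λ θ)
  have hB0 := Real.exp_pos (ρ θ₀ + Λ θ₀)
  set B := Real.exp (ρ θ + Λ θ)
  set B₀ := Real.exp (ρ θ₀ + Λ θ₀)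
  refine ⟨B₀ * u θ / (B * u θ₀), by positivity, ?_, ?_⟩
  · field_simp at h1 ⊢
    linear_combination h1
  · rw [div_pow, mul_div_assoc', div_eq_iff (by positivity)]
    have h3 : (B * u θ ^ 2 * Real.sin (α θ)) ^ 2 = (B₀ * u θ₀ ^ 2 * Real.sin (α θ₀)) ^ 2 := by
      rw [h2]
    linear_combination (-(u θ) ^ 2 * u θ₀ ^ 2) * h3

theorem homothetic_pos (H : PastFlow lam u α ρ Λ) {θ₀ : ℝ}
    (h : 0 < homothetic lam (u θ₀) (Real.cos (α θ₀))) (θ : ℝ) :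
    0 < homothetic lam (u θ) (Real.cos (α θ)) := by
  obtain ⟨k, hk, e, -⟩ := H.homothetic_eq θ₀ θ
  rw [e]; positivity

theorem homothetic_nonpos (H : PastFlow lam u α ρ Λ) {θ₀ : ℝ}
    (h : homothetic lam (u θ₀) (Real.cos (α θ₀)) ≤ 0) (θ : ℝ) :
    homothetic lam (u θ) (Real.cos (α θ)) ≤ 0 := by
  obtain ⟨k, hk, e, -⟩ := H.homothetic_eq θ₀ θ
  rw [e]; exact mul_nonpos_of_nonneg_of_nonpos hk.le h

/-- Eliminating `k` from `homothetic_eq` shows that b, the squared impact parameter, is constant. -/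
theorem impact_eq (H : PastFlow lam u α ρ Λ) {θ₀ b : ℝ}
    (h : b * homothetic lam (u θ₀) (Real.cos (α θ₀)) ^ 2 =
      9 * lam ^ 2 * u θ₀ ^ 6 * (1 - Real.cos (α θ₀) ^ 2)) (θ : ℝ) :
    b * homothetic lam (u θ) (Real.cos (α θ)) ^ 2 =
      9 * lam ^ 2 * u θ ^ 6 * (1 - Real.cos (α θ) ^ 2) := by
  obtain ⟨k, hk, e, e'⟩ := H.homothetic_eq θ₀ θ
  rw [← Real.sin_sq] at *
  rw [e]
  linear_combination k ^ 2 * h + 9 * lam ^ 2 * e'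

theorem sin_eq_zero (H : PastFlow lam u α ρ Λ) {θ₀ : ℝ} (h : Real.sin (α θ₀) = 0) (θ : ℝ) :
    Real.sin (α θ) = 0 := by
  have h2 := (H.angular_const θ).trans (H.angular_const θ₀).symm
  rw [h, mul_zero] at h2
  have hu := H.u_pos θ
  exact (mul_eq_zero.1 h2).resolve_left (by positivity)

theorem cos_const (H : PastFlow lam u α ρ Λ) {θ₀ : ℝ} (h : Real.sin (α θ₀) = 0) (θ : ℝ) :
    Real.cos (α θ) = Real.cos (α 0) :=
  const_of_hasDerivAt_zero (f := fun θ => Real.cos (α θ)) H.deriv_cos (fun θ => by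
    rw [← Real.sin_sq, H.sin_eq_zero h]; simp) θ

/-- Radial directions are invariant, so a trajectory that is not radially outgoing at one parameter
value never is. -/
theorem cos_gt (H : PastFlow lam u α ρ Λ) {θ₀ : ℝ} (h : -1 < Real.cos (α θ₀)) (θ : ℝ) :
    -1 < Real.cos (α θ) := by
  refine lt_of_le_of_ne (Real.neg_one_le_cos _) fun e => ?_
  have hs : Real.sin (α θ) = 0 := by
    have := Real.sin_sq_add_cos_sq (α θ)
    rw [← e] at this
    nlinarith
  rw [H.cos_const hs] at e
  rw [H.cos_const hs] at h
  linarith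

/-- The derivative of the normalized velocity `(P + Q cos α) / (Q + P cos α)`. -/
theorem deriv_quotient (H : PastFlow lam u α ρ Λ) {θ : ℝ}
    (h : homothetic lam (u θ) (Real.cos (α θ)) ≠ 0) :
    HasDerivAt (fun θ => radial lam (u θ) (Real.cos (α θ)) / homothetic lam (u θ) (Real.cos (α θ)))
      (3 * (1 - Real.cos (α θ) ^ 2) * (2 + u θ ^ 3) * slope lam (u θ) /
        ((1 + u θ ^ 4) * homothetic lam (u θ) (Real.cos (α θ)))) θ := by
  refine ((H.deriv_radial θ).div (H.deriv_homothetic θ) h).congr_deriv ?_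
  have h4 : 1 + u θ ^ 4 ≠ 0 := by positivity
  rw [div_eq_div_iff (by positivity) (by positivity)]
  simp only [polyP, polyQ, homothetic, radial, slope]
  field_simp
  ring

end PastFlow

/-! ### Energy balance and bounds for the momenta. -/

theorem continuous_radial (lam : ℝ) : Continuous fun z : ℝ × ℝ => radial lam z.1 z.2 := by
  unfold radial polyP polyQ; fun_prop

theorem continuous_homothetic (lam : ℝ) : Continuous fun z : ℝ × ℝ => homothetic lam z.1 z.2 := by
  unfold homothetic polyP polyQ; fun_prop

theorem continuous_slope (lam : ℝ) : Continuous (slope lam) := by unfold slope; fun_prop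

theorem pot_mul {lam u : ℝ} (hlam : lam ≠ 0) (hu : u ≠ 0) :
    9 * lam ^ 2 * u ^ 6 * pot lam u = polyQ u ^ 2 - polyP lam u ^ 2 := by
  unfold pot
  field_simp

/-- Energy conservation. -/
theorem radial_sq {lam u c b : ℝ} (hlam : lam ≠ 0) (hu : u ≠ 0)
    (hb : b * homothetic lam u c ^ 2 = 9 * lam ^ 2 * u ^ 6 * (1 - c ^ 2)) :
    radial lam u c ^ 2 = (1 - b * pot lam u) * homothetic lam u c ^ 2 := by
  have h := pot_mul hlam hu
  have h2 : b * pot lam u * homothetic lam u c ^ 2 = pot lam u * (9 * lam ^ 2 * u ^ 6 * (1 - c ^ 2)) := by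
    rw [← hb]; ring
  rw [sub_mul, h2]
  unfold radial homothetic
  linear_combination (1 - c ^ 2) * h

theorem radial_add_homothetic (lam u c : ℝ) :
    radial lam u c + homothetic lam u c = (1 + c) * (polyP lam u + polyQ u) := by
  unfold radial homothetic; ring

theorem homothetic_ge {lam u c : ℝ} (hlam : 0 < lam) (hu : 0 < u) (hc : -1 ≤ c) :
    polyQ u - polyP lam u ≤ homothetic lam u c := by
  have := polyP_pos hlam hu
  unfold homothetic
  nlinarith

theorem radial_ge {lam u c : ℝ} (hu : 0 < u) (hu1 : u ≤ 1) (hc : -1 ≤ c) :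
    polyP lam u - polyQ u ≤ radial lam u c := by
  have h1 : u ^ 3 ≤ 1 := pow_le_one₀ hu.le hu1
  have : 0 ≤ polyQ u := mul_nonneg (by linarith) (by linarith)
  unfold radial
  nlinarith

/-- Where both momenta are nonnegative, the direction cannot be close to the outgoing radial one. -/
theorem impact_bound {lam u c b : ℝ} (hb0 : 0 ≤ b)
    (hb : b * homothetic lam u c ^ 2 = 9 * lam ^ 2 * u ^ 6 * (1 - c ^ 2)) (hd : 0 < homothetic lam u c)
    (hy : 0 ≤ radial lam u c) (hc : -1 ≤ c) :
    9 * lam ^ 2 * u ^ 6 * (1 - c) ≤ b * (1 + c) * (polyP lam u + polyQ u) ^ 2 := by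
  have hs := radial_add_homothetic lam u c
  have hc1 : 0 < 1 + c := by
    refine lt_of_le_of_ne (by linarith) fun e => ?_
    rw [← e, zero_mul] at hs
    linarith
  have hle : homothetic lam u c ≤ (1 + c) * (polyP lam u + polyQ u) := by linarith
  have h2 : homothetic lam u c ^ 2 ≤ ((1 + c) * (polyP lam u + polyQ u)) ^ 2 := by gcongr
  have h3 := mul_le_mul_of_nonneg_left h2 hb0
  rw [hb] at h3
  refine le_of_mul_le_mul_left ?_ hc1
  linarith

/-- The compact slab in which the trajectories are confined. -/
def slab (r s : ℝ) : Set (ℝ × ℝ) := Icc r s ×ˢ Icc (-1) 1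

theorem isCompact_slab (r s : ℝ) : IsCompact (slab r s) := isCompact_Icc.prod isCompact_Icc

theorem one_add_pow_ne (x : ℝ) : 1 + x ^ 4 ≠ 0 := by positivity

namespace Landscape

variable {lam a₂ u₁ a₁ a₀ : ℝ}

theorem pot_nonpos (H : Landscape lam a₂ u₁ a₁ a₀) {u : ℝ} (h1 : a₁ ≤ u) (h2 : u ≤ 1) :
    pot lam u ≤ 0 := by
  have h0 : 0 < u := H.a₁_pos.trans_le h1
  have hq : 0 ≤ polyQ u := by
    have : u ^ 3 ≤ 1 := pow_le_one₀ h0.le h2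
    exact mul_nonneg (by linarith) (by linarith)
  have hqp : polyQ u ≤ polyP lam u := by
    rcases h1.eq_or_lt with rfl | h
    · exact H.eq_a₁.ge
    · exact (H.gt_of_gt u h).le
  exact div_nonpos_of_nonpos_of_nonneg (sub_nonpos.2 (by gcongr)) (by positivity)

theorem pot_pos (H : Landscape lam a₂ u₁ a₁ a₀) {u : ℝ} (h1 : a₂ < u) (h2 : u < a₁) :
    0 < pot lam u := by
  have h0 : 0 < u := H.a₂_pos.trans h1
  have hl := H.lam_pos
  have := polyP_pos hl h0
  have hqp := H.lt_of_mem u h1 h2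
  exact div_pos (sub_pos.2 (by gcongr)) (by positivity)

theorem pot_u₁_pos (H : Landscape lam a₂ u₁ a₁ a₀) : 0 < pot lam u₁ := H.pot_pos H.a₂_lt H.u₁_lt

theorem pot_le (H : Landscape lam a₂ u₁ a₁ a₀) {u : ℝ} (h0 : 0 < u) (h1 : u ≤ 1) :
    pot lam u ≤ pot lam u₁ := by
  rcases le_total u u₁ with h | h
  · exact H.pot_strictMonoOn.monotoneOn ⟨h0, h⟩ ⟨H.u₁_pos, le_rfl⟩ h
  · rcases le_total u a₁ with h' | h'
    · exact H.pot_strictAntiOn.antitoneOn ⟨le_rfl, H.u₁_lt.le⟩ ⟨h, h'⟩ h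
    · exact (H.pot_nonpos h' h1).trans H.pot_u₁_pos.le

theorem pot_lt (H : Landscape lam a₂ u₁ a₁ a₀) {u : ℝ} (h0 : 0 < u) (h1 : u ≤ 1) (hne : u ≠ u₁) :
    pot lam u < pot lam u₁ := by
  rcases hne.lt_or_gt with h | h
  · exact H.pot_strictMonoOn ⟨h0, h.le⟩ ⟨H.u₁_pos, le_rfl⟩ h
  · rcases le_total u a₁ with h' | h'
    · exact H.pot_strictAntiOn ⟨le_rfl, H.u₁_lt.le⟩ ⟨h.le, h'⟩ h
    · exact (H.pot_nonpos h' h1).trans_lt H.pot_u₁_pos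

theorem polyP_lt_polyQ (H : Landscape lam a₂ u₁ a₁ a₀) {u : ℝ} (h1 : u₁ ≤ u) (h2 : u < a₁) :
    polyP lam u < polyQ u := H.lt_of_mem u (H.a₂_lt.trans_le h1) h2

theorem polyQ_le_polyP (H : Landscape lam a₂ u₁ a₁ a₀) {u : ℝ} (h0 : 0 < u) (h1 : u ≤ a₂) :
    polyQ u ≤ polyP lam u := by
  rcases h1.eq_or_lt with rfl | h
  · exact H.eq_a₂.ge
  · exact (H.gt_of_lt u h0 h).le

theorem sum_pos (H : Landscape lam a₂ u₁ a₁ a₀) {u : ℝ} (h0 : 0 < u) (h1 : u ≤ 1) :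
    0 < polyP lam u + polyQ u := H.add_pos u h0 (h1.trans_lt H.one_lt)

theorem continuousAt_pot_u₁ (H : Landscape lam a₂ u₁ a₁ a₀) : ContinuousAt (pot lam) u₁ :=
  (hasDerivAt_pot H.lam_pos.ne' H.u₁_pos.ne').continuousAt

end Landscape

/-! ### Motion in the potential: passing, turning, crossing and collapse. -/

namespace PastFlow

variable {lam : ℝ} {u α ρ Λ : ℝ → ℝ} {a₂ u₁ a₁ a₀ : ℝ}

theorem mem_slab (θ : ℝ) {r s : ℝ} (h1 : r ≤ u θ) (h2 : u θ ≤ s) :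
    (u θ, Real.cos (α θ)) ∈ slab r s :=
  ⟨⟨h1, h2⟩, Real.neg_one_le_cos _, Real.cos_le_one _⟩

theorem continuous_radial (H : PastFlow lam u α ρ Λ) :
    Continuous fun θ => radial lam (u θ) (Real.cos (α θ)) :=
  continuous_iff_continuousAt.2 fun θ => (H.deriv_radial θ).continuousAt

theorem monotoneOn_u (H : PastFlow lam u α ρ Λ) {D : Set ℝ} (hD : Convex ℝ D)
    (h : ∀ θ ∈ interior D, 0 ≤ radial lam (u θ) (Real.cos (α θ))) : MonotoneOn u D :=
  monotoneOn_of_hasDerivAt_nonneg hD H.deriv_u fun θ hθ =>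
    div_nonneg (mul_nonneg (H.u_pos θ).le (h θ hθ)) (by positivity)

theorem antitoneOn_u (H : PastFlow lam u α ρ Λ) {D : Set ℝ} (hD : Convex ℝ D)
    (h : ∀ θ ∈ interior D, radial lam (u θ) (Real.cos (α θ)) ≤ 0) : AntitoneOn u D :=
  antitoneOn_of_hasDerivAt_nonpos hD H.deriv_u fun θ hθ =>
    div_nonpos_of_nonpos_of_nonneg (mul_nonpos_of_nonneg_of_nonpos (H.u_pos θ).le (h θ hθ))
      (by positivity)

/-- Values of `u` which the trajectory avoids separate it. -/
theorem lt_of_ne (H : PastFlow lam u α ρ Λ) {θ₀ r : ℝ} (h : u θ₀ < r)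
    (hne : ∀ θ, θ₀ ≤ θ → u θ ≠ r) : ∀ θ, θ₀ ≤ θ → u θ < r := by
  intro θ hθ
  by_contra hc
  obtain ⟨z, hz, e⟩ := intermediate_value_Icc hθ H.continuous_u.continuousOn ⟨h.le, not_lt.1 hc⟩
  exact hne z hz.1 e

theorem gt_of_ne (H : PastFlow lam u α ρ Λ) {θ₀ r : ℝ} (h : r < u θ₀)
    (hne : ∀ θ, θ₀ ≤ θ → u θ ≠ r) : ∀ θ, θ₀ ≤ θ → r < u θ := by
  intro θ hθ
  by_contra hc
  obtain ⟨z, hz, e⟩ := intermediate_value_Icc' hθ H.continuous_u.continuousOn ⟨not_lt.1 hc, h.le⟩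
  exact hne z hz.1 e

/-- A trajectory on its way out which is energetic enough passes `x = 0`. -/
theorem exists_ge_one (H : PastFlow lam u α ρ Λ) (hL : Landscape lam a₂ u₁ a₁ a₀) {b e θ₀ : ℝ}
    (hd : ∀ θ, 0 < homothetic lam (u θ) (Real.cos (α θ))) (hb0 : 0 ≤ b)
    (hb : ∀ θ, b * homothetic lam (u θ) (Real.cos (α θ)) ^ 2 =
      9 * lam ^ 2 * u θ ^ 6 * (1 - Real.cos (α θ) ^ 2))
    (hy : 0 < radial lam (u θ₀) (Real.cos (α θ₀))) (he : 0 < e)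
    (hW : ∀ r, u θ₀ ≤ r → r ≤ 1 → e ≤ 1 - b * pot lam r) : ∃ θ, θ₀ ≤ θ ∧ 1 ≤ u θ := by
  by_contra! hlt
  have hl := hL.lam_pos
  have hen : ∀ θ, θ₀ ≤ θ → u θ₀ ≤ u θ → e * homothetic lam (u θ) (Real.cos (α θ)) ^ 2 ≤
      radial lam (u θ) (Real.cos (α θ)) ^ 2 := by
    intro θ hθ hu
    rw [radial_sq hl.ne' (H.u_pos θ).ne' (hb θ)]
    exact mul_le_mul_of_nonneg_right (hW _ hu (hlt θ hθ).le) (by positivity)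
  -- At a first zero of the velocity u has only grown, so the energy there would still be at least
  -- `e` times a positive square.
  have hypos : ∀ θ, θ₀ ≤ θ → 0 < radial lam (u θ) (Real.cos (α θ)) := by
    intro θ hθ
    by_contra hc
    obtain ⟨T, hT0, -, hT, hbef⟩ := exists_first_zero H.continuous_radial hθ hy (not_lt.1 hc)
    have hmono := H.monotoneOn_u (convex_Icc θ₀ T) (fun τ hτ => by
      rw [interior_Icc] at hτ
      exact (hbef τ hτ.1.le hτ.2).le)
    have := hen T hT0.le (hmono ⟨le_rfl, hT0.le⟩ ⟨hT0.le, le_rfl⟩ hT0.le)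
    rw [hT] at this
    have := mul_pos he (pow_pos (hd T) 2)
    linarith
  have hmono := H.monotoneOn_u (convex_Ici θ₀) (fun τ hτ => by
    rw [interior_Ici] at hτ
    exact (hypos τ (le_of_lt hτ)).le)
  have hge : ∀ θ, θ₀ ≤ θ → u θ₀ ≤ u θ := fun θ hθ => hmono self_mem_Ici hθ hθ
  -- The last condition, from `impact_bound`, cuts off the direction cos α = -1, where both momenta
  -- may vanish together. Without it the drift of u would have no positive lower bound on the
  -- compact set.
  set K : Set (ℝ × ℝ) := slab (u θ₀) 1 ∩ {z | (e * homothetic lam z.1 z.2 ^ 2 ≤ radial lam z.1 z.2 ^ 2 ∧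
    0 ≤ homothetic lam z.1 z.2) ∧ (0 ≤ radial lam z.1 z.2 ∧
    9 * lam ^ 2 * z.1 ^ 6 * (1 - z.2) ≤ b * (1 + z.2) * (polyP lam z.1 + polyQ z.1) ^ 2)} with hK
  have hc1 := SelfSimilarDust.continuous_radial lam
  have hc2 := continuous_homothetic lam
  have hc3 := continuous_polyP lam
  have hc4 := continuous_polyQ
  have hKc : IsCompact K := by
    refine (isCompact_slab _ _).inter_right ?_
    exact ((isClosed_le (by fun_prop) (by fun_prop)).and (isClosed_le (by fun_prop)
      (by fun_prop))).and ((isClosed_le (by fun_prop) (by fun_prop)).and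
      (isClosed_le (by fun_prop) (by fun_prop)))
  have hlim := tendsto_atTop_of_drift H.deriv_u hKc (z := fun θ => (u θ, Real.cos (α θ)))
    (g := fun z => z.1 * radial lam z.1 z.2 / (1 + z.1 ^ 4)) (θ₀ := θ₀)
    (fun θ hθ => ⟨mem_slab θ (hge θ hθ) (hlt θ hθ).le,
      ⟨hen θ hθ (hge θ hθ), (hd θ).le⟩, (hypos θ hθ).le,
      impact_bound hb0 (hb θ) (hd θ) (hypos θ hθ).le (Real.neg_one_le_cos _)⟩)
    (Continuous.continuousOn (Continuous.div (by fun_prop) (by fun_prop) fun z => one_add_pow_ne _))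
    (fun z hz => by
      obtain ⟨⟨⟨hu1, hu2⟩, hz1, hz2⟩, ⟨h1, h2⟩, h3, h4⟩ := hz
      have hu0 : 0 < z.1 := (H.u_pos θ₀).trans_le hu1
      have hy0 : 0 < radial lam z.1 z.2 := by
        refine lt_of_le_of_ne h3 fun h0 => ?_
        rw [← h0] at h1
        have hd0 : homothetic lam z.1 z.2 = 0 := by
          by_contra hne
          have : 0 < homothetic lam z.1 z.2 ^ 2 := by positivity
          nlinarith
        have hs := radial_add_homothetic lam z.1 z.2
        rw [← h0, hd0, add_zero] at hs
        have hc : 1 + z.2 = 0 := (mul_eq_zero.1 hs.symm).resolve_right (hL.sum_pos hu0 hu2).ne'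
        rw [hc] at h4
        have : 0 < 9 * lam ^ 2 * z.1 ^ 6 * (1 - z.2) := mul_pos (by positivity) (by linarith)
        linarith
      positivity)
    (fun θ _ => le_rfl)
  obtain ⟨θ, hθ, h1⟩ := ((eventually_ge_atTop θ₀).and (hlim.eventually_ge_atTop 1)).exists
  linarith [hlt θ hθ]

/-- A trajectory with too little energy for the barrier, coming up to it from small `u`, turns. -/
theorem exists_turn_down (H : PastFlow lam u α ρ Λ) (hL : Landscape lam a₂ u₁ a₁ a₀) {b θ₀ : ℝ}
    (hd : ∀ θ, 0 < homothetic lam (u θ) (Real.cos (α θ))) (hb0 : 0 ≤ b)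
    (hb : ∀ θ, b * homothetic lam (u θ) (Real.cos (α θ)) ^ 2 =
      9 * lam ^ 2 * u θ ^ 6 * (1 - Real.cos (α θ) ^ 2))
    (hu : u θ₀ < u₁) (hW : 1 < b * pot lam u₁) :
    ∃ θ, θ₀ ≤ θ ∧ radial lam (u θ) (Real.cos (α θ)) < 0 ∧ u θ < u₁ := by
  have hl := hL.lam_pos
  -- Where b W > 1 the energy balance would give a negative square.
  have hbar : ∀ r, 1 < b * pot lam r → ∀ θ, u θ ≠ r := by
    rintro r hr θ rfl
    have := radial_sq hl.ne' (H.u_pos θ).ne' (hb θ)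
    have h2 := pow_pos (hd θ) 2
    nlinarith [sq_nonneg (radial lam (u θ) (Real.cos (α θ)))]
  obtain ⟨r, ⟨hr1, hr2⟩, hrW⟩ : ∃ r, r ∈ Ioo (u θ₀) u₁ ∧ 1 < b * pot lam r := by
    have h1 : ∀ᶠ r in 𝓝[<] u₁, 1 < b * pot lam r :=
      ((hL.continuousAt_pot_u₁.const_mul b).eventually_const_lt hW).filter_mono nhdsWithin_le_nhds
    have h2 : ∀ᶠ r in 𝓝[<] u₁, r ∈ Ioo (u θ₀) u₁ := Ioo_mem_nhdsLT hu
    exact (h2.and h1).exists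
  have hlt := H.lt_of_ne hr1 (fun θ _ => hbar r hrW θ)
  by_contra! hcon
  have hy : ∀ θ, θ₀ ≤ θ → 0 ≤ radial lam (u θ) (Real.cos (α θ)) := by
    intro θ hθ
    by_contra hc
    linarith [hcon θ hθ (not_le.1 hc), hlt θ hθ]
  have hmono := H.monotoneOn_u (convex_Ici θ₀) (fun τ hτ => by
    rw [interior_Ici] at hτ
    exact hy τ (le_of_lt hτ))
  have hge : ∀ θ, θ₀ ≤ θ → u θ₀ ≤ u θ := fun θ hθ => hmono self_mem_Ici hθ hθ
  have hbpos : 0 < b := lt_of_le_of_ne hb0 (fun e => by rw [← e] at hW; linarith)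
  set K : Set (ℝ × ℝ) := slab (u θ₀) r ∩ {z | (b * homothetic lam z.1 z.2 ^ 2 =
      9 * lam ^ 2 * z.1 ^ 6 * (1 - z.2 ^ 2) ∧ 0 ≤ homothetic lam z.1 z.2) ∧
    9 * lam ^ 2 * z.1 ^ 6 * (1 - z.2) ≤ b * (1 + z.2) * (polyP lam z.1 + polyQ z.1) ^ 2} with hK
  have hc2 := continuous_homothetic lam
  have hc3 := continuous_polyP lam
  have hc4 := continuous_polyQ
  have hc5 := continuous_slope lam
  have hKc : IsCompact K := by
    refine (isCompact_slab _ _).inter_right ?_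
    exact ((isClosed_eq (by fun_prop) (by fun_prop)).and (isClosed_le (by fun_prop)
      (by fun_prop))).and (isClosed_le (by fun_prop) (by fun_prop))
  have hKd : ∀ z ∈ K, 0 < z.1 ∧ z.1 < u₁ ∧ 0 < homothetic lam z.1 z.2 := by
    rintro z ⟨⟨⟨hz1, hz2⟩, hz3, hz4⟩, ⟨h1, h2⟩, h3⟩
    have hz0 : 0 < z.1 := (H.u_pos θ₀).trans_le hz1
    have hlt1 : z.1 ≤ 1 := by linarith [hL.u₁_lt, hL.a₁_lt]
    refine ⟨hz0, by linarith, lt_of_le_of_ne h2 fun h0 => ?_⟩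
    rw [← h0] at h1
    have hsin : (1 + z.2) * (1 - z.2) = 0 := by
      have h9 : 9 * lam ^ 2 * z.1 ^ 6 ≠ 0 := by positivity
      apply mul_left_cancel₀ h9
      linarith
    rcases mul_eq_zero.1 hsin with h | h
    · rw [h] at h3
      have : 0 < 9 * lam ^ 2 * z.1 ^ 6 * (1 - z.2) := mul_pos (by positivity) (by linarith)
      linarith
    · have hz : z.2 = 1 := by linarith
      have := hL.sum_pos hz0 hlt1
      unfold homothetic at h0
      rw [hz] at h0
      linarith
  -- The trajectory cannot stall at a turning point: below `u₁` the slope is negative, so the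
  -- normalized velocity decreases at a uniform rate and must become negative.
  have hlim := tendsto_atTop_of_drift (fun θ => (H.deriv_quotient (hd θ).ne').neg) hKc
    (z := fun θ => (u θ, Real.cos (α θ)))
    (g := fun z => -(3 * (1 - z.2 ^ 2) * (2 + z.1 ^ 3) * slope lam z.1 /
        ((1 + z.1 ^ 4) * homothetic lam z.1 z.2))) (θ₀ := θ₀)
    (fun θ hθ => ⟨mem_slab θ (hge θ hθ) (hlt θ hθ).le, ⟨hb θ, (hd θ).le⟩,
      impact_bound hb0 (hb θ) (hd θ) (hy θ hθ) (Real.neg_one_le_cos _)⟩)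
    (ContinuousOn.neg (ContinuousOn.div (Continuous.continuousOn (by fun_prop))
      (Continuous.continuousOn (by fun_prop)) fun z hz =>
        mul_ne_zero (one_add_pow_ne _) (hKd z hz).2.2.ne'))
    (fun z hz => by
      obtain ⟨h0, h1, h2⟩ := hKd z hz
      have h3 : 0 < 9 * lam ^ 2 * z.1 ^ 6 * (1 - z.2 ^ 2) := by rw [← hz.2.1.1]; positivity
      have h4 : 0 < 1 - z.2 ^ 2 := pos_of_mul_pos_right h3 (by positivity)
      rw [neg_pos]
      exact div_neg_of_neg_of_pos (mul_neg_of_pos_of_neg (by positivity) (hL.slope_neg _ h0 h1))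
        (by positivity))
    (fun θ _ => le_rfl)
  obtain ⟨θ, hθ, h1⟩ := ((eventually_ge_atTop θ₀).and (hlim.eventually_ge_atTop 1)).exists
  have := div_nonneg (hy θ hθ) (hd θ).le
  rw [Pi.neg_apply] at h1
  linarith

/-- A trajectory with too little energy for the barrier, coming down to it from large `u`, turns. -/
theorem exists_turn_up (H : PastFlow lam u α ρ Λ) (hL : Landscape lam a₂ u₁ a₁ a₀) {b θ₀ : ℝ}
    (hd : ∀ θ, 0 < homothetic lam (u θ) (Real.cos (α θ))) (hb0 : 0 ≤ b)
    (hb : ∀ θ, b * homothetic lam (u θ) (Real.cos (α θ)) ^ 2 =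
      9 * lam ^ 2 * u θ ^ 6 * (1 - Real.cos (α θ) ^ 2))
    (hu : u₁ < u θ₀) (hu' : u θ₀ < a₁) (hW : 1 < b * pot lam u₁) :
    ∃ θ, θ₀ ≤ θ ∧ 0 < radial lam (u θ) (Real.cos (α θ)) ∧ u₁ < u θ := by
  have hl := hL.lam_pos
  have hbar : ∀ r, 1 < b * pot lam r → ∀ θ, u θ ≠ r := by
    rintro r hr θ rfl
    have := radial_sq hl.ne' (H.u_pos θ).ne' (hb θ)
    have h2 := pow_pos (hd θ) 2
    nlinarith [sq_nonneg (radial lam (u θ) (Real.cos (α θ)))]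
  obtain ⟨r, ⟨hr1, hr2⟩, hrW⟩ : ∃ r, r ∈ Ioo u₁ (u θ₀) ∧ 1 < b * pot lam r := by
    have h1 : ∀ᶠ r in 𝓝[>] u₁, 1 < b * pot lam r :=
      ((hL.continuousAt_pot_u₁.const_mul b).eventually_const_lt hW).filter_mono nhdsWithin_le_nhds
    have h2 : ∀ᶠ r in 𝓝[>] u₁, r ∈ Ioo u₁ (u θ₀) := Ioo_mem_nhdsGT hu
    exact (h2.and h1).exists
  have hgt := H.gt_of_ne hr2 (fun θ _ => hbar r hrW θ)
  by_contra! hcon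
  have hy : ∀ θ, θ₀ ≤ θ → radial lam (u θ) (Real.cos (α θ)) ≤ 0 := by
    intro θ hθ
    by_contra hc
    linarith [hcon θ hθ (not_le.1 hc), hgt θ hθ]
  have hmono := H.antitoneOn_u (convex_Ici θ₀) (fun τ hτ => by
    rw [interior_Ici] at hτ
    exact hy τ (le_of_lt hτ))
  have hle : ∀ θ, θ₀ ≤ θ → u θ ≤ u θ₀ := fun θ hθ => hmono self_mem_Ici hθ hθ
  have hbpos : 0 < b := lt_of_le_of_ne hb0 (fun e => by rw [← e] at hW; linarith)
  set K : Set (ℝ × ℝ) := slab r (u θ₀) ∩ {z | b * homothetic lam z.1 z.2 ^ 2 =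
      9 * lam ^ 2 * z.1 ^ 6 * (1 - z.2 ^ 2)} with hK
  have hc2 := continuous_homothetic lam
  have hc5 := continuous_slope lam
  have hKc : IsCompact K := by
    refine (isCompact_slab _ _).inter_right (isClosed_eq ?_ ?_) <;> fun_prop
  have hKd : ∀ z ∈ K, 0 < z.1 ∧ u₁ < z.1 ∧ z.1 < a₁ ∧ 0 < homothetic lam z.1 z.2 := by
    rintro z ⟨⟨⟨hz1, hz2⟩, hz3, hz4⟩, h1⟩
    have hz0 : 0 < z.1 := hL.u₁_pos.trans (by linarith)
    refine ⟨hz0, by linarith, by linarith, ?_⟩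
    have := hL.polyP_lt_polyQ (u := z.1) (by linarith) (by linarith)
    linarith [homothetic_ge hl hz0 hz3]
  -- Above `u₁` the slope is positive, and the normalized velocity increases at a uniform rate.
  have hlim := tendsto_atTop_of_drift (fun θ => H.deriv_quotient (hd θ).ne') hKc
    (z := fun θ => (u θ, Real.cos (α θ)))
    (g := fun z => 3 * (1 - z.2 ^ 2) * (2 + z.1 ^ 3) * slope lam z.1 /
        ((1 + z.1 ^ 4) * homothetic lam z.1 z.2)) (θ₀ := θ₀)
    (fun θ hθ => ⟨mem_slab θ (hgt θ hθ).le (hle θ hθ), hb θ⟩)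
    (ContinuousOn.div (Continuous.continuousOn (by fun_prop))
      (Continuous.continuousOn (by fun_prop)) fun z hz =>
        mul_ne_zero (one_add_pow_ne _) (hKd z hz).2.2.2.ne')
    (fun z hz => by
      obtain ⟨h0, h1, h2, h5⟩ := hKd z hz
      have h3 : 0 < 9 * lam ^ 2 * z.1 ^ 6 * (1 - z.2 ^ 2) := by rw [← hz.2]; positivity
      have h4 : 0 < 1 - z.2 ^ 2 := pos_of_mul_pos_right h3 (by positivity)
      have h6 := hL.slope_pos _ h1 h2.le
      positivity)
    (fun θ _ => le_rfl)
  obtain ⟨θ, hθ, h1⟩ := ((eventually_ge_atTop θ₀).and (hlim.eventually_ge_atTop 1)).exists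
  have := div_nonpos_of_nonpos_of_nonneg (hy θ hθ) (hd θ).le
  linarith

/-- A trajectory with enough energy for the barrier which comes down to it from large `u`
crosses it. -/
theorem exists_cross_down (H : PastFlow lam u α ρ Λ) (hL : Landscape lam a₂ u₁ a₁ a₀) {b θ₀ : ℝ}
    (hd : ∀ θ, 0 < homothetic lam (u θ) (Real.cos (α θ))) (hb0 : 0 ≤ b)
    (hb : ∀ θ, b * homothetic lam (u θ) (Real.cos (α θ)) ^ 2 =
      9 * lam ^ 2 * u θ ^ 6 * (1 - Real.cos (α θ) ^ 2))
    (hy : radial lam (u θ₀) (Real.cos (α θ₀)) < 0) (hu : u θ₀ < a₁) (hW : b * pot lam u₁ < 1) :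
    ∃ θ, θ₀ ≤ θ ∧ radial lam (u θ) (Real.cos (α θ)) < 0 ∧ u θ ≤ u₁ := by
  have hl := hL.lam_pos
  have hen : ∀ θ, u θ ≤ 1 → (1 - b * pot lam u₁) * homothetic lam (u θ) (Real.cos (α θ)) ^ 2 ≤
      radial lam (u θ) (Real.cos (α θ)) ^ 2 := by
    intro θ h1
    rw [radial_sq hl.ne' (H.u_pos θ).ne' (hb θ)]
    have := mul_le_mul_of_nonneg_left (hL.pot_le (H.u_pos θ) h1) hb0
    exact mul_le_mul_of_nonneg_right (by linarith) (by positivity)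
  -- The potential never exceeds its value at the top for u ≤ 1, so the energy left over there
  -- forbids a zero of the velocity.
  have hyneg : ∀ θ, θ₀ ≤ θ → radial lam (u θ) (Real.cos (α θ)) < 0 := by
    intro θ hθ
    by_contra hc
    obtain ⟨T, hT0, -, hT, hbef⟩ := exists_first_zero H.continuous_radial.neg hθ
      (neg_pos.2 hy) (neg_nonpos.2 (not_lt.1 hc))
    have hmono := H.antitoneOn_u (convex_Icc θ₀ T) (fun τ hτ => by
      rw [interior_Icc] at hτ
      exact (neg_pos.1 (hbef τ hτ.1.le hτ.2)).le)
    have h1 := hmono ⟨le_rfl, hT0.le⟩ ⟨hT0.le, le_rfl⟩ hT0.le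
    have := hen T (by linarith [hL.a₁_lt])
    rw [show radial lam (u T) (Real.cos (α T)) = 0 from neg_eq_zero.1 hT] at this
    have := mul_pos (sub_pos.2 hW) (pow_pos (hd T) 2)
    linarith
  have hmono := H.antitoneOn_u (convex_Ici θ₀) (fun τ hτ => by
    rw [interior_Ici] at hτ
    exact (hyneg τ (le_of_lt hτ)).le)
  have hle : ∀ θ, θ₀ ≤ θ → u θ ≤ u θ₀ := fun θ hθ => hmono self_mem_Ici hθ hθ
  by_contra! hcon
  have hgt : ∀ θ, θ₀ ≤ θ → u₁ < u θ := fun θ hθ => hcon θ hθ (hyneg θ hθ)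
  set K : Set (ℝ × ℝ) := slab u₁ (u θ₀) ∩ {z | (1 - b * pot lam u₁) * homothetic lam z.1 z.2 ^ 2 ≤
    radial lam z.1 z.2 ^ 2 ∧ radial lam z.1 z.2 ≤ 0} with hK
  have hc1 := SelfSimilarDust.continuous_radial lam
  have hc2 := continuous_homothetic lam
  have hKc : IsCompact K := by
    exact (isCompact_slab _ _).inter_right ((isClosed_le (by fun_prop) (by fun_prop)).and
      (isClosed_le (by fun_prop) (by fun_prop)))
  have hlim := tendsto_atTop_of_drift (fun θ => (H.deriv_u θ).neg) hKc
    (z := fun θ => (u θ, Real.cos (α θ)))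
    (g := fun z => -(z.1 * radial lam z.1 z.2 / (1 + z.1 ^ 4))) (θ₀ := θ₀)
    (fun θ hθ => ⟨mem_slab θ (hgt θ hθ).le (hle θ hθ),
      hen θ ((hle θ hθ).trans (by linarith [hL.a₁_lt])), (hyneg θ hθ).le⟩)
    (Continuous.continuousOn (Continuous.neg
      (Continuous.div (by fun_prop) (by fun_prop) fun z => one_add_pow_ne _)))
    (fun z hz => by
      obtain ⟨⟨⟨hu1, hu2⟩, hz1, hz2⟩, h1, h2⟩ := hz
      have hu0 : 0 < z.1 := hL.u₁_pos.trans_le hu1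
      have hd0 : 0 < homothetic lam z.1 z.2 := by
        have := hL.polyP_lt_polyQ hu1 (by linarith)
        linarith [homothetic_ge hl hu0 hz1]
      have hy0 : radial lam z.1 z.2 < 0 := by
        refine lt_of_le_of_ne h2 fun h0 => ?_
        rw [h0] at h1
        have := mul_pos (sub_pos.2 hW) (pow_pos hd0 2)
        linarith
      rw [neg_pos]
      exact div_neg_of_neg_of_pos (mul_neg_of_pos_of_neg hu0 hy0) (by positivity))
    (fun θ _ => le_rfl)
  obtain ⟨θ, hθ, h1⟩ := ((eventually_ge_atTop θ₀).and (hlim.eventually_ge_atTop 1)).exists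
  rw [Pi.neg_apply] at h1
  linarith [hgt θ hθ, hL.u₁_pos]

/-- The potential increases on (0, `u₁`], so on the way down 1 - b W does not decrease and the
velocity cannot reach zero. -/
theorem radial_neg_of_le (H : PastFlow lam u α ρ Λ) (hL : Landscape lam a₂ u₁ a₁ a₀) {b θ₀ : ℝ}
    (hd : ∀ θ, 0 < homothetic lam (u θ) (Real.cos (α θ))) (hb0 : 0 ≤ b)
    (hb : ∀ θ, b * homothetic lam (u θ) (Real.cos (α θ)) ^ 2 =
      9 * lam ^ 2 * u θ ^ 6 * (1 - Real.cos (α θ) ^ 2))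
    (hy : radial lam (u θ₀) (Real.cos (α θ₀)) < 0) (hu : u θ₀ ≤ u₁) (θ : ℝ) (hθ : θ₀ ≤ θ) :
    radial lam (u θ) (Real.cos (α θ)) < 0 := by
  have hl := hL.lam_pos
  by_contra hc
  obtain ⟨T, hT0, -, hT, hbef⟩ := exists_first_zero H.continuous_radial.neg hθ
    (neg_pos.2 hy) (neg_nonpos.2 (not_lt.1 hc))
  have hmono := H.antitoneOn_u (convex_Icc θ₀ T) (fun τ hτ => by
    rw [interior_Icc] at hτ
    exact (neg_pos.1 (hbef τ hτ.1.le hτ.2)).le)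
  have h1 := hmono ⟨le_rfl, hT0.le⟩ ⟨hT0.le, le_rfl⟩ hT0.le
  have hp := hL.pot_strictMonoOn.monotoneOn ⟨H.u_pos T, h1.trans hu⟩ ⟨H.u_pos θ₀, hu⟩ h1
  have e0 := radial_sq hl.ne' (H.u_pos θ₀).ne' (hb θ₀)
  have e1 := radial_sq hl.ne' (H.u_pos T).ne' (hb T)
  rw [show radial lam (u T) (Real.cos (α T)) = 0 from neg_eq_zero.1 hT] at e1
  have h2 : 0 < (1 - b * pot lam (u θ₀)) * homothetic lam (u θ₀) (Real.cos (α θ₀)) ^ 2 := by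
    rw [← e0]; nlinarith
  have h3 : 0 < 1 - b * pot lam (u θ₀) := pos_of_mul_pos_left h2 (by positivity)
  have h4 := mul_le_mul_of_nonneg_left hp hb0
  have := mul_pos (show 0 < 1 - b * pot lam (u T) by linarith) (pow_pos (hd T) 2)
  linarith

/-- The trajectory runs into the central singularity. -/
def Collapses (u ρ : ℝ → ℝ) : Prop := Tendsto ρ atTop atBot ∧ ∀ᶠ θ in atTop, u θ ≤ 1

theorem collapses_of_drift (H : PastFlow lam u α ρ Λ) {K : Set (ℝ × ℝ)} (hK : IsCompact K)
    {θ₀ : ℝ} (h : ∀ θ, θ₀ ≤ θ → (u θ, Real.cos (α θ)) ∈ K)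
    (hpos : ∀ z ∈ K, 0 < z.1 ∧ z.1 ≤ 1 ∧ z.2 < 0) : Collapses u ρ := by
  have hlim := tendsto_atTop_of_drift (fun θ => (H.deriv_ρ θ).neg) hK
    (z := fun θ => (u θ, Real.cos (α θ))) (g := fun z => -(9 * z.1 ^ 4 * z.2 / (1 + z.1 ^ 4)))
    h (Continuous.continuousOn (Continuous.neg
      (Continuous.div (by fun_prop) (by fun_prop) fun z => one_add_pow_ne _)))
    (fun z hz => by
      obtain ⟨h1, -, h2⟩ := hpos z hz
      rw [neg_pos]
      exact div_neg_of_neg_of_pos (mul_neg_of_pos_of_neg (by positivity) h2) (by positivity))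
    (fun θ _ => le_rfl)
  exact ⟨tendsto_neg_atTop_iff.1 hlim, (eventually_ge_atTop θ₀).mono fun θ hθ => (hpos _ (h θ hθ)).2.1⟩

/-- The value `a₂` is a floor, because the velocity is at least P - Q ≥ 0 for u ≤ `a₂`. On the
remaining compact set P and Q are positive, so a nonpositive velocity forces cos α < 0, and log R
decreases at a uniform rate. -/
theorem collapses_of_radial_neg (H : PastFlow lam u α ρ Λ) (hL : Landscape lam a₂ u₁ a₁ a₀)
    {b θ₀ : ℝ} (hd : ∀ θ, 0 < homothetic lam (u θ) (Real.cos (α θ))) (hb0 : 0 ≤ b)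
    (hb : ∀ θ, b * homothetic lam (u θ) (Real.cos (α θ)) ^ 2 =
      9 * lam ^ 2 * u θ ^ 6 * (1 - Real.cos (α θ) ^ 2))
    (hy : radial lam (u θ₀) (Real.cos (α θ₀)) < 0) (hu : u θ₀ ≤ u₁) : Collapses u ρ := by
  have hneg := H.radial_neg_of_le hL hd hb0 hb hy hu
  have hmono := H.antitoneOn_u (convex_Ici θ₀) (fun τ hτ => by
    rw [interior_Ici] at hτ
    exact (hneg τ (le_of_lt hτ)).le)
  have hle : ∀ θ, θ₀ ≤ θ → u θ ≤ u₁ := fun θ hθ => (hmono self_mem_Ici hθ hθ).trans hu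
  have hc1 := SelfSimilarDust.continuous_radial lam
  have h11 : u₁ < 1 := hL.u₁_lt.trans hL.a₁_lt
  refine H.collapses_of_drift (θ₀ := θ₀) (K := slab a₂ u₁ ∩ {z | radial lam z.1 z.2 ≤ 0})
    ((isCompact_slab _ _).inter_right (isClosed_le hc1 continuous_const)) (fun θ hθ => ?_) ?_
  · refine ⟨mem_slab θ (le_of_not_ge fun h2 => ?_) (hle θ hθ), (hneg θ hθ).le⟩
    have h3 := hL.polyQ_le_polyP (H.u_pos θ) h2
    have := radial_ge (lam := lam) (H.u_pos θ) ((hle θ hθ).trans h11.le) (Real.neg_one_le_cos (α θ))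
    linarith [hneg θ hθ]
  · rintro z ⟨⟨⟨h1, h2⟩, h3, h4⟩, h5⟩
    have h0 : 0 < z.1 := hL.a₂_pos.trans_le h1
    refine ⟨h0, h2.trans h11.le, ?_⟩
    by_contra hc
    have := mul_nonneg (polyQ_pos h0 (h2.trans_lt h11)).le (not_lt.1 hc)
    have h6 := polyP_pos hL.lam_pos h0
    have h7 : radial lam z.1 z.2 ≤ 0 := h5
    unfold radial at h7
    linarith

/-- Between `a₂` and `a₁` the homothetic momentum is at least Q - P > 0, so the trajectory is
confined to u ≤ `a₂`. There u does not decrease, and a nonpositive Q + P cos α forces cos α < 0. -/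
theorem collapses_of_homothetic_nonpos (H : PastFlow lam u α ρ Λ)
    (hL : Landscape lam a₂ u₁ a₁ a₀) {θ₀ : ℝ}
    (hd : homothetic lam (u θ₀) (Real.cos (α θ₀)) ≤ 0) (hu : u θ₀ < a₁) : Collapses u ρ := by
  have hl := hL.lam_pos
  have hd' := H.homothetic_nonpos hd
  have hnot : ∀ θ, a₂ < u θ → a₁ ≤ u θ := by
    intro θ h1
    by_contra h2
    have := hL.lt_of_mem _ h1 (not_le.1 h2)
    linarith [homothetic_ge hl (H.u_pos θ) (Real.neg_one_le_cos (α θ)), hd' θ]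
  have hle : ∀ θ, θ₀ ≤ θ → u θ ≤ a₂ := by
    have hlt : u θ₀ < u₁ := by
      by_contra hc
      linarith [hnot θ₀ (hL.a₂_lt.trans_le (not_lt.1 hc))]
    have := H.lt_of_ne hlt (fun θ _ e => by
      have := hnot θ (by rw [e]; exact hL.a₂_lt)
      linarith [hL.u₁_lt])
    intro θ hθ
    by_contra hc
    linarith [hnot θ (not_le.1 hc), this θ hθ, hL.u₁_lt]
  have h21 : a₂ < 1 := by linarith [hL.a₂_lt, hL.u₁_lt, hL.a₁_lt]
  have hmono := H.monotoneOn_u (convex_Ici θ₀) (fun τ hτ => by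
    rw [interior_Ici] at hτ
    have h1 := hle τ (le_of_lt hτ)
    have := hL.polyQ_le_polyP (H.u_pos τ) h1
    linarith [radial_ge (lam := lam) (H.u_pos τ) (by linarith) (Real.neg_one_le_cos (α τ))])
  have hge : ∀ θ, θ₀ ≤ θ → u θ₀ ≤ u θ := fun θ hθ => hmono self_mem_Ici hθ hθ
  refine H.collapses_of_drift (θ₀ := θ₀)
    (K := slab (u θ₀) a₂ ∩ {z | homothetic lam z.1 z.2 ≤ 0})
    ((isCompact_slab _ _).inter_right (isClosed_le (continuous_homothetic lam) continuous_const))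
    (fun θ hθ => ⟨mem_slab θ (hge θ hθ) (hle θ hθ), hd' θ⟩) ?_
  rintro z ⟨⟨⟨h1, h2⟩, h3, h4⟩, h5⟩
  have h0 : 0 < z.1 := (H.u_pos θ₀).trans_le h1
  refine ⟨h0, h2.trans h21.le, ?_⟩
  by_contra hc
  have := mul_nonneg (polyP_pos hl h0).le (not_lt.1 hc)
  have h6 := polyQ_pos h0 (h2.trans_lt h21)
  have h7 : homothetic lam z.1 z.2 ≤ 0 := h5
  unfold homothetic at h7
  linarith

end PastFlow

/-! ### Escape to the far past. -/

/-- The trajectory comes from the far past. -/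
def Escapes (u ρ : ℝ → ℝ) : Prop := Tendsto ρ atTop atTop ∧ ∃ a, 1 < a ∧ ∀ᶠ θ in atTop, a ≤ u θ

/-- A convex combination of the values P + Q and P - Q at c = ±1: the first is positive below `a₀`,
the second above `a₁`. -/
theorem Landscape.radial_pos {lam a₂ u₁ a₁ a₀ : ℝ} (H : Landscape lam a₂ u₁ a₁ a₀) {u c : ℝ}
    (h1 : a₁ < u) (h2 : u < a₀) (hc1 : -1 ≤ c) (hc2 : c ≤ 1) : 0 < radial lam u c := by
  have h3 := H.add_pos u (H.a₁_pos.trans h1) h2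
  have h4 := H.gt_of_gt u h1
  have e : 2 * radial lam u c = (1 + c) * (polyP lam u + polyQ u) + (1 - c) * (polyP lam u - polyQ u) := by
    unfold radial; ring
  rcases hc1.eq_or_lt with rfl | h
  · linarith
  · have := mul_pos (show 0 < 1 + c by linarith) h3
    have := mul_nonneg (show 0 ≤ 1 - c by linarith) (sub_pos.2 h4).le
    linarith

namespace PastFlow

variable {lam : ℝ} {u α ρ Λ : ℝ → ℝ} {a₂ u₁ a₁ a₀ : ℝ}

theorem exists_ge_of_gt (H : PastFlow lam u α ρ Λ) (hL : Landscape lam a₂ u₁ a₁ a₀) {θ₀ a : ℝ}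
    (hu : a₁ < u θ₀) (ha : a < a₀) : ∃ θ, θ₀ ≤ θ ∧ a ≤ u θ := by
  by_contra! hlt
  have hge := le_of_deriv_pos_of_eq (θ₀ := θ₀) H.deriv_u le_rfl (fun θ hθ e => by
    have h1 := hL.radial_pos (c := Real.cos (α θ)) (hu.trans_eq e.symm) ((hlt θ hθ).trans ha)
      (Real.neg_one_le_cos _) (Real.cos_le_one _)
    have h2 := H.u_pos θ
    exact div_pos (mul_pos h2 h1) (by positivity))
  have hc1 := SelfSimilarDust.continuous_radial lam
  have hlim := tendsto_atTop_of_drift H.deriv_u (isCompact_slab (u θ₀) a)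
    (z := fun θ => (u θ, Real.cos (α θ))) (θ₀ := θ₀)
    (g := fun z => z.1 * radial lam z.1 z.2 / (1 + z.1 ^ 4))
    (fun θ hθ => mem_slab θ (hge θ hθ) (hlt θ hθ).le)
    (Continuous.continuousOn (Continuous.div (by fun_prop) (by fun_prop) fun z => one_add_pow_ne _))
    (fun z hz => by
      obtain ⟨⟨h1, h2⟩, h3, h4⟩ := hz
      have h5 : 0 < z.1 := (H.u_pos _).trans_le h1
      have h6 := hL.radial_pos (hu.trans_le h1) (h2.trans_lt ha) h3 h4
      positivity)
    (fun θ _ => le_rfl)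
  obtain ⟨θ, hθ, h1⟩ := ((eventually_ge_atTop θ₀).and (hlim.eventually_ge_atTop a)).exists
  linarith [hlt θ hθ]

theorem ge_of_ge (H : PastFlow lam u α ρ Λ) (hL : Landscape lam a₂ u₁ a₁ a₀) {θ₀ a : ℝ}
    (ha1 : a₁ < a) (ha : a < a₀) (hu : a ≤ u θ₀) : ∀ θ, θ₀ ≤ θ → a ≤ u θ :=
  le_of_deriv_pos_of_eq H.deriv_u hu (fun θ _ e => by
    have h1 := hL.radial_pos (c := Real.cos (α θ)) (ha1.trans_eq e.symm) (by rw [e]; exact ha)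
      (Real.neg_one_le_cos _) (Real.cos_le_one _)
    have h2 := H.u_pos θ
    exact div_pos (mul_pos h2 h1) (by positivity))

/-- Beyond `x = 0`, every trajectory which is not radially outgoing comes from the far past. -/
theorem escapes_of_gt (H : PastFlow lam u α ρ Λ) (hL : Landscape lam a₂ u₁ a₁ a₀) {θ₀ : ℝ}
    (hu : a₁ < u θ₀) (hc : -1 < Real.cos (α θ₀)) : Escapes u ρ := by
  obtain ⟨a, ha1, ha⟩ := exists_between hL.one_lt
  obtain ⟨θ₁, -, h1⟩ := H.exists_ge_of_gt hL hu ha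
  have hge := H.ge_of_ge hL (hL.a₁_lt.trans ha1) ha h1
  have hl := hL.lam_pos
  have hl3 := hL.lam_lt
  have hc' := H.cos_gt hc
  -- Here 2λ < 3 enters: for u ≥ 1 the factor driving cos α upwards is positive even at cos α = -1.
  have hrate : ∀ θ, θ₁ ≤ θ → (3 - 2 * lam) / 6 ≤
      (u θ * (u θ ^ 3 + 2) + 2 * lam * Real.cos (α θ)) / (1 + u θ ^ 4) := by
    intro θ hθ
    have h2 : 1 ≤ u θ := ha1.le.trans (hge θ hθ)
    have h3 : 1 ≤ u θ ^ 4 := one_le_pow₀ h2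
    rw [le_div_iff₀ (by positivity)]
    have h4 := mul_le_mul_of_nonneg_left (Real.neg_one_le_cos (α θ)) hl.le
    nlinarith [mul_nonneg hl.le (sub_nonneg.2 h3)]
  have hderiv : ∀ θ, θ₁ ≤ θ → 3 * (1 - Real.cos (α θ) ^ 2) * ((3 - 2 * lam) / 6) ≤
      3 * (1 - Real.cos (α θ) ^ 2) * (u θ * (u θ ^ 3 + 2) + 2 * lam * Real.cos (α θ)) /
      (1 + u θ ^ 4) := by
    intro θ hθ
    rw [mul_div_assoc]
    exact mul_le_mul_of_nonneg_left (hrate θ hθ) (mul_nonneg (by norm_num)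
      (by linarith [Real.cos_sq_le_one (α θ)]))
  have hmono : MonotoneOn (fun θ => Real.cos (α θ)) (Ici θ₁) :=
    monotoneOn_of_hasDerivAt_nonneg (convex_Ici θ₁) H.deriv_cos (fun θ hθ => by
      rw [interior_Ici] at hθ
      refine le_trans ?_ (hderiv θ (le_of_lt hθ))
      exact mul_nonneg (mul_nonneg (by norm_num) (by linarith [Real.cos_sq_le_one (α θ)]))
        (by linarith))
  -- While cos α stays between its initial value, which exceeds -1, and 1/2, the factor 1 - cos² α
  -- is bounded below; 3/4 is its value at 1/2.
  obtain ⟨θ₂, h12, hhalf⟩ : ∃ θ, θ₁ ≤ θ ∧ 1 / 2 ≤ Real.cos (α θ) := by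
    by_contra! hlt
    have hlim := tendsto_atTop_of_deriv_ge H.deriv_cos (θ₀ := θ₁)
      (δ := 3 * min (1 - Real.cos (α θ₁) ^ 2) (3 / 4) * ((3 - 2 * lam) / 6)) (by
        have h2 := hlt θ₁ le_rfl
        have h3 := hc' θ₁
        have : 0 < min (1 - Real.cos (α θ₁) ^ 2) (3 / 4) := lt_min (by nlinarith) (by norm_num)
        have : 0 < (3 - 2 * lam) / 6 := by linarith
        positivity) (fun θ hθ => by
        refine le_trans ?_ (hderiv θ hθ)
        have h2 := hlt θ hθ
        have h3 : Real.cos (α θ₁) ≤ Real.cos (α θ) := hmono self_mem_Ici hθ hθ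
        have h4 := hc' θ₁
        refine mul_le_mul_of_nonneg_right (mul_le_mul_of_nonneg_left ?_ (by norm_num)) (by linarith)
        rcases le_total 0 (Real.cos (α θ)) with h | h
        · exact (min_le_right _ _).trans (by nlinarith)
        · exact (min_le_left _ _).trans (by nlinarith))
    obtain ⟨θ, hθ, h1⟩ := ((eventually_ge_atTop θ₁).and (hlim.eventually_ge_atTop 1)).exists
    linarith [hlt θ hθ]
  refine ⟨tendsto_atTop_of_deriv_ge H.deriv_ρ (δ := 9 / 4) (θ₀ := θ₂) (by norm_num) ?_, a, ha1,
    (eventually_ge_atTop θ₁).mono hge⟩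
  intro θ hθ
  have h2 : 1 ≤ u θ := ha1.le.trans (hge θ (h12.trans hθ))
  have h3 : 1 ≤ u θ ^ 4 := one_le_pow₀ h2
  have h4 : Real.cos (α θ₂) ≤ Real.cos (α θ) := hmono h12 (h12.trans hθ) hθ
  rw [le_div_iff₀ (by positivity)]
  nlinarith

end PastFlow

/-! ### The critical direction and the dichotomy. -/

/-- The cosine of the critical angle, as a function of `u = (1 - λ x)^(1/3)`. -/
noncomputable def critCos (lam u₁ u : ℝ) : ℝ :=
  (-(polyP lam u * polyQ u) + (if u < u₁ then 1 else -1) *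
    Real.sqrt (9 * lam ^ 2 * u ^ 6 * pot lam u₁ *
      (polyP lam u ^ 2 - polyQ u ^ 2 + 9 * lam ^ 2 * u ^ 6 * pot lam u₁))) /
    (polyP lam u ^ 2 + 9 * lam ^ 2 * u ^ 6 * pot lam u₁)

section Algebra

variable {p q k G T R : ℝ}

/-- Here p, q, k stand for P, Q, `critK`, G for p² - q² + k, T for (p² + k) cos α + pq, and R for
`critRoot`. The hypotheses `hy` and `hd` are the signs of the two momenta. If T ≤ -R, they give qR ≤
pG and pR < qk, which contradict each other because R² = kG. -/
theorem abs_lt_of_reflected (hp : 0 < p) (hk : 0 < k) (hR : 0 < R) (hRR : R ^ 2 = k * G)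
    (hy : 0 ≤ p * G + q * T) (hd : 0 < q * k + p * T) (hq : 0 < q) (hT : T < R) : T ^ 2 < R ^ 2 := by
  have hT' : -R < T := by
    by_contra hc
    have hc := not_lt.1 hc
    have h1 : q * R ≤ p * G := by nlinarith
    have h2 : p * R < q * k := by nlinarith
    have h3 : k * (q * R) ≤ k * (p * G) := mul_le_mul_of_nonneg_left h1 hk.le
    have h4 : R * (p * R) < R * (q * k) := mul_lt_mul_of_pos_left h2 hR
    nlinarith
  exact sq_lt_sq' hT' hT

/-- Both inequalities reduce after squaring to p²G ≤ q²k, and q²k - p²G factors as (q² - p²)(p² +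
k). They give the signs of the momenta on the far side of the barrier, where P ≤ Q. -/
theorem mul_root_le (hp : 0 ≤ p) (hq : 0 ≤ q) (hpq : p ≤ q) (hk : 0 ≤ k) (hG : 0 ≤ G)
    (hGe : G = p ^ 2 - q ^ 2 + k) (hR : 0 ≤ R) (hRR : R ^ 2 = k * G) : p * G ≤ q * R ∧ p * R ≤ q * k := by
  have h : p ^ 2 * G ≤ q ^ 2 * k := by
    have : q ^ 2 * k - p ^ 2 * G = (q ^ 2 - p ^ 2) * (p ^ 2 + k) := by rw [hGe]; ring
    have : 0 ≤ (q ^ 2 - p ^ 2) * (p ^ 2 + k) :=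
      mul_nonneg (sub_nonneg.2 (by gcongr)) (by positivity)
    linarith
  constructor
  · refine le_of_sq_le_sq ?_ (by positivity)
    have := mul_le_mul_of_nonneg_right h hG
    nlinarith
  · refine le_of_sq_le_sq ?_ (by positivity)
    have := mul_le_mul_of_nonneg_right h hk
    nlinarith

end Algebra

/-- The value of `Q² - P²` at the top of the barrier. -/
noncomputable def critK (lam u₁ u : ℝ) : ℝ := 9 * lam ^ 2 * u ^ 6 * pot lam u₁

noncomputable def critRoot (lam u₁ u : ℝ) : ℝ :=
  Real.sqrt (critK lam u₁ u * (polyP lam u ^ 2 - polyQ u ^ 2 + critK lam u₁ u))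

namespace Landscape

variable {lam a₂ u₁ a₁ a₀ : ℝ}

theorem critK_pos (H : Landscape lam a₂ u₁ a₁ a₀) {u : ℝ} (hu : 0 < u) : 0 < critK lam u₁ u := by
  have := H.lam_pos
  have := H.pot_u₁_pos
  unfold critK; positivity

theorem critG_eq (H : Landscape lam a₂ u₁ a₁ a₀) {u : ℝ} (hu : 0 < u) :
    polyP lam u ^ 2 - polyQ u ^ 2 + critK lam u₁ u =
      9 * lam ^ 2 * u ^ 6 * (pot lam u₁ - pot lam u) := by
  have := pot_mul H.lam_pos.ne' hu.ne'
  unfold critK; linarith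

theorem critG_nonneg (H : Landscape lam a₂ u₁ a₁ a₀) {u : ℝ} (hu : 0 < u) (h1 : u ≤ 1) :
    0 ≤ polyP lam u ^ 2 - polyQ u ^ 2 + critK lam u₁ u := by
  rw [H.critG_eq hu]
  exact mul_nonneg (by positivity) (sub_nonneg.2 (H.pot_le hu h1))

theorem critG_pos (H : Landscape lam a₂ u₁ a₁ a₀) {u : ℝ} (hu : 0 < u) (h1 : u ≤ 1) (hne : u ≠ u₁) :
    0 < polyP lam u ^ 2 - polyQ u ^ 2 + critK lam u₁ u := by
  have := H.lam_pos
  rw [H.critG_eq hu]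
  exact mul_pos (by positivity) (sub_pos.2 (H.pot_lt hu h1 hne))

theorem critRoot_sq (H : Landscape lam a₂ u₁ a₁ a₀) {u : ℝ} (hu : 0 < u) (h1 : u ≤ 1) :
    critRoot lam u₁ u ^ 2 =
      critK lam u₁ u * (polyP lam u ^ 2 - polyQ u ^ 2 + critK lam u₁ u) :=
  Real.sq_sqrt (mul_nonneg (H.critK_pos hu).le (H.critG_nonneg hu h1))

theorem mul_critCos (H : Landscape lam a₂ u₁ a₁ a₀) {u : ℝ} (hu : 0 < u) :
    (polyP lam u ^ 2 + critK lam u₁ u) * critCos lam u₁ u + polyP lam u * polyQ u =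
      (if u < u₁ then 1 else -1) * critRoot lam u₁ u := by
  have h := H.critK_pos hu
  have h2 : polyP lam u ^ 2 + critK lam u₁ u ≠ 0 := by positivity
  unfold critCos critRoot
  rw [← critK, mul_div_cancel₀ _ h2]
  ring

theorem critRoot_u₁ (H : Landscape lam a₂ u₁ a₁ a₀) : critRoot lam u₁ u₁ = 0 := by
  unfold critRoot
  rw [H.critG_eq H.u₁_pos, sub_self, mul_zero, mul_zero, Real.sqrt_zero]

/-- Where P = Q the root equals `critK`. This makes the critical angle join continuously with π at
J₁. -/
theorem critCos_a₁ (H : Landscape lam a₂ u₁ a₁ a₀) : critCos lam u₁ a₁ = -1 := by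
  have h := H.mul_critCos H.a₁_pos
  have hk := H.critK_pos H.a₁_pos
  rw [if_neg (not_lt.2 H.u₁_lt.le), critRoot, H.eq_a₁, sub_self, zero_add, Real.sqrt_mul_self hk.le] at h
  have h2 : polyQ a₁ ^ 2 + critK lam u₁ a₁ ≠ 0 := by positivity
  apply mul_left_cancel₀ h2
  linarith

end Landscape

/-- Deficit of energy below the top of the barrier, up to a positive factor. -/
theorem critDiscr_eq (p q k c : ℝ) : (p ^ 2 + k) * ((q + p * c) ^ 2 - k * (1 - c ^ 2)) =
    ((p ^ 2 + k) * c + p * q) ^ 2 - k * (p ^ 2 - q ^ 2 + k) := by ring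

namespace PastFlow

variable {lam : ℝ} {u α ρ Λ : ℝ → ℝ} {a₂ u₁ a₁ a₀ : ℝ}

/-- The square of the (normalized) impact parameter. -/
theorem exists_impact (H : PastFlow lam u α ρ Λ) {θ₀ : ℝ}
    (hd : 0 < homothetic lam (u θ₀) (Real.cos (α θ₀))) : ∃ b, 0 ≤ b ∧
      (∀ θ, b * homothetic lam (u θ) (Real.cos (α θ)) ^ 2 =
        9 * lam ^ 2 * u θ ^ 6 * (1 - Real.cos (α θ) ^ 2)) ∧
      (∀ θ, b * pot lam u₁ * homothetic lam (u θ) (Real.cos (α θ)) ^ 2 =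
        critK lam u₁ (u θ) * (1 - Real.cos (α θ) ^ 2)) := by
  have h1 : 0 ≤ 1 - Real.cos (α θ₀) ^ 2 := sub_nonneg.2 (Real.cos_sq_le_one _)
  have h2 : ∀ θ, 9 * lam ^ 2 * u θ₀ ^ 6 * (1 - Real.cos (α θ₀) ^ 2) /
      homothetic lam (u θ₀) (Real.cos (α θ₀)) ^ 2 * homothetic lam (u θ) (Real.cos (α θ)) ^ 2 =
        9 * lam ^ 2 * u θ ^ 6 * (1 - Real.cos (α θ) ^ 2) :=
    H.impact_eq (θ₀ := θ₀) (div_mul_cancel₀ _ (by positivity))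
  refine ⟨_, div_nonneg (mul_nonneg (by positivity) h1) (sq_nonneg _), h2, fun θ => ?_⟩
  rw [mul_right_comm, h2, critK]
  ring

/-- With T and R as in `abs_lt_of_reflected` the hypothesis reads T < R for u < `u₁` and T < -R for
u > `u₁`, and by `critDiscr_eq` T² < R² means b W(x_c) > 1. Below `u₁` the trajectory either already
moves down, or has |T| < R and is reflected by the barrier. At `u₁` the root vanishes and the
velocity is negative. Above `u₁` the velocity is negative and the energy suffices to cross. -/
theorem collapses_of_lt_critCos (H : PastFlow lam u α ρ Λ) (hL : Landscape lam a₂ u₁ a₁ a₀)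
    (hu : u 0 ≤ a₁) (hc : Real.cos (α 0) < critCos lam u₁ (u 0)) : Collapses u ρ := by
  have hu0 := H.u_pos 0
  have hua : u 0 < a₁ := lt_of_le_of_ne hu fun e => by
    rw [e, hL.critCos_a₁] at hc
    linarith [Real.neg_one_le_cos (α 0)]
  rcases le_or_gt (homothetic lam (u 0) (Real.cos (α 0))) 0 with hd | hd
  · exact H.collapses_of_homothetic_nonpos hL hd hua
  obtain ⟨b, hb0, hb, hbW⟩ := H.exists_impact hd
  have hd' := H.homothetic_pos hd
  have hu1 : u 0 < 1 := hua.trans hL.a₁_lt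
  have hp := polyP_pos hL.lam_pos hu0
  have hq := polyQ_pos hu0 hu1
  have hk := hL.critK_pos hu0
  have hG0 := hL.critG_nonneg hu0 hu1.le
  have hGpos := hL.critG_pos hu0 hu1.le
  have hR0 : 0 ≤ critRoot lam u₁ (u 0) := Real.sqrt_nonneg _
  have hRR := hL.critRoot_sq hu0 hu1.le
  have hT : (polyP lam (u 0) ^ 2 + critK lam u₁ (u 0)) * Real.cos (α 0) + polyP lam (u 0) * polyQ (u 0) <
      (if u 0 < u₁ then 1 else -1) * critRoot lam u₁ (u 0) := by
    rw [← hL.mul_critCos hu0]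
    have : 0 < polyP lam (u 0) ^ 2 + critK lam u₁ (u 0) := by positivity
    gcongr
  have hpk : 0 < polyP lam (u 0) ^ 2 + critK lam u₁ (u 0) := by positivity
  -- Up to the positive factor P² + `critK`, both momenta are affine in the quantity called T below.
  have hyT : (polyP lam (u 0) ^ 2 + critK lam u₁ (u 0)) * radial lam (u 0) (Real.cos (α 0)) =
      polyP lam (u 0) * (polyP lam (u 0) ^ 2 - polyQ (u 0) ^ 2 + critK lam u₁ (u 0)) +
      polyQ (u 0) * ((polyP lam (u 0) ^ 2 + critK lam u₁ (u 0)) * Real.cos (α 0) +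
        polyP lam (u 0) * polyQ (u 0)) := by unfold radial; ring
  have hdT : (polyP lam (u 0) ^ 2 + critK lam u₁ (u 0)) * homothetic lam (u 0) (Real.cos (α 0)) =
      polyQ (u 0) * critK lam u₁ (u 0) +
      polyP lam (u 0) * ((polyP lam (u 0) ^ 2 + critK lam u₁ (u 0)) * Real.cos (α 0) +
        polyP lam (u 0) * polyQ (u 0)) := by unfold homothetic; ring
  have hdisc := critDiscr_eq (polyP lam (u 0)) (polyQ (u 0)) (critK lam u₁ (u 0)) (Real.cos (α 0))
  have hbW0 := hbW 0
  change _ * (homothetic lam (u 0) (Real.cos (α 0)) ^ 2 - _) = _ at hdisc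
  have hpd := mul_pos hpk hd
  rw [hdT] at hpd
  generalize (polyP lam (u 0) ^ 2 + critK lam u₁ (u 0)) * Real.cos (α 0) +
    polyP lam (u 0) * polyQ (u 0) = T at *
  set k := critK lam u₁ (u 0)
  set R := critRoot lam u₁ (u 0)
  set G := polyP lam (u 0) ^ 2 - polyQ (u 0) ^ 2 + k
  have hyneg : polyP lam (u 0) * G + polyQ (u 0) * T < 0 → radial lam (u 0) (Real.cos (α 0)) < 0 := by
    intro h
    rw [← hyT] at h
    exact neg_of_mul_neg_right h hpk.le
  rcases lt_trichotomy (u 0) u₁ with h | h | h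
  · rw [if_pos h, one_mul] at hT
    rcases lt_or_ge (radial lam (u 0) (Real.cos (α 0))) 0 with hy | hy
    · exact H.collapses_of_radial_neg hL hd' hb0 hb hy h.le
    have hR : 0 < R := Real.sqrt_pos.2 (mul_pos hk (hGpos h.ne))
    have h3 := abs_lt_of_reflected hp hk hR hRR (by rw [← hyT]; positivity) hpd hq hT
    have h4 : 1 < b * pot lam u₁ := by
      have h5 : homothetic lam (u 0) (Real.cos (α 0)) ^ 2 - k * (1 - Real.cos (α 0) ^ 2) < 0 := by
        refine neg_of_mul_neg_right (a := polyP lam (u 0) ^ 2 + k) ?_ hpk.le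
        rw [hdisc, ← hRR]; linarith
      have h6 := pow_pos hd 2
      by_contra hc
      nlinarith
    obtain ⟨θ, -, hy', hu'⟩ := H.exists_turn_down hL hd' hb0 hb h h4
    exact H.collapses_of_radial_neg hL hd' hb0 hb hy' hu'.le
  · have hR : R = 0 := by
      change critRoot lam u₁ (u 0) = 0
      rw [h]
      exact hL.critRoot_u₁
    rw [hR, mul_zero] at hT
    have hG : G = 0 := by
      rw [hR] at hRR
      rcases mul_eq_zero.1 (show k * G = 0 by linarith) with h | h
      · exact absurd h hk.ne'
      · exact h
    refine H.collapses_of_radial_neg hL hd' hb0 hb (hyneg ?_) h.le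
    rw [hG]
    nlinarith
  · rw [if_neg (not_lt.2 h.le)] at hT
    have hR : 0 < R := Real.sqrt_pos.2 (mul_pos hk (hGpos h.ne'))
    have hpq := hL.polyP_lt_polyQ h.le hua
    have h1 := (mul_root_le hp.le hq.le hpq.le hk.le hG0 rfl hR0 hRR).1
    have hy := hyneg (by nlinarith)
    have h4 : b * pot lam u₁ < 1 := by
      have h5 : 0 < homothetic lam (u 0) (Real.cos (α 0)) ^ 2 - k * (1 - Real.cos (α 0) ^ 2) := by
        refine pos_of_mul_pos_right (a := polyP lam (u 0) ^ 2 + k) ?_ hpk.le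
        rw [hdisc, ← hRR]; nlinarith
      have h6 := pow_pos hd 2
      by_contra hc
      nlinarith
    obtain ⟨θ, -, hy', hu'⟩ := H.exists_cross_down hL hd' hb0 hb hy hua h4
    exact H.collapses_of_radial_neg hL hd' hb0 hb hy' hu'

theorem escapes_of_radial_pos (H : PastFlow lam u α ρ Λ) (hL : Landscape lam a₂ u₁ a₁ a₀) {b e θ₀ : ℝ}
    (hd : ∀ θ, 0 < homothetic lam (u θ) (Real.cos (α θ))) (hb0 : 0 ≤ b)
    (hb : ∀ θ, b * homothetic lam (u θ) (Real.cos (α θ)) ^ 2 =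
      9 * lam ^ 2 * u θ ^ 6 * (1 - Real.cos (α θ) ^ 2))
    (hy : 0 < radial lam (u θ₀) (Real.cos (α θ₀))) (he : 0 < e)
    (hW : ∀ r, u θ₀ ≤ r → r ≤ 1 → e ≤ 1 - b * pot lam r) : Escapes u ρ := by
  obtain ⟨θ, -, h1⟩ := H.exists_ge_one hL hd hb0 hb hy he hW
  refine H.escapes_of_gt hL (hL.a₁_lt.trans_le h1) (H.cos_gt (θ₀ := θ₀) ?_ θ)
  refine lt_of_le_of_ne (Real.neg_one_le_cos _) fun h => ?_
  have := radial_add_homothetic lam (u θ₀) (Real.cos (α θ₀))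
  rw [← h] at this hy
  linarith [h ▸ hd θ₀]

/-- Beyond the barrier, a trajectory on its way out comes from the far past. -/
theorem escapes_of_radial_pos_of_gt (H : PastFlow lam u α ρ Λ) (hL : Landscape lam a₂ u₁ a₁ a₀)
    {b θ₀ : ℝ} (hd : ∀ θ, 0 < homothetic lam (u θ) (Real.cos (α θ))) (hb0 : 0 ≤ b)
    (hb : ∀ θ, b * homothetic lam (u θ) (Real.cos (α θ)) ^ 2 =
      9 * lam ^ 2 * u θ ^ 6 * (1 - Real.cos (α θ) ^ 2))
    (hy : 0 < radial lam (u θ₀) (Real.cos (α θ₀))) (hu' : u₁ ≤ u θ₀) :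
    Escapes u ρ := by
  have h1 : 0 < 1 - b * pot lam (u θ₀) := by
    have h2 := radial_sq hL.lam_pos.ne' (H.u_pos θ₀).ne' (hb θ₀)
    refine pos_of_mul_pos_left (b := homothetic lam (u θ₀) (Real.cos (α θ₀)) ^ 2) ?_ (by positivity)
    rw [← h2]; positivity
  refine H.escapes_of_radial_pos hL (e := min 1 (1 - b * pot lam (u θ₀))) hd hb0 hb hy
    (lt_min one_pos h1) (fun r hr hr1 => ?_)
  rcases le_total r a₁ with h | h
  · refine (min_le_right _ _).trans ?_
    have := mul_le_mul_of_nonneg_left (hL.pot_strictAntiOn.antitoneOn ⟨hu', hr.trans h⟩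
      ⟨hu'.trans hr, h⟩ hr) hb0
    linarith
  · refine (min_le_left _ _).trans ?_
    have := mul_nonpos_of_nonneg_of_nonpos hb0 (hL.pot_nonpos h hr1)
    linarith

/-- For u ≤ `u₁`, T > R ≥ 0 makes both momenta positive and puts the energy above the top of the
barrier. For u > `u₁`, T > -R makes the homothetic momentum positive; then either the velocity is
already positive, and the potential only falls ahead, or |T| < R and the trajectory turns at the
barrier. -/
theorem escapes_of_critCos_lt (H : PastFlow lam u α ρ Λ) (hL : Landscape lam a₂ u₁ a₁ a₀)
    (hu : u 0 ≤ a₁) (hc : critCos lam u₁ (u 0) < Real.cos (α 0)) : Escapes u ρ := by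
  have hu0 := H.u_pos 0
  have hu1 : u 0 < 1 := hu.trans_lt hL.a₁_lt
  have hp := polyP_pos hL.lam_pos hu0
  have hq := polyQ_pos hu0 hu1
  have hk := hL.critK_pos hu0
  have hG0 := hL.critG_nonneg hu0 hu1.le
  have hGpos := hL.critG_pos hu0 hu1.le
  have hR0 : 0 ≤ critRoot lam u₁ (u 0) := Real.sqrt_nonneg _
  have hRR := hL.critRoot_sq hu0 hu1.le
  have hpk : 0 < polyP lam (u 0) ^ 2 + critK lam u₁ (u 0) := by positivity
  have hT : (if u 0 < u₁ then 1 else -1) * critRoot lam u₁ (u 0) <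
      (polyP lam (u 0) ^ 2 + critK lam u₁ (u 0)) * Real.cos (α 0) + polyP lam (u 0) * polyQ (u 0) := by
    rw [← hL.mul_critCos hu0]
    gcongr
  have hyT : (polyP lam (u 0) ^ 2 + critK lam u₁ (u 0)) * radial lam (u 0) (Real.cos (α 0)) =
      polyP lam (u 0) * (polyP lam (u 0) ^ 2 - polyQ (u 0) ^ 2 + critK lam u₁ (u 0)) +
      polyQ (u 0) * ((polyP lam (u 0) ^ 2 + critK lam u₁ (u 0)) * Real.cos (α 0) +
        polyP lam (u 0) * polyQ (u 0)) := by unfold radial; ring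
  have hdT : (polyP lam (u 0) ^ 2 + critK lam u₁ (u 0)) * homothetic lam (u 0) (Real.cos (α 0)) =
      polyQ (u 0) * critK lam u₁ (u 0) +
      polyP lam (u 0) * ((polyP lam (u 0) ^ 2 + critK lam u₁ (u 0)) * Real.cos (α 0) +
        polyP lam (u 0) * polyQ (u 0)) := by unfold homothetic; ring
  have hdisc := critDiscr_eq (polyP lam (u 0)) (polyQ (u 0)) (critK lam u₁ (u 0)) (Real.cos (α 0))
  change _ * (homothetic lam (u 0) (Real.cos (α 0)) ^ 2 - _) = _ at hdisc
  generalize (polyP lam (u 0) ^ 2 + critK lam u₁ (u 0)) * Real.cos (α 0) +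
    polyP lam (u 0) * polyQ (u 0) = T at *
  have hRu : u 0 = u₁ → critRoot lam u₁ (u 0) = 0 := fun e => by rw [e]; exact hL.critRoot_u₁
  set k := critK lam u₁ (u 0)
  set R := critRoot lam u₁ (u 0)
  set G := polyP lam (u 0) ^ 2 - polyQ (u 0) ^ 2 + k
  have hdpos : 0 < polyQ (u 0) * k + polyP lam (u 0) * T →
      0 < homothetic lam (u 0) (Real.cos (α 0)) := fun h => by
    rw [← hdT] at h
    exact pos_of_mul_pos_right h hpk.le
  rcases le_or_gt (u 0) u₁ with h | h
  · have hTR : R < T := by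
      rcases h.lt_or_eq with h' | h'
      · rwa [if_pos h', one_mul] at hT
      · rw [hRu h', mul_zero] at hT
        rwa [hRu h']
    have hT0 : 0 < T := hR0.trans_lt hTR
    have hd := hdpos (by positivity)
    obtain ⟨b, hb0, hb, hbW⟩ := H.exists_impact hd
    have hy : 0 < radial lam (u 0) (Real.cos (α 0)) := by
      refine pos_of_mul_pos_right (a := polyP lam (u 0) ^ 2 + k) ?_ hpk.le
      rw [hyT]; positivity
    have h4 : b * pot lam u₁ < 1 := by
      have h5 : 0 < homothetic lam (u 0) (Real.cos (α 0)) ^ 2 - k * (1 - Real.cos (α 0) ^ 2) := by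
        refine pos_of_mul_pos_right (a := polyP lam (u 0) ^ 2 + k) ?_ hpk.le
        rw [hdisc, ← hRR]; nlinarith
      have h6 := pow_pos hd 2
      have h7 := hbW 0
      by_contra hc
      nlinarith
    refine H.escapes_of_radial_pos hL (H.homothetic_pos hd) hb0 hb hy (sub_pos.2 h4)
      fun r hr hr1 => ?_
    have := mul_le_mul_of_nonneg_left (hL.pot_le (hu0.trans_le hr) hr1) hb0
    linarith
  · rw [if_neg (not_lt.2 h.le)] at hT
    have hG := hGpos h.ne'
    have hR : 0 < R := Real.sqrt_pos.2 (mul_pos hk hG)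
    have hpq : polyP lam (u 0) ≤ polyQ (u 0) := by
      rcases hu.lt_or_eq with h' | h'
      · exact (hL.polyP_lt_polyQ h.le h').le
      · rw [h']; exact hL.eq_a₁.le
    have h1 := (mul_root_le hp.le hq.le hpq hk.le hG0 rfl hR0 hRR).2
    have hd := hdpos (by nlinarith)
    obtain ⟨b, hb0, hb, hbW⟩ := H.exists_impact hd
    have hd' := H.homothetic_pos hd
    rcases lt_or_ge 0 (radial lam (u 0) (Real.cos (α 0))) with hy | hy
    · exact H.escapes_of_radial_pos_of_gt hL hd' hb0 hb hy h.le
    -- At `a₁` one has P = Q, so the two momenta coincide and the velocity would be positive.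
    have hua : u 0 < a₁ := lt_of_le_of_ne hu fun e => by
      have h8 := radial_add_homothetic lam (u 0) (Real.cos (α 0))
      have h9 : radial lam (u 0) (Real.cos (α 0)) = homothetic lam (u 0) (Real.cos (α 0)) := by
        unfold radial homothetic
        rw [e, hL.eq_a₁]
      linarith
    have h4 : 1 < b * pot lam u₁ := by
      have hTR : T < R := by
        have : polyP lam (u 0) * G + polyQ (u 0) * T ≤ 0 := by
          rw [← hyT]; exact mul_nonpos_of_nonneg_of_nonpos hpk.le hy
        by_contra hc
        have := mul_pos hp hG
        nlinarith
      have h5 : homothetic lam (u 0) (Real.cos (α 0)) ^ 2 - k * (1 - Real.cos (α 0) ^ 2) < 0 := by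
        refine neg_of_mul_neg_right (a := polyP lam (u 0) ^ 2 + k) ?_ hpk.le
        rw [hdisc, ← hRR]
        have := sq_lt_sq' (by linarith) hTR
        linarith
      have h6 := pow_pos hd 2
      have h7 := hbW 0
      by_contra hc
      nlinarith
    obtain ⟨θ, hθ, hy', hu'⟩ := H.exists_turn_up hL hd' hb0 hb h hua h4
    exact H.escapes_of_radial_pos_of_gt hL hd' hb0 hb hy' hu'.le

end PastFlow

/-! ### The metric functions in the coordinate u. -/

section MetricFunctions

variable {lam u : ℝ}

theorem one_sub_mul_div (hlam : lam ≠ 0) (u : ℝ) : 1 - lam * ((1 - u ^ 3) / lam) = u ^ 3 := by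
  field_simp; ring

theorem cube_rpow_third (hu : 0 < u) : (u ^ 3) ^ (1 / 3 : ℝ) = u := by
  rw [← Real.rpow_natCast, ← Real.rpow_mul hu.le]; norm_num

theorem cube_rpow_two_thirds (hu : 0 < u) : (u ^ 3) ^ (2 / 3 : ℝ) = u ^ 2 := by
  rw [← Real.rpow_natCast, ← Real.rpow_mul hu.le]; norm_num

theorem F_eq (hlam : lam ≠ 0) (hu : 0 < u) : F lam ((1 - u ^ 3) / lam) = (2 + u ^ 3) / (3 * u) := by
  unfold F
  rw [one_sub_mul_div hlam, cube_rpow_third hu]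
  field_simp
  ring

theorem S_eq (hlam : lam ≠ 0) (hu : 0 < u) : S lam ((1 - u ^ 3) / lam) = u ^ 2 := by
  unfold S
  rw [one_sub_mul_div hlam, cube_rpow_two_thirds hu]

theorem hasDerivAt_F (hlam : lam ≠ 0) (hu : 0 < u) :
    HasDerivAt (F lam) (2 * lam * (1 - u ^ 3) / (9 * u ^ 4)) ((1 - u ^ 3) / lam) := by
  have h1 : HasDerivAt (fun x : ℝ => 1 - lam * x) (-lam) ((1 - u ^ 3) / lam) := by
    simpa using ((hasDerivAt_id ((1 - u ^ 3) / lam)).const_mul lam).const_sub 1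
  have h2 : HasDerivAt (fun x : ℝ => 1 - lam * x / 3) (-(lam / 3)) ((1 - u ^ 3) / lam) := by
    simpa using (((hasDerivAt_id ((1 - u ^ 3) / lam)).const_mul lam).div_const 3).const_sub 1
  have h3 := h1.rpow_const (p := 1 / 3) (Or.inl (by rw [one_sub_mul_div hlam]; positivity))
  have h4 := h2.div h3 (by rw [one_sub_mul_div hlam]; positivity)
  refine h4.congr_deriv ?_
  have e : (u ^ 3) ^ ((1 : ℝ) / 3 - 1) = 1 / u ^ 2 := by
    rw [← Real.rpow_natCast, ← Real.rpow_mul hu.le]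
    norm_num
  rw [one_sub_mul_div hlam, cube_rpow_third hu, e]
  field_simp
  ring

theorem hasDerivAt_S (hlam : lam ≠ 0) (hu : 0 < u) :
    HasDerivAt (S lam) (-(2 * lam / (3 * u))) ((1 - u ^ 3) / lam) := by
  have h1 : HasDerivAt (fun x : ℝ => 1 - lam * x) (-lam) ((1 - u ^ 3) / lam) := by
    simpa using ((hasDerivAt_id ((1 - u ^ 3) / lam)).const_mul lam).const_sub 1
  have h3 := h1.rpow_const (p := 2 / 3) (Or.inl (by rw [one_sub_mul_div hlam]; positivity))
  refine h3.congr_deriv ?_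
  have e : (u ^ 3) ^ ((2 : ℝ) / 3 - 1) = 1 / u := by
    rw [← Real.rpow_natCast, ← Real.rpow_mul hu.le]
    norm_num
    rw [Real.rpow_neg hu.le]; norm_num
  rw [one_sub_mul_div hlam, e]
  field_simp

theorem W_eq (hlam : lam ≠ 0) (hu : 0 < u) : W lam ((1 - u ^ 3) / lam) = pot lam u := by
  unfold W pot polyP polyQ
  rw [F_eq hlam hu, S_eq hlam hu]
  field_simp
  ring

/-- The cube root which serves as self-similar coordinate. -/
theorem exists_coord (hlam : 0 < lam) {x : ℝ} (hx : x < 1 / lam) :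
    ∃ u : ℝ, 0 < u ∧ x = (1 - u ^ 3) / lam := by
  have h : 0 < 1 - lam * x := by
    rw [lt_div_iff₀ hlam] at hx; linarith
  refine ⟨(1 - lam * x) ^ (1 / 3 : ℝ), by positivity, ?_⟩
  rw [← Real.rpow_natCast, ← Real.rpow_mul h.le]
  norm_num
  field_simp

theorem coord_lt (hlam : 0 < lam) (hu : 0 < u) : (1 - u ^ 3) / lam < 1 / lam := by
  have : 0 < u ^ 3 := by positivity
  gcongr
  linarith

theorem coord_lt_iff (hlam : 0 < lam) (hu : 0 < u) {v : ℝ} (hv : 0 < v) :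
    (1 - u ^ 3) / lam < (1 - v ^ 3) / lam ↔ v < u := by
  rw [div_lt_div_iff_of_pos_right hlam, sub_lt_sub_iff_left, pow_lt_pow_iff_left₀ hv.le hu.le (by norm_num)]

variable {R : ℝ}

theorem mul_coord_div (hR : 0 < R) (x : ℝ) : R * x / R = x := by field_simp

theorem expPsi_eq (hlam : lam ≠ 0) (hu : 0 < u) (hR : 0 < R) :
    expPsi lam (R * ((1 - u ^ 3) / lam)) R = (2 + u ^ 3) / (3 * u) := by
  rw [expPsi, mul_coord_div hR, F_eq hlam hu]

theorem areal_eq (hlam : lam ≠ 0) (hu : 0 < u) (hR : 0 < R) :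
    areal lam (R * ((1 - u ^ 3) / lam)) R = R * u ^ 2 := by
  rw [areal, mul_coord_div hR, S_eq hlam hu]

theorem hasDerivAt_ratio_t (R t : ℝ) : HasDerivAt (fun τ => τ / R) (1 / R) t :=
  (hasDerivAt_id t).div_const R

theorem hasDerivAt_ratio_R (hR : 0 < R) (t : ℝ) : HasDerivAt (fun r => t / r) (-(t / R ^ 2)) R := by
  refine ((hasDerivAt_const R t).div (hasDerivAt_id R) hR.ne').congr_deriv ?_
  simp; ring

theorem deriv_expPsi_t (hlam : lam ≠ 0) (hu : 0 < u) (hR : 0 < R) :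
    deriv (fun τ => expPsi lam τ R) (R * ((1 - u ^ 3) / lam)) =
      2 * lam * (1 - u ^ 3) / (9 * u ^ 4) / R := by
  have h := hasDerivAt_F hlam hu
  rw [← mul_coord_div hR ((1 - u ^ 3) / lam)] at h
  have := (HasDerivAt.comp (R * ((1 - u ^ 3) / lam)) h (hasDerivAt_ratio_t R _)).deriv
  exact this.trans (by ring)

theorem deriv_expPsi_R (hlam : lam ≠ 0) (hu : 0 < u) (hR : 0 < R) :
    deriv (fun ρ => expPsi lam (R * ((1 - u ^ 3) / lam)) ρ) R =
      -(2 * lam * (1 - u ^ 3) / (9 * u ^ 4) * ((1 - u ^ 3) / lam) / R) := by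
  have h := hasDerivAt_F hlam hu
  rw [← mul_coord_div hR ((1 - u ^ 3) / lam)] at h
  have := (h.comp R (hasDerivAt_ratio_R hR (R * ((1 - u ^ 3) / lam)))).deriv
  refine this.trans ?_
  field_simp

theorem deriv_areal_t (hlam : lam ≠ 0) (hu : 0 < u) (hR : 0 < R) :
    deriv (fun τ => areal lam τ R) (R * ((1 - u ^ 3) / lam)) = -(2 * lam / (3 * u)) := by
  have h := hasDerivAt_S hlam hu
  rw [← mul_coord_div hR ((1 - u ^ 3) / lam)] at h
  have := ((HasDerivAt.comp (R * ((1 - u ^ 3) / lam)) h (hasDerivAt_ratio_t R _)).const_mul R).deriv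
  refine this.trans ?_
  field_simp

theorem deriv_areal_R (hlam : lam ≠ 0) (hu : 0 < u) (hR : 0 < R) :
    deriv (fun ρ => areal lam (R * ((1 - u ^ 3) / lam)) ρ) R =
      u ^ 2 + 2 * lam / (3 * u) * ((1 - u ^ 3) / lam) := by
  have h := hasDerivAt_S hlam hu
  rw [← mul_coord_div hR ((1 - u ^ 3) / lam)] at h
  have := ((hasDerivAt_id R).mul
    (h.comp R (hasDerivAt_ratio_R hR (R * ((1 - u ^ 3) / lam))))).deriv
  refine this.trans ?_
  simp only [Function.comp, id, mul_coord_div hR, S_eq hlam hu]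
  field_simp

end MetricFunctions

/-! ### From trajectories to null geodesics. -/

namespace PastFlow

variable {lam : ℝ} {u α ρ Λ : ℝ → ℝ}

/-- The null geodesic of a trajectory, in affine parametrization. -/
theorem exists_geodesic (H : PastFlow lam u α ρ Λ) (hlam : 0 < lam) (φ₀ : ℝ) :
    ∃ s T φ : ℝ → ℝ, s 0 = 0 ∧ StrictAnti s ∧ (∀ θ, T (s θ) = θ) ∧
      (Real.sin (α 0) = 0 → ∀ τ ∈ range s, φ τ = φ₀) ∧
      IsNullGeodesic lam (range s) (fun τ => Real.exp (ρ (T τ)) * ((1 - u (T τ) ^ 3) / lam))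
        (fun τ => Real.exp (ρ (T τ))) φ (fun τ => Real.exp (Λ (T τ)))
        (fun τ => -(Real.exp (Λ (T τ)) * ((2 + u (T τ) ^ 3) / (3 * u (T τ))) * Real.cos (α (T τ))))
        (Real.exp (ρ 0 + Λ 0) * u 0 ^ 2 * Real.sin (α 0)) := by
  have hu := H.u_pos
  have hcu := H.continuous_u
  have hcρ : Continuous ρ := continuous_iff_continuousAt.2 fun θ => (H.deriv_ρ θ).continuousAt
  have hcΛ : Continuous Λ := continuous_iff_continuousAt.2 fun θ => (H.deriv_Λ θ).continuousAt
  -- The affine parameter. Its rate is negative, because θ runs to the past; its size is the ratio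
  -- of dR/dθ to dR/ds.
  obtain ⟨s, hs0, hs⟩ := exists_antideriv (f := fun θ => -(3 * u θ ^ 3 * (2 + u θ ^ 3) * Real.exp (ρ θ) /
    ((1 + u θ ^ 4) * Real.exp (Λ θ)))) (Continuous.neg (Continuous.div (by fun_prop) (by fun_prop)
      fun θ => by positivity)) 0
  have hneg : ∀ θ, -(3 * u θ ^ 3 * (2 + u θ ^ 3) * Real.exp (ρ θ) /
      ((1 + u θ ^ 4) * Real.exp (Λ θ))) < 0 := fun θ => by
    have := hu θ
    rw [neg_lt_zero]; positivity
  obtain ⟨hopen, hord, hanti, T, hT, hT'⟩ := exists_decreasing_reparam hs hneg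
  set L := Real.exp (ρ 0 + Λ 0) * u 0 ^ 2 * Real.sin (α 0) with hL
  obtain ⟨φ, hφ0, hφ⟩ := exists_antideriv (f := fun θ => L / (Real.exp (ρ θ) * u θ ^ 2) ^ 2 *
    -(3 * u θ ^ 3 * (2 + u θ ^ 3) * Real.exp (ρ θ) / ((1 + u θ ^ 4) * Real.exp (Λ θ))))
    (Continuous.mul (Continuous.div (by fun_prop) (by fun_prop) fun θ => by
      have := hu θ; positivity) (Continuous.neg (Continuous.div (by fun_prop) (by fun_prop)
      fun θ => by positivity))) φ₀
  have hLθ : ∀ θ, L = Real.exp (ρ θ) * Real.exp (Λ θ) * u θ ^ 2 * Real.sin (α θ) := fun θ => by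
    rw [hL, ← H.angular_const θ, Real.exp_add]
  have hchain : ∀ {f : ℝ → ℝ} {f' θ : ℝ}, HasDerivAt f f' θ → HasDerivAt (fun τ => f (T τ))
      (f' * (-(3 * u θ ^ 3 * (2 + u θ ^ 3) * Real.exp (ρ θ) /
        ((1 + u θ ^ 4) * Real.exp (Λ θ))))⁻¹) (s θ) := by
    intro f f' θ hf
    rw [← hT θ] at hf
    have := HasDerivAt.comp (s θ) hf (hT' θ)
    exact this
  refine ⟨s, T, fun τ => φ (T τ), hs0, hanti, hT, ?_, ?_⟩
  · rintro h _ ⟨θ, rfl⟩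
    have : L = 0 := by rw [hL, h, mul_zero]
    change φ (T (s θ)) = φ₀
    rw [hT, const_of_hasDerivAt_zero hφ (fun θ => by rw [this]; simp) θ, hφ0]
  refine ⟨hopen, hord, range_nonempty s, ?_, ?_, ?_, ?_, ?_, ?_, ?_, ?_, ?_⟩
  · rintro _ ⟨θ, rfl⟩
    exact Real.exp_pos _
  · rintro _ ⟨θ, rfl⟩
    simp only [hT]
    rw [mul_coord_div (Real.exp_pos _)]
    exact coord_lt hlam (hu θ)
  · rintro _ ⟨θ, rfl⟩
    simp only [hT]
    refine (hchain ((H.deriv_ρ θ).exp.mul ((((H.deriv_u θ).pow 3).const_sub 1).div_const lam))).congr_deriv ?_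
    have h1 := hu θ
    have h2 := Real.exp_pos (ρ θ)
    have h3 := Real.exp_pos (Λ θ)
    have h4 : 1 + u θ ^ 4 ≠ 0 := by positivity
    have h5 : 2 + u θ ^ 3 ≠ 0 := by positivity
    simp only [Pi.pow_apply, polyP, polyQ]
    field_simp
    ring
  · rintro _ ⟨θ, rfl⟩
    simp only [hT]
    have h1 := hu θ
    have h2 := Real.exp_pos (ρ θ)
    have h3 := Real.exp_pos (Λ θ)
    have h4 : 1 + u θ ^ 4 ≠ 0 := by positivity
    have h5 : 2 + u θ ^ 3 ≠ 0 := by positivity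
    rw [expPsi_eq hlam.ne' h1 h2]
    refine (hchain (H.deriv_ρ θ).exp).congr_deriv ?_
    field_simp
    ring
  · rintro _ ⟨θ, rfl⟩
    simp only [hT]
    have h1 := hu θ
    have h2 := Real.exp_pos (ρ θ)
    have h3 := Real.exp_pos (Λ θ)
    rw [areal_eq hlam.ne' h1 h2]
    refine (hchain (hφ θ)).congr_deriv ?_
    exact mul_inv_cancel_right₀ (hneg θ).ne _
  · rintro _ ⟨θ, rfl⟩
    simp only [hT]
    have h1 := hu θ
    have h2 := Real.exp_pos (ρ θ)
    have h3 := Real.exp_pos (Λ θ)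
    have h4 : 1 + u θ ^ 4 ≠ 0 := by positivity
    have h5 : 2 + u θ ^ 3 ≠ 0 := by positivity
    rw [expPsi_eq hlam.ne' h1 h2, areal_eq hlam.ne' h1 h2, deriv_expPsi_t hlam.ne' h1 h2,
      deriv_areal_t hlam.ne' h1 h2, hLθ θ]
    refine (hchain (H.deriv_Λ θ).exp).congr_deriv ?_
    simp only [mul_pow, Real.sin_sq]
    field_simp
    ring
  · rintro _ ⟨θ, rfl⟩
    simp only [hT]
    have h1 := hu θ
    have h2 := Real.exp_pos (ρ θ)
    have h3 := Real.exp_pos (Λ θ)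
    have h4 : 1 + u θ ^ 4 ≠ 0 := by positivity
    have h5 : 2 + u θ ^ 3 ≠ 0 := by positivity
    rw [expPsi_eq hlam.ne' h1 h2, areal_eq hlam.ne' h1 h2, deriv_expPsi_R hlam.ne' h1 h2,
      deriv_areal_R hlam.ne' h1 h2, hLθ θ]
    refine (hchain ((((H.deriv_Λ θ).exp.mul ((((H.deriv_u θ).pow 3).const_add 2).div
      ((H.deriv_u θ).const_mul 3) (by positivity))).mul (H.deriv_cos θ)).neg)).congr_deriv ?_
    simp only [Pi.mul_apply, Pi.div_apply, Pi.pow_apply, mul_pow, Real.sin_sq, polyP, polyQ]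
    field_simp
    ring
  · rintro _ ⟨θ, rfl⟩
    simp only [hT]
    have h1 := hu θ
    have h2 := Real.exp_pos (ρ θ)
    have h3 := Real.exp_pos (Λ θ)
    have h5 : 2 + u θ ^ 3 ≠ 0 := by positivity
    rw [expPsi_eq hlam.ne' h1 h2, areal_eq hlam.ne' h1 h2, hLθ θ]
    simp only [neg_sq, mul_pow, Real.sin_sq]
    field_simp
    ring
  · rintro _ ⟨θ, rfl⟩
    exact Real.exp_pos _

end PastFlow

theorem tendsto_reparam_atBot {s T : ℝ → ℝ} (hs : StrictAnti s) (hT : ∀ θ, T (s θ) = θ) :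
    Tendsto (fun τ : range s => T τ) atBot atTop := by
  refine tendsto_atTop.2 fun N => ?_
  filter_upwards [eventually_le_atBot (⟨s N, N, rfl⟩ : range s)] with τ hτ
  obtain ⟨_, θ, rfl⟩ := τ
  rw [hT]
  exact hs.le_iff_ge.1 hτ

theorem tendsto_reparam_atTop {s T : ℝ → ℝ} (hs : StrictAnti s) (hT : ∀ θ, T (s θ) = θ) :
    Tendsto (fun τ : range s => T τ) atTop atBot := by
  refine tendsto_atBot.2 fun N => ?_
  filter_upwards [eventually_ge_atTop (⟨s N, N, rfl⟩ : range s)] with τ hτ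
  obtain ⟨_, θ, rfl⟩ := τ
  rw [hT]
  exact hs.le_iff_ge.1 hτ

theorem tendsto_of_antitoneOn_bddBelow {f : ℝ → ℝ} {θ₀ m : ℝ} (hf : AntitoneOn f (Ici θ₀))
    (hm : ∀ θ, θ₀ ≤ θ → m ≤ f θ) : ∃ l, Tendsto f atTop (𝓝 l) := by
  have hanti : Antitone fun θ => f (max θ θ₀) := fun x y h =>
    hf (show max x θ₀ ∈ Ici θ₀ from le_max_right x θ₀) (show max y θ₀ ∈ Ici θ₀ from le_max_right y θ₀)
      (max_le_max_right θ₀ h)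
  have hbdd : BddBelow (range fun θ => f (max θ θ₀)) :=
    ⟨m, by rintro _ ⟨θ, rfl⟩; exact hm _ (le_max_right _ _)⟩
  refine ⟨_, (tendsto_atTop_ciInf hanti hbdd).congr' ?_⟩
  filter_upwards [eventually_ge_atTop θ₀] with θ hθ
  rw [max_eq_left hθ]

/-! ### Radial rays near the regular center. -/

/-- Radial light rays arrive at the regular center at a finite negative time. -/
theorem tendsto_center {lam σ a κ θ₀ : ℝ} {u ρ : ℝ → ℝ} (hlam : 0 < lam) (hσ : |σ| ≤ 1)
    (hu : ∀ θ, HasDerivAt u (u θ * (σ * polyP lam (u θ) - polyQ (u θ)) / (1 + u θ ^ 4)) θ)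
    (hρ : ∀ θ, HasDerivAt ρ (-(9 * u θ ^ 4 / (1 + u θ ^ 4))) θ) (ha : 1 < a) (hκ : 0 < κ)
    (hge : ∀ θ, θ₀ ≤ θ → a ≤ u θ)
    (hrate : ∀ θ, θ₀ ≤ θ → κ * (1 + u θ ^ 4) ≤ σ * polyP lam (u θ) - polyQ (u θ)) :
    ∃ tc, tc < 0 ∧ Tendsto (fun θ => (Real.exp (ρ θ) * ((1 - u θ ^ 3) / lam), Real.exp (ρ θ))) atTop
      (𝓝 (tc, 0)) := by
  have hpos : ∀ θ, θ₀ ≤ θ → 0 < u θ := fun θ hθ => by linarith [hge θ hθ]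
  have hone : ∀ θ, θ₀ ≤ θ → 1 < u θ ^ 3 := fun θ hθ =>
    one_lt_pow₀ (ha.trans_le (hge θ hθ)) (by norm_num)
  have ha3 : 1 < a ^ 3 := one_lt_pow₀ ha (by norm_num)
  have hu' : ∀ θ, θ₀ ≤ θ →
      κ * u θ ≤ u θ * (σ * polyP lam (u θ) - polyQ (u θ)) / (1 + u θ ^ 4) := by
    intro θ hθ
    rw [le_div_iff₀ (by positivity)]
    nlinarith [mul_le_mul_of_nonneg_left (hrate θ hθ) (hpos θ hθ).le]
  have hulim : Tendsto u atTop atTop := by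
    refine tendsto_atTop_of_deriv_ge hu (δ := κ * a) (by positivity) (θ₀ := θ₀) fun θ hθ => ?_
    exact (mul_le_mul_of_nonneg_left (hge θ hθ) hκ.le).trans (hu' θ hθ)
  have hρlim : Tendsto ρ atTop atBot := by
    refine tendsto_neg_atTop_iff.1 (tendsto_atTop_of_deriv_ge (fun θ => (hρ θ).neg) (δ := 9 / 2)
      (by norm_num) (θ₀ := θ₀) fun θ hθ => ?_)
    have h1 : 1 ≤ u θ ^ 4 := one_le_pow₀ (ha.le.trans (hge θ hθ))
    rw [neg_neg, le_div_iff₀ (by positivity)]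
    linarith
  -- the logarithm of `-t`
  set N : ℝ → ℝ := fun θ => ρ θ + Real.log ((u θ ^ 3 - 1) / lam) with hN
  set N' : ℝ → ℝ := fun θ => 3 * u θ ^ 3 * (σ * polyP lam (u θ)) / ((u θ ^ 3 - 1) * (1 + u θ ^ 4))
  have hNd : ∀ θ, θ₀ ≤ θ → HasDerivAt N (N' θ) θ := by
    intro θ hθ
    have h1 : u θ ^ 3 - 1 ≠ 0 := (sub_pos.2 (hone θ hθ)).ne'
    have h4 : 1 + u θ ^ 4 ≠ 0 := by positivity
    refine ((hρ θ).add (((((hu θ).pow 3).sub_const 1).div_const lam).log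
      (div_ne_zero h1 hlam.ne'))).congr_deriv ?_
    simp only [Pi.pow_apply, N', polyQ]
    field_simp
    ring
  set K : ℝ := 9 * lam * (a ^ 3 / (a ^ 3 - 1)) with hK
  have hK0 : 0 < K := mul_pos (by positivity) (div_pos (by positivity) (by linarith))
  -- The terms with Q cancel in the derivative of log(-t), which leaves only a quantity of order
  -- 1/u.
  have hN' : ∀ θ, θ₀ ≤ θ → |N' θ| ≤ K / u θ := by
    intro θ hθ
    have h0 := hpos θ hθ
    have h1 := hone θ hθ
    have h2 : a ^ 3 ≤ u θ ^ 3 := by have := hge θ hθ; gcongr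
    have hp : 0 < polyP lam (u θ) := polyP_pos hlam h0
    have hden : 0 < (u θ ^ 3 - 1) * (1 + u θ ^ 4) := mul_pos (by linarith) (by positivity)
    have e1 : |N' θ| ≤ 3 * u θ ^ 3 * polyP lam (u θ) / ((u θ ^ 3 - 1) * (1 + u θ ^ 4)) := by
      simp only [N']
      rw [abs_div, abs_of_pos hden]
      gcongr
      rw [abs_mul (3 * u θ ^ 3), abs_mul σ, abs_of_pos hp,
        abs_of_pos (by positivity : 0 < 3 * u θ ^ 3)]
      have := mul_le_mul_of_nonneg_right hσ hp.le
      rw [one_mul] at this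
      gcongr
    refine e1.trans ?_
    rw [div_le_div_iff₀ hden h0]
    have e2 : u θ ^ 3 ≤ a ^ 3 / (a ^ 3 - 1) * (u θ ^ 3 - 1) := by
      rw [div_mul_eq_mul_div, le_div_iff₀ (by linarith)]
      nlinarith
    have e3 : polyP lam (u θ) ≤ lam * (3 * u θ ^ 3) := by
      unfold polyP; gcongr; linarith
    calc 3 * u θ ^ 3 * polyP lam (u θ) * u θ ≤ 3 * u θ ^ 3 * (lam * (3 * u θ ^ 3)) * u θ := by gcongr
      _ = 9 * lam * u θ ^ 4 * u θ ^ 3 := by ring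
      _ ≤ 9 * lam * u θ ^ 4 * (a ^ 3 / (a ^ 3 - 1) * (u θ ^ 3 - 1)) := by gcongr
      _ = K * ((u θ ^ 3 - 1) * u θ ^ 4) := by rw [hK]; ring
      _ ≤ K * ((u θ ^ 3 - 1) * (1 + u θ ^ 4)) := by
        have : 0 ≤ u θ ^ 3 - 1 := by linarith
        gcongr; linarith
  have hinv : ∀ θ, θ₀ ≤ θ → HasDerivAt (fun θ => K / κ * (u θ)⁻¹) (K / κ * (-(u θ *
      (σ * polyP lam (u θ) - polyQ (u θ)) / (1 + u θ ^ 4)) / u θ ^ 2)) θ := fun θ hθ =>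
    ((hu θ).fun_inv (hpos θ hθ).ne').const_mul _
  have hinv' : ∀ θ, θ₀ ≤ θ → K / κ * (-(u θ *
      (σ * polyP lam (u θ) - polyQ (u θ)) / (1 + u θ ^ 4)) / u θ ^ 2) ≤ -(K / u θ) := by
    intro θ hθ
    have h0 := hpos θ hθ
    have := mul_le_mul_of_nonneg_left (hu' θ hθ) (show 0 ≤ K / κ / u θ ^ 2 by positivity)
    have e : K / κ / u θ ^ 2 * (κ * u θ) = K / u θ := by field_simp
    rw [e] at this
    calc _ = -(K / κ / u θ ^ 2 *
          (u θ * (σ * polyP lam (u θ) - polyQ (u θ)) / (1 + u θ ^ 4))) := by ring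
      _ ≤ _ := neg_le_neg this
  -- Since u' ≥ κu, the derivative of (K/κ)/u is at most -K/u. So N becomes antitone when this
  -- function is added and monotone when it is subtracted; as the correction tends to 0, N
  -- converges, and -exp of its limit is the arrival time.
  have hanti : AntitoneOn (fun θ => N θ + K / κ * (u θ)⁻¹) (Ici θ₀) := by
    refine antitoneOn_of_deriv_nonpos (convex_Ici θ₀)
      (fun τ hτ => ((hNd τ hτ).add (hinv τ hτ)).continuousAt.continuousWithinAt)
      (fun τ hτ => ?_) (fun τ hτ => ?_) <;> rw [interior_Ici] at hτ
    · exact ((hNd τ (le_of_lt hτ)).add (hinv τ (le_of_lt hτ))).differentiableAt.differentiableWithinAt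
    · refine ((hNd τ (le_of_lt hτ)).add (hinv τ (le_of_lt hτ))).deriv.trans_le ?_
      linarith [hinv' τ (le_of_lt hτ), (abs_le.1 (hN' τ (le_of_lt hτ))).2]
  have hmono : MonotoneOn (fun θ => N θ - K / κ * (u θ)⁻¹) (Ici θ₀) := by
    refine monotoneOn_of_deriv_nonneg (convex_Ici θ₀)
      (fun τ hτ => ((hNd τ hτ).sub (hinv τ hτ)).continuousAt.continuousWithinAt)
      (fun τ hτ => ?_) (fun τ hτ => ?_) <;> rw [interior_Ici] at hτ
    · exact ((hNd τ (le_of_lt hτ)).sub (hinv τ (le_of_lt hτ))).differentiableAt.differentiableWithinAt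
    · refine le_of_le_of_eq ?_ ((hNd τ (le_of_lt hτ)).sub (hinv τ (le_of_lt hτ))).deriv.symm
      linarith [hinv' τ (le_of_lt hτ), (abs_le.1 (hN' τ (le_of_lt hτ))).1]
  obtain ⟨l, hl⟩ := tendsto_of_antitoneOn_bddBelow hanti (m := N θ₀ - K / κ * (u θ₀)⁻¹) (by
    intro θ hθ
    have h1 : N θ₀ - K / κ * (u θ₀)⁻¹ ≤ N θ - K / κ * (u θ)⁻¹ := hmono self_mem_Ici hθ hθ
    have h2 := hpos θ hθ
    have : 0 ≤ K / κ * (u θ)⁻¹ := by positivity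
    linarith)
  have hNlim : Tendsto N atTop (𝓝 l) := by
    have h1 : Tendsto (fun θ => K / κ * (u θ)⁻¹) atTop (𝓝 (K / κ * 0)) :=
      (tendsto_inv_atTop_zero.comp hulim).const_mul _
    have h2 := hl.sub h1
    simpa using h2
  refine ⟨-Real.exp l, neg_lt_zero.2 (Real.exp_pos _), Tendsto.prodMk_nhds ?_
    (Real.tendsto_exp_atBot.comp hρlim)⟩
  refine ((Real.continuous_exp.tendsto l).comp hNlim).neg.congr' ?_
  filter_upwards [eventually_ge_atTop θ₀] with θ hθ
  have h1 : 0 < (u θ ^ 3 - 1) / lam := div_pos (by linarith [hone θ hθ]) hlam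
  simp only [Function.comp, hN, Real.exp_add, Real.exp_log h1]
  ring

/-! ### Past ends of the constructed geodesics. -/

namespace PastFlow

variable {lam : ℝ} {u α ρ Λ : ℝ → ℝ} {a₂ u₁ a₁ a₀ : ℝ}

theorem exists_registered (H : PastFlow lam u α ρ Λ) (hlam : 0 < lam) :
    ∃ s T φ : ℝ → ℝ, StrictAnti s ∧ (∀ θ, T (s θ) = θ) ∧
      (Real.sin (α 0) = 0 → ∀ τ ∈ range s, φ τ = 0) ∧
      IsRegistered lam (range s) (fun τ => Real.exp (ρ (T τ)) * ((1 - u (T τ) ^ 3) / lam))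
        (fun τ => Real.exp (ρ (T τ))) φ (fun τ => Real.exp (Λ (T τ)))
        (fun τ => -(Real.exp (Λ (T τ)) * ((2 + u (T τ) ^ 3) / (3 * u (T τ))) * Real.cos (α (T τ))))
        (Real.exp (ρ 0 + Λ 0) * u 0 ^ 2 * Real.sin (α 0))
        (Real.exp (ρ 0) * ((1 - u 0 ^ 3) / lam)) (Real.exp (ρ 0)) (α 0) := by
  obtain ⟨s, T, φ, hs0, hs, hT, hφ, hgeo⟩ := H.exists_geodesic hlam 0
  have hT0 : T 0 = 0 := by have := hT 0; rwa [hs0] at this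
  have hu := H.u_pos 0
  have hR := Real.exp_pos (ρ 0)
  refine ⟨s, T, φ, hs, hT, hφ, hgeo, ⟨0, hs0⟩, by simp only [hT0], by simp only [hT0],
    Real.exp (Λ 0), Real.exp_pos _, by simp only [hT0], ?_, ?_⟩
  · simp only [hT0]
    rw [expPsi_eq hlam.ne' hu hR]
    field_simp
  · rw [areal_eq hlam.ne' hu hR, Real.exp_add]
    field_simp

theorem emanates (H : PastFlow lam u α ρ Λ) (hlam : 0 < lam) (hcol : Collapses u ρ) :
    EmanatesFromSingularity lam (Real.exp (ρ 0) * ((1 - u 0 ^ 3) / lam)) (Real.exp (ρ 0)) (α 0) := by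
  obtain ⟨s, T, φ, hs, hT, -, hreg⟩ := H.exists_registered hlam
  refine ⟨_, _, _, _, _, _, _, hreg, ?_⟩
  have hR : Tendsto (fun θ => Real.exp (ρ θ)) atTop (𝓝 0) := Real.tendsto_exp_atBot.comp hcol.1
  have ht : Tendsto (fun θ => Real.exp (ρ θ) * ((1 - u θ ^ 3) / lam)) atTop (𝓝 0) := by
    have h1 : Tendsto (fun θ => Real.exp (ρ θ) * (1 / lam)) atTop (𝓝 0) := by
      simpa using hR.mul_const (1 / lam)
    -- For u ≤ 1 one has 0 ≤ x < 1/λ, so t is squeezed between 0 and R/λ.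
    refine tendsto_of_tendsto_of_tendsto_of_le_of_le' tendsto_const_nhds h1 ?_ ?_
    · filter_upwards [hcol.2] with θ hθ
      have : u θ ^ 3 ≤ 1 := pow_le_one₀ (H.u_pos θ).le hθ
      have : 0 ≤ 1 - u θ ^ 3 := by linarith
      positivity
    · refine Eventually.of_forall fun θ => ?_
      have := coord_lt hlam (H.u_pos θ)
      gcongr
  exact (ht.prodMk_nhds hR).comp (tendsto_reparam_atBot hs hT)

theorem comesFromInfinity (H : PastFlow lam u α ρ Λ) (hlam : 0 < lam) (hesc : Escapes u ρ)
    {s T : ℝ → ℝ} (hs : StrictAnti s) (hT : ∀ θ, T (s θ) = θ) :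
    ComesFromInfinity lam (range s) (fun τ => Real.exp (ρ (T τ)) * ((1 - u (T τ) ^ 3) / lam))
      (fun τ => Real.exp (ρ (T τ))) := by
  obtain ⟨hρ, a, ha, hev⟩ := hesc
  have hR : Tendsto (fun θ => Real.exp (ρ θ)) atTop atTop := Real.tendsto_exp_atTop.comp hρ
  have ha3 : 1 < a ^ 3 := one_lt_pow₀ ha (by norm_num)
  have ht : Tendsto (fun θ => Real.exp (ρ θ) * ((1 - u θ ^ 3) / lam)) atTop atBot := by
    refine tendsto_atBot_mono' _ ?_ (hR.atTop_mul_const_of_neg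
      (show (1 - a ^ 3) / lam < 0 from div_neg_of_neg_of_pos (by linarith) hlam))
    filter_upwards [hev] with θ hθ
    gcongr
  have hA : Tendsto (fun θ => areal lam (Real.exp (ρ θ) * ((1 - u θ ^ 3) / lam)) (Real.exp (ρ θ)))
      atTop atTop := by
    refine tendsto_atTop_mono' _ ?_ hR
    filter_upwards [hev] with θ hθ
    rw [areal_eq hlam.ne' (H.u_pos θ) (Real.exp_pos _)]
    have : 1 ≤ u θ ^ 2 := one_le_pow₀ (ha.le.trans hθ)
    exact le_mul_of_one_le_right (Real.exp_pos _).le this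
  exact ⟨ht.comp (tendsto_reparam_atBot hs hT), hA.comp (tendsto_reparam_atBot hs hT)⟩

theorem originates (H : PastFlow lam u α ρ Λ) (hlam : 0 < lam) (hesc : Escapes u ρ) :
    OriginatesFromFarPast lam (Real.exp (ρ 0) * ((1 - u 0 ^ 3) / lam)) (Real.exp (ρ 0)) (α 0) := by
  obtain ⟨s, T, φ, hs, hT, -, hreg⟩ := H.exists_registered hlam
  exact ⟨_, _, _, _, _, _, _, hreg, Or.inl (H.comesFromInfinity hlam hesc hs hT)⟩

/-- The scaling symmetry (t, R) ↦ (e^d t, e^d R). -/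
theorem shift (H : PastFlow lam u α ρ Λ) (d : ℝ) : PastFlow lam u α (fun θ => ρ θ + d) Λ :=
  ⟨H.u_pos, H.deriv_u, H.deriv_α, fun θ => (H.deriv_ρ θ).add_const d, H.deriv_Λ⟩

/-- There is an ingoing radial trajectory which arrives at the center at the given time. -/
theorem exists_ingoing (hL : Landscape lam a₂ u₁ a₁ a₀) {tc : ℝ} (htc : tc < 0) :
    ∃ u α ρ Λ : ℝ → ℝ, PastFlow lam u α ρ Λ ∧ Real.sin (α 0) = 0 ∧ Escapes u ρ ∧
      Tendsto (fun θ => (Real.exp (ρ θ) * ((1 - u θ ^ 3) / lam), Real.exp (ρ θ))) atBot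
        (𝓝 (tc, 0)) := by
  have hlam := hL.lam_pos
  have ha0 : 0 < a₀ := one_pos.trans hL.one_lt
  -- The ingoing ray starts beyond `a₀`, where P + Q < 0. Followed to the future it has increasing u
  -- and runs into the center; the distance from `a₀` to 2`a₀` gives u - `a₀` ≥ u/2, hence the
  -- constant 3/4 below.
  obtain ⟨u, α, ρ, Λ, H, hu0, hα0, -, -⟩ := exists_pastFlow hlam (u₀ := 2 * a₀) (by positivity) 0 0 0
  have hsin : Real.sin (α 0) = 0 := by rw [hα0, Real.sin_zero]
  have hcos : ∀ θ, Real.cos (α θ) = 1 := fun θ => by rw [H.cos_const hsin, hα0, Real.cos_zero]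
  have hesc : Escapes u ρ := H.escapes_of_gt hL (θ₀ := 0)
    (by rw [hu0]; linarith [hL.a₁_lt, hL.one_lt]) (by rw [hcos]; norm_num)
  have hdu : ∀ θ, HasDerivAt (fun θ => u (-θ))
      (u (-θ) * (-1 * polyP lam (u (-θ)) - polyQ (u (-θ))) / (1 + u (-θ) ^ 4)) θ := fun θ => by
    refine (HasDerivAt.comp θ (H.deriv_u (-θ)) (hasDerivAt_neg θ)).congr_deriv ?_
    rw [hcos]; ring
  have hdρ : ∀ θ, HasDerivAt (fun θ => ρ (-θ)) (-(9 * u (-θ) ^ 4 / (1 + u (-θ) ^ 4))) θ := fun θ => by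
    refine (HasDerivAt.comp θ (H.deriv_ρ (-θ)) (hasDerivAt_neg θ)).congr_deriv ?_
    rw [hcos]; ring
  have hge : ∀ θ, 0 ≤ θ → 2 * a₀ ≤ u (-θ) := by
    refine le_of_deriv_pos_of_eq hdu (by simp [hu0]) fun θ _ e => ?_
    have h1 := hL.add_neg (u (-θ)) (by rw [e]; linarith)
    exact div_pos (mul_pos (H.u_pos _) (by linarith)) (by positivity)
  obtain ⟨tc', htc', hlim⟩ := tendsto_center (σ := -1) (κ := 3 / 4) hlam (by simp) hdu hdρ
    (show 1 < 2 * a₀ by linarith [hL.one_lt]) (by norm_num) hge (fun θ hθ => by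
      have h1 := hge θ hθ
      have h2 := H.u_pos (-θ)
      have h3 := polyP_add_polyQ_mul_eq hL.eq_a₀ (u (-θ))
      have h4 : 1 ≤ u (-θ) ^ 4 := one_le_pow₀ (by linarith [hL.one_lt])
      refine le_of_mul_le_mul_right ?_ (show 0 < a₀ ^ 3 by positivity)
      have e1 : (-1 * polyP lam (u (-θ)) - polyQ (u (-θ))) * a₀ ^ 3 = (u (-θ) - a₀) *
          (2 * lam * (a₀ ^ 2 + a₀ * u (-θ) + u (-θ) ^ 2) + 3 * u (-θ) * a₀ * (a₀ + u (-θ)) +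
            3 * u (-θ) ^ 3 * a₀ ^ 3) := by linear_combination -h3
      rw [e1]
      have e2 : 0 ≤ 2 * lam * (a₀ ^ 2 + a₀ * u (-θ) + u (-θ) ^ 2) + 3 * u (-θ) * a₀ * (a₀ + u (-θ)) := by
        positivity
      have e3 : u (-θ) / 2 ≤ u (-θ) - a₀ := by linarith
      calc 3 / 4 * (1 + u (-θ) ^ 4) * a₀ ^ 3 ≤ 3 / 4 * (u (-θ) ^ 4 + u (-θ) ^ 4) * a₀ ^ 3 := by gcongr
        _ = u (-θ) / 2 * (0 + 3 * u (-θ) ^ 3 * a₀ ^ 3) := by ring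
        _ ≤ _ := by
          refine mul_le_mul e3 (by linarith) (by positivity) (by linarith))
  -- A rescaling moves the arrival time from `tc'` to the prescribed `tc`.
  refine ⟨u, α, fun θ => ρ θ + Real.log (tc / tc'), Λ, H.shift _, hsin, ?_, ?_⟩
  · obtain ⟨h1, a, ha, h2⟩ := hesc
    exact ⟨tendsto_atTop_add_const_right _ _ h1, a, ha, h2⟩
  · have h1 : Tendsto (fun θ => (Real.exp (ρ θ) * ((1 - u θ ^ 3) / lam), Real.exp (ρ θ))) atBot
        (𝓝 (tc', 0)) := by
      have := hlim.comp tendsto_neg_atBot_atTop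
      simpa [Function.comp_def] using this
    have hk : 0 < tc / tc' := div_pos_of_neg_of_neg htc htc'
    have h2 := h1.const_smul (tc / tc')
    have e : (tc / tc') • (tc', (0 : ℝ)) = (tc, 0) := by
      ext
      · simp [htc'.ne]
      · simp
    rw [e] at h2
    refine h2.congr fun θ => ?_
    ext
    · simp only [Prod.smul_fst, smul_eq_mul, Real.exp_add, Real.exp_log hk]; ring
    · simp only [Prod.smul_snd, smul_eq_mul, Real.exp_add, Real.exp_log hk]; ring

/-- Before the Cauchy horizon, radially outgoing rays come from the center. -/
theorem originates_of_outgoing (H : PastFlow lam u α ρ Λ) (hL : Landscape lam a₂ u₁ a₁ a₀)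
    (hu : a₁ < u 0) (hc : Real.cos (α 0) = -1) :
    OriginatesFromFarPast lam (Real.exp (ρ 0) * ((1 - u 0 ^ 3) / lam)) (Real.exp (ρ 0)) (α 0) := by
  have hlam := hL.lam_pos
  have hsin : Real.sin (α 0) = 0 := by
    have := Real.sin_sq_add_cos_sq (α 0)
    rw [hc] at this
    nlinarith
  have hcos : ∀ θ, Real.cos (α θ) = -1 := fun θ => by rw [H.cos_const hsin, hc]
  obtain ⟨a, ha1, ha⟩ := exists_between hL.one_lt
  obtain ⟨θ₁, -, h1⟩ := H.exists_ge_of_gt hL hu ha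
  have hge := H.ge_of_ge hL (hL.a₁_lt.trans ha1) ha h1
  have ha3 : 1 < a ^ 3 := one_lt_pow₀ ha1 (by norm_num)
  -- The constant κ comes from -Q = 3u⁴(1 - u⁻³), with u ≥ a > 1 and 1 + u⁴ ≤ 2u⁴; the positive term
  -- P is dropped.
  obtain ⟨tc, htc, hlim⟩ := tendsto_center (u := u) (ρ := ρ) (σ := 1) (a := a)
    (κ := 3 / 2 * (1 - 1 / a ^ 3)) hlam
    (by simp) (fun θ => (H.deriv_u θ).congr_deriv (by rw [hcos]; ring))
    (fun θ => (H.deriv_ρ θ).congr_deriv (by rw [hcos]; ring)) ha1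
    (mul_pos (by norm_num) (sub_pos.2 ((div_lt_one (by linarith)).2 ha3))) hge (fun θ hθ => by
      have h2 := hge θ hθ
      have h0 := H.u_pos θ
      have hp := polyP_pos hlam h0
      have h4 : 1 ≤ u θ ^ 4 := one_le_pow₀ (by linarith)
      have h3 : a ^ 3 ≤ u θ ^ 3 := by gcongr
      have h5 : 1 - 1 / a ^ 3 ≤ 1 - 1 / u θ ^ 3 := by gcongr
      have h6 : 0 < 1 - 1 / a ^ 3 := sub_pos.2 ((div_lt_one (by linarith)).2 ha3)
      have h7 := h6.trans_le h5
      calc 3 / 2 * (1 - 1 / a ^ 3) * (1 + u θ ^ 4) ≤ 3 / 2 * (1 - 1 / u θ ^ 3) * (u θ ^ 4 + u θ ^ 4) := by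
            gcongr
        _ = - polyQ (u θ) := by unfold polyQ; field_simp; ring
        _ ≤ _ := by linarith)
  -- The continuation beyond the center is an ingoing radial ray with the same arrival time. Radial
  -- rays have constant φ, taken as 0 on one side and π on the other.
  obtain ⟨u', α', ρ', Λ', H', hsin', hesc', hlim'⟩ := exists_ingoing hL htc
  obtain ⟨s, T, φ, hs, hT, hφ, hreg⟩ := H.exists_registered hlam
  obtain ⟨s', T', φ', hs0', hs', hT', hφ', hgeo'⟩ := H'.exists_geodesic hlam Real.pi
  refine ⟨_, _, _, _, _, _, _, hreg, Or.inr ⟨tc, htc, hlim.comp (tendsto_reparam_atBot hs hT),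
    _, _, _, _, _, _, _, hgeo', hlim'.comp (tendsto_reparam_atTop hs' hT'), ?_,
    H'.comesFromInfinity hlam hesc' hs' hT'⟩⟩
  intro τ hτ τ' hτ'
  rw [hφ hsin τ hτ, hφ' hsin' τ' hτ', zero_add]

end PastFlow

/-! ### The dichotomy at a given event. -/

section Events

variable {lam a₂ u₁ a₁ a₀ t R α v : ℝ}

theorem emanates_of_lt (hL : Landscape lam a₂ u₁ a₁ a₀) (hR : 0 < R) (hv : 0 < v)
    (ht : t / R = (1 - v ^ 3) / lam) (hva : v ≤ a₁) (hα : Real.cos α < critCos lam u₁ v) :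
    EmanatesFromSingularity lam t R α := by
  obtain ⟨u, α', ρ, Λ, H, rfl, rfl, hρ, -⟩ := exists_pastFlow hL.lam_pos hv α (Real.log R) 0
  have := H.emanates hL.lam_pos (H.collapses_of_lt_critCos hL hva hα)
  rwa [hρ, Real.exp_log hR, ← ht, mul_div_cancel₀ _ hR.ne'] at this

theorem originates_of_gt (hL : Landscape lam a₂ u₁ a₁ a₀) (hR : 0 < R) (hv : 0 < v)
    (ht : t / R = (1 - v ^ 3) / lam) (h : a₁ < v ∨ critCos lam u₁ v < Real.cos α) :
    OriginatesFromFarPast lam t R α := by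
  obtain ⟨u, α', ρ, Λ, H, rfl, rfl, hρ, -⟩ := exists_pastFlow hL.lam_pos hv α (Real.log R) 0
  suffices hs : OriginatesFromFarPast lam (Real.exp (ρ 0) * ((1 - u 0 ^ 3) / lam)) (Real.exp (ρ 0))
      (α' 0) by
    rwa [hρ, Real.exp_log hR, ← ht, mul_div_cancel₀ _ hR.ne'] at hs
  rcases lt_or_ge a₁ (u 0) with h1 | h1
  · rcases (Real.neg_one_le_cos (α' 0)).eq_or_lt with h2 | h2
    · exact H.originates_of_outgoing hL h1 h2.symm
    · exact H.originates hL.lam_pos (H.escapes_of_gt hL h1 h2)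
  · exact H.originates hL.lam_pos (H.escapes_of_critCos_lt hL h1 (h.resolve_left (not_lt.2 h1)))

end Events

/-! ### Comparing the past ends of two curves. -/

section PastEnds

variable {X : Type*} {I J : Set ℝ} {c d : ℝ → X} {l l₁ l₂ : Filter X}

theorem tendsto_pastEnd_iff (hI : I.Nonempty) :
    Tendsto (fun s : I => c s) atBot l ↔ ∀ U ∈ l, ∃ s₀ ∈ I, ∀ s ∈ I, s ≤ s₀ → c s ∈ U := by
  have : Nonempty I := hI.to_subtype
  refine forall₂_congr fun U _ => ?_
  rw [mem_map, mem_atBot_sets]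
  simp

theorem tendsto_pastEnd_scale (hI : I.Nonempty) {k : ℝ} (hk : 0 < k)
    (h : Tendsto (fun s : I => c s) atBot l) :
    Tendsto (fun s : {s | k * s ∈ I} => c (k * s)) atBot l := by
  have hne : {s | k * s ∈ I}.Nonempty := by
    obtain ⟨s, hs⟩ := hI
    exact ⟨s / k, by rwa [mem_ofPred_eq, mul_div_cancel₀ _ hk.ne']⟩
  refine (tendsto_pastEnd_iff (c := fun s => c (k * s)) hne).2 fun U hU => ?_
  obtain ⟨s₀, h0, h1⟩ := (tendsto_pastEnd_iff hI).1 h U hU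
  refine ⟨s₀ / k, by rwa [mem_ofPred_eq, mul_div_cancel₀ _ hk.ne'], fun s hs hle => h1 _ hs ?_⟩
  rwa [le_div_iff₀ hk, mul_comm] at hle

theorem not_disjoint_of_tendsto (hI : I.Nonempty) {s₀ : ℝ} (h0 : s₀ ∈ I)
    (h₁ : Tendsto (fun s : I => c s) atBot l₁) (h₂ : Tendsto (fun s : I => d s) atBot l₂)
    (he : ∀ s ∈ I, s ≤ s₀ → c s = d s) : ¬ Disjoint l₁ l₂ := by
  intro hd
  obtain ⟨U, hU, V, hV, hUV⟩ := Filter.disjoint_iff.1 hd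
  obtain ⟨a, ha, ha'⟩ := (tendsto_pastEnd_iff hI).1 h₁ U hU
  obtain ⟨b, hb, hb'⟩ := (tendsto_pastEnd_iff hI).1 h₂ V hV
  have hm : min s₀ (min a b) ∈ I := by
    rcases min_choice s₀ (min a b) with h | h <;> rw [h]
    · exact h0
    · rcases min_choice a b with h | h <;> rw [h] <;> assumption
  refine disjoint_left.1 hUV (ha' _ hm (by simp)) ?_
  rw [he _ hm (by simp)]
  exact hb' _ hm (by simp)

/-- A curve which extends beyond the past end of another one with the same values has no
past end incompatible with its own points. -/
theorem exists_not_disjoint_of_extends [TopologicalSpace X] (hI : I.OrdConnected)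
    (hI0 : (0 : ℝ) ∈ I) (hJ0 : (0 : ℝ) ∈ J) (hc : ∀ s ∈ I, ContinuousAt c s) (he : EqOn c d (I ∩ J))
    (h₂ : Tendsto (fun s : J => d s) atBot l₂) {m : ℝ} (hm : m ∈ I) (hmJ : ∀ s ∈ J, m < s) :
    ∃ p ∈ I, ¬ Disjoint (𝓝 (c p)) l₂ := by
  have hbdd : BddBelow J := ⟨m, fun s hs => (hmJ s hs).le⟩
  have hne : J.Nonempty := ⟨0, hJ0⟩
  have h0 : sInf J ≤ 0 := csInf_le hbdd hJ0
  have hp : sInf J ∈ I := hI.out hm hI0 ⟨le_csInf hne fun s hs => (hmJ s hs).le, h0⟩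
  refine ⟨sInf J, hp, not_disjoint_of_tendsto (c := c) hne hJ0 ?_ h₂ fun s hs hs0 =>
    he ⟨hI.out hp hI0 ⟨csInf_le hbdd hs, hs0⟩, hs⟩⟩
  refine (tendsto_pastEnd_iff hne).2 fun U hU => ?_
  obtain ⟨ε, hε, hεU⟩ := Metric.mem_nhds_iff.1 (hc _ hp hU)
  obtain ⟨s₀, hs₀, hlt⟩ := (csInf_lt_iff hbdd hne).1 (lt_add_of_pos_right (sInf J) hε)
  refine ⟨s₀, hs₀, fun s hs hle => hεU ?_⟩
  rw [Metric.mem_ball, Real.dist_eq, abs_of_nonneg (sub_nonneg.2 (csInf_le hbdd hs))]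
  linarith

/-- If one interval reaches below all of the other, the past end of the shorter curve is a point of
the longer one, against `hd₁` or `hd₂`. Otherwise the curves agree towards the past, and one curve
would converge along two disjoint filters. -/
theorem false_of_disjoint_pastEnds [TopologicalSpace X] (hI : I.OrdConnected)
    (hJ : J.OrdConnected) (hI0 : (0 : ℝ) ∈ I) (hJ0 : (0 : ℝ) ∈ J)
    (hc : ∀ s ∈ I, ContinuousAt c s) (hd : ∀ s ∈ J, ContinuousAt d s) (he : EqOn c d (I ∩ J))
    (h₁ : Tendsto (fun s : I => c s) atBot l₁) (h₂ : Tendsto (fun s : J => d s) atBot l₂)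
    (h₁₂ : Disjoint l₁ l₂) (hd₁ : ∀ s ∈ J, Disjoint (𝓝 (d s)) l₁)
    (hd₂ : ∀ s ∈ I, Disjoint (𝓝 (c s)) l₂) : False := by
  by_cases hIJ : ∃ m ∈ I, ∀ s ∈ J, m < s
  · obtain ⟨m, hm, hmJ⟩ := hIJ
    obtain ⟨p, hp, h⟩ := exists_not_disjoint_of_extends hI hI0 hJ0 hc he h₂ hm hmJ
    exact h (hd₂ p hp)
  by_cases hJI : ∃ m ∈ J, ∀ s ∈ I, m < s
  · obtain ⟨m, hm, hmI⟩ := hJI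
    obtain ⟨p, hp, h⟩ := exists_not_disjoint_of_extends hJ hJ0 hI0 hd
      (fun s hs => (he ⟨hs.2, hs.1⟩).symm) h₁ hm hmI
    exact h (hd₁ p hp)
  push Not at hIJ hJI
  have hmem : ∀ s ∈ I, s ≤ 0 → s ∈ J := fun s hs hs0 => by
    obtain ⟨r, hr, hrs⟩ := hIJ s hs
    exact hJ.out hr hJ0 ⟨hrs, hs0⟩
  refine not_disjoint_of_tendsto (d := d) ⟨0, hI0⟩ hI0 h₁ ?_
    (fun s hs hs0 => he ⟨hs, hmem s hs hs0⟩) h₁₂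
  refine (tendsto_pastEnd_iff ⟨0, hI0⟩).2 fun U hU => ?_
  obtain ⟨s₀, h0, h1⟩ := (tendsto_pastEnd_iff ⟨0, hJ0⟩).1 h₂ U hU
  obtain ⟨s₁, hs₁, hle⟩ := hJI _ h0
  rcases le_total s₁ 0 with h | h
  · exact ⟨s₁, hs₁, fun s hs hs' => h1 s (hmem s hs (hs'.trans h)) (hs'.trans hle)⟩
  · exact ⟨0, hI0, fun s hs hs' => h1 s (hmem s hs hs') (hs'.trans (h.trans hle))⟩

end PastEnds

/-! ### Uniqueness of geodesics and exclusivity of the two pasts. -/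

section GeodesicFlow

variable {lam : ℝ}

theorem one_sub_mul_pos (hlam : 0 < lam) {x : ℝ} (hx : x < 1 / lam) : 0 < 1 - lam * x := by
  rw [lt_div_iff₀ hlam] at hx; linarith

theorem contDiffAt_F (hlam : 0 < lam) {n : WithTop ℕ∞} {x : ℝ} (hx : x < 1 / lam) :
    ContDiffAt ℝ n (F lam) x := by
  have h := one_sub_mul_pos hlam hx
  have h1 : ContDiffAt ℝ n (fun x : ℝ => (1 - lam * x) ^ (1 / 3 : ℝ)) x :=
    ContDiffAt.rpow_const_of_ne (by fun_prop) h.ne'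
  exact ContDiffAt.div (by fun_prop) h1 (by positivity)

theorem contDiffAt_S (hlam : 0 < lam) {n : WithTop ℕ∞} {x : ℝ} (hx : x < 1 / lam) :
    ContDiffAt ℝ n (S lam) x :=
  ContDiffAt.rpow_const_of_ne (by fun_prop) (one_sub_mul_pos hlam hx).ne'

theorem ContDiffAt.deriv_one {f : ℝ → ℝ} {x : ℝ} (hf : ContDiffAt ℝ 2 f x) :
    ContDiffAt ℝ 1 (deriv f) x := by
  have h : ContDiffAt ℝ 1 (fun y => fderiv ℝ f y 1) x :=
    (hf.fderiv_right (m := 1) (by norm_num)).clm_apply contDiffAt_const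
  exact h

theorem F_pos (hlam : 0 < lam) {x : ℝ} (hx : x < 1 / lam) : 0 < F lam x := by
  obtain ⟨u, hu, rfl⟩ := exists_coord hlam hx
  rw [F_eq hlam.ne' hu]; positivity

theorem S_pos (hlam : 0 < lam) {x : ℝ} (hx : x < 1 / lam) : 0 < S lam x :=
  Real.rpow_pos_of_pos (one_sub_mul_pos hlam hx) _

/-- The vector field of the equations for `(t, R, pt, pR)`. -/
noncomputable def geodesicField (lam ell : ℝ) (z : ℝ × ℝ × ℝ × ℝ) : ℝ × ℝ × ℝ × ℝ :=
  (z.2.2.1, z.2.2.2 / F lam (z.1 / z.2.1) ^ 2,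
    -(deriv (F lam) (z.1 / z.2.1) * (1 / z.2.1) / F lam (z.1 / z.2.1) ^ 3 * z.2.2.2 ^ 2) -
      ell ^ 2 / (z.2.1 * S lam (z.1 / z.2.1)) ^ 3 * (z.2.1 * (deriv (S lam) (z.1 / z.2.1) * (1 / z.2.1))),
    deriv (F lam) (z.1 / z.2.1) * -(z.1 / z.2.1 ^ 2) / F lam (z.1 / z.2.1) ^ 3 * z.2.2.2 ^ 2 +
      ell ^ 2 / (z.2.1 * S lam (z.1 / z.2.1)) ^ 3 *
        (1 * S lam (z.1 / z.2.1) + z.2.1 * (deriv (S lam) (z.1 / z.2.1) * -(z.1 / z.2.1 ^ 2))))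

theorem contDiffAt_geodesicField (hlam : 0 < lam) (ell : ℝ) {z : ℝ × ℝ × ℝ × ℝ} (hR : 0 < z.2.1)
    (hx : z.1 / z.2.1 < 1 / lam) : ContDiffAt ℝ 1 (geodesicField lam ell) z := by
  have hR' := hR.ne'
  have hF' := (F_pos hlam hx).ne'
  have hS' := (S_pos hlam hx).ne'
  have hr : ContDiffAt ℝ 1 (fun z : ℝ × ℝ × ℝ × ℝ => z.1 / z.2.1) z :=
    ContDiffAt.div (by fun_prop) (by fun_prop) hR'
  have hF : ContDiffAt ℝ 1 (fun z : ℝ × ℝ × ℝ × ℝ => F lam (z.1 / z.2.1)) z :=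
    ContDiffAt.comp z (contDiffAt_F hlam hx) hr
  have hS : ContDiffAt ℝ 1 (fun z : ℝ × ℝ × ℝ × ℝ => S lam (z.1 / z.2.1)) z :=
    ContDiffAt.comp z (contDiffAt_S hlam hx) hr
  have hdF : ContDiffAt ℝ 1 (fun z : ℝ × ℝ × ℝ × ℝ => deriv (F lam) (z.1 / z.2.1)) z :=
    ContDiffAt.comp z (ContDiffAt.deriv_one (contDiffAt_F hlam hx)) hr
  have hdS : ContDiffAt ℝ 1 (fun z : ℝ × ℝ × ℝ × ℝ => deriv (S lam) (z.1 / z.2.1)) z :=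
    ContDiffAt.comp z (ContDiffAt.deriv_one (contDiffAt_S hlam hx)) hr
  have hi : ContDiffAt ℝ 1 (fun z : ℝ × ℝ × ℝ × ℝ => 1 / z.2.1) z :=
    ContDiffAt.div (by fun_prop) (by fun_prop) hR'
  have hi2 : ContDiffAt ℝ 1 (fun z : ℝ × ℝ × ℝ × ℝ => -(z.1 / z.2.1 ^ 2)) z :=
    (contDiffAt_fst.div ((contDiffAt_fst.comp z contDiffAt_snd).pow 2) (pow_ne_zero 2 hR')).neg
  have hR1 : ContDiffAt ℝ 1 (fun z : ℝ × ℝ × ℝ × ℝ => z.2.1) z := by fun_prop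
  have hp : ContDiffAt ℝ 1 (fun z : ℝ × ℝ × ℝ × ℝ => z.2.2.2) z := by fun_prop
  have hl : ContDiffAt ℝ 1 (fun z : ℝ × ℝ × ℝ × ℝ =>
      ell ^ 2 / (z.2.1 * S lam (z.1 / z.2.1)) ^ 3) z :=
    contDiffAt_const.div ((hR1.mul hS).pow 3) (pow_ne_zero 3 (mul_ne_zero hR' hS'))
  refine ContDiffAt.prodMk (by fun_prop) (ContDiffAt.prodMk ?_ (ContDiffAt.prodMk ?_ ?_))
  · exact hp.div (hF.pow 2) (pow_ne_zero 2 hF')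
  · exact ((((hdF.mul hi).div (hF.pow 3) (pow_ne_zero 3 hF')).mul (hp.pow 2)).neg).sub
      (hl.mul (hR1.mul (hdS.mul hi)))
  · exact (((hdF.mul hi2).div (hF.pow 3) (pow_ne_zero 3 hF')).mul (hp.pow 2)).add
      (hl.mul ((contDiffAt_const.mul hS).add (hR1.mul (hdS.mul hi2))))

variable {I : Set ℝ} {t R φ pt pR : ℝ → ℝ} {ell : ℝ}

theorem IsNullGeodesic.hasDerivAt_state (hlam : 0 < lam) (h : IsNullGeodesic lam I t R φ pt pR ell)
    {s : ℝ} (hs : s ∈ I) : HasDerivAt (fun s => (t s, R s, pt s, pR s))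
      (geodesicField lam ell (t s, R s, pt s, pR s)) s := by
  have hR := h.R_pos s hs
  have hx := h.x_lt s hs
  have hF := ((contDiffAt_F (n := 1) hlam hx).differentiableAt (by norm_num)).hasDerivAt
  have hS := ((contDiffAt_S (n := 1) hlam hx).differentiableAt (by norm_num)).hasDerivAt
  have hS' : HasDerivAt (fun τ => S lam (τ / R s)) (deriv (S lam) (t s / R s) * (1 / R s)) (t s) :=
    HasDerivAt.comp (h₂ := S lam) (t s) hS (hasDerivAt_ratio_t (R s) (t s))
  have e1 : deriv (fun τ => expPsi lam τ (R s)) (t s) = deriv (F lam) (t s / R s) * (1 / R s) :=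
    (HasDerivAt.comp (t s) hF (hasDerivAt_ratio_t (R s) (t s))).deriv
  have e2 : deriv (fun τ => areal lam τ (R s)) (t s) =
      R s * (deriv (S lam) (t s / R s) * (1 / R s)) :=
    (hS'.const_mul (R s)).deriv
  have e3 : deriv (fun ρ => expPsi lam (t s) ρ) (R s) =
      deriv (F lam) (t s / R s) * -(t s / R s ^ 2) :=
    (HasDerivAt.comp (R s) hF (hasDerivAt_ratio_R hR (t s))).deriv
  have e4 : deriv (fun ρ => areal lam (t s) ρ) (R s) =
      1 * S lam (t s / R s) + R s * (deriv (S lam) (t s / R s) * -(t s / R s ^ 2)) :=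
    ((hasDerivAt_id (R s)).mul (HasDerivAt.comp (R s) hS (hasDerivAt_ratio_R hR (t s)))).deriv
  have h3 := h.deriv_pt s hs
  have h4 := h.deriv_pR s hs
  rw [e1, e2] at h3
  rw [e3, e4] at h4
  exact (h.deriv_t s hs).prodMk ((h.deriv_R s hs).prodMk (h3.prodMk h4))

/-- The geodesic equations are homogeneous: s ↦ ks multiplies the momenta and the angular momentum
by k. This absorbs the free factor A in the four-momentum. -/
theorem IsNullGeodesic.hasDerivAt_state_scale (hlam : 0 < lam)
    (h : IsNullGeodesic lam I t R φ pt pR ell) {k s : ℝ} (hs : k * s ∈ I) :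
    HasDerivAt (fun s => (t (k * s), R (k * s), k * pt (k * s), k * pR (k * s)))
      (geodesicField lam (k * ell) (t (k * s), R (k * s), k * pt (k * s), k * pR (k * s))) s := by
  have hk : HasDerivAt (fun s => k * s) k s := by simpa using (hasDerivAt_id s).const_mul k
  have hcomp : ∀ {f : ℝ → ℝ} {f' : ℝ}, HasDerivAt f f' (k * s) →
      HasDerivAt (fun s => f (k * s)) (f' * k) s := fun hf => HasDerivAt.comp s hf hk
  have h0 := h.hasDerivAt_state hlam hs
  have h3 : HasDerivAt pt (geodesicField lam ell (t (k * s), R (k * s), pt (k * s), pR (k * s))).2.2.1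
      (k * s) := by simpa using h0.hasFDerivAt.snd.snd.fst.hasDerivAt
  have h4 : HasDerivAt pR (geodesicField lam ell (t (k * s), R (k * s), pt (k * s), pR (k * s))).2.2.2
      (k * s) := by simpa using h0.hasFDerivAt.snd.snd.snd.hasDerivAt
  refine ((hcomp (h.deriv_t _ hs)).prodMk ((hcomp (h.deriv_R _ hs)).prodMk
    (((hcomp h3).const_mul k).prodMk ((hcomp h4).const_mul k)))).congr_deriv ?_
  simp only [geodesicField, expPsi]
  refine Prod.ext ?_ (Prod.ext ?_ (Prod.ext ?_ ?_)) <;> simp only <;> ring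

variable {t₀ R₀ α : ℝ}

/-- Two null geodesics with the same incidence angle at an event cover the same events, up to an
affine change of the parameter. -/
theorem IsRegistered.exists_scale (hlam : 0 < lam) {I' : Set ℝ} {t' R' φ' pt' pR' : ℝ → ℝ} {ell' : ℝ}
    (h : IsRegistered lam I t R φ pt pR ell t₀ R₀ α)
    (h' : IsRegistered lam I' t' R' φ' pt' pR' ell' t₀ R₀ α) :
    ∃ k, 0 < k ∧ EqOn (fun s => (t s, R s)) (fun s => (t' (k * s), R' (k * s)))
      (I ∩ {s | k * s ∈ I'}) := by
  obtain ⟨hg, hm, ht, hR, A, hA, hpt, hpR, hl⟩ := h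
  obtain ⟨hg', hm', ht', hR', A', hA', hpt', hpR', hl'⟩ := h'
  have hR0 : 0 < R₀ := hR ▸ hg.R_pos 0 hm
  have hx : t₀ / R₀ < 1 / lam := by have := hg.x_lt 0 hm; rwa [ht, hR] at this
  have hF : expPsi lam t₀ R₀ ≠ 0 := (F_pos hlam hx).ne'
  have hr : areal lam t₀ R₀ ≠ 0 := (mul_pos hR0 (S_pos hlam hx)).ne'
  rw [div_eq_iff hF] at hpR hpR'
  rw [div_eq_iff hr] at hl hl'
  have hA'' := hA'.ne'
  refine ⟨A / A', div_pos hA hA', ?_⟩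
  set k := A / A' with hk
  have hell : k * ell' = ell := by rw [hl, hl', hk]; field_simp
  have hcont : Continuous fun s : ℝ => k * s := by fun_prop
  have hord : {s | k * s ∈ I'}.OrdConnected := ⟨fun a ha b hb s hs => hg'.ordConnected.out ha hb
    ⟨mul_le_mul_of_nonneg_left hs.1 (div_pos hA hA').le,
      mul_le_mul_of_nonneg_left hs.2 (div_pos hA hA').le⟩⟩
  have key := eqOn_of_ode (v := geodesicField lam ell) (hg.ordConnected.inter hord)
    (hg.isOpen.inter (hg'.isOpen.preimage hcont))
    (f := fun s => (t s, R s, pt s, pR s))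
    (g := fun s => (t' (k * s), R' (k * s), k * pt' (k * s), k * pR' (k * s)))
    (fun s hs => contDiffAt_geodesicField hlam ell (hg.R_pos s hs.1) (hg.x_lt s hs.1))
    (fun s hs => hg.hasDerivAt_state hlam hs.1)
    (fun s hs => by have := hg'.hasDerivAt_state_scale hlam (k := k) hs.2; rwa [hell] at this)
    (s₀ := 0) ⟨hm, by simpa using hm'⟩ (by
      simp only [mul_zero, ht, ht', hR, hR', hpt, hpt', hpR, hpR', hk]
      refine Prod.ext rfl (Prod.ext rfl (Prod.ext ?_ ?_)) <;> field_simp)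
  intro s hs
  have := key hs
  simp only [Prod.mk.injEq] at this ⊢
  exact ⟨this.1, this.2.1⟩

theorem IsNullGeodesic.continuousAt (h : IsNullGeodesic lam I t R φ pt pR ell) {s : ℝ} (hs : s ∈ I) :
    ContinuousAt (fun s => (t s, R s)) s :=
  (h.deriv_t s hs).continuousAt.prodMk (h.deriv_R s hs).continuousAt

theorem disjoint_nhds_comap_fst_atBot (p : ℝ × ℝ) :
    Disjoint (𝓝 p) (comap Prod.fst (atBot : Filter ℝ)) :=
  (Filter.disjoint_comap (m := Prod.fst) (disjoint_nhds_atBot p.1)).mono_left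
    (continuous_fst.tendsto p).le_comap

/-- The two geodesics agree up to scale on their common interval. The point (0, 0), the end t → -∞
and a center point (t_c, 0) with t_c < 0 are compared: the first is separated from the other two,
and none of them is met by a curve in R > 0. The continuation through the center plays no role. -/
theorem not_originates_of_emanates (hlam : 0 < lam) (h : EmanatesFromSingularity lam t₀ R₀ α) :
    ¬ OriginatesFromFarPast lam t₀ R₀ α := by
  rintro ⟨I', t', R', φ', pt', pR', ell', hr', hpast⟩
  obtain ⟨I, t, R, φ, pt, pR, ell, hr, hlim⟩ := h
  obtain ⟨k, hk, he⟩ := hr.exists_scale hlam hr'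
  have hg := hr.geodesic
  have hg' := hr'.geodesic
  have hcont : Continuous fun s : ℝ => k * s := by fun_prop
  have hord : {s | k * s ∈ I'}.OrdConnected := ⟨fun a ha b hb s hs => hg'.ordConnected.out ha hb
    ⟨mul_le_mul_of_nonneg_left hs.1 hk.le, mul_le_mul_of_nonneg_left hs.2 hk.le⟩⟩
  have main : ∀ l₂ : Filter (ℝ × ℝ), Disjoint (𝓝 (0, 0)) l₂ →
      (∀ p : ℝ × ℝ, 0 < p.2 → Disjoint (𝓝 p) l₂) →
      Tendsto (fun s : I' => (t' s, R' s)) atBot l₂ → False := fun l₂ h0 h1 h2 =>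
    false_of_disjoint_pastEnds (c := fun s => (t s, R s)) (d := fun s => (t' (k * s), R' (k * s)))
      hg.ordConnected hord hr.mem (by simpa using hr'.mem)
      (fun s hs => hg.continuousAt hs)
      (fun s hs => ContinuousAt.comp (f := fun s => k * s) (x := s) (hg'.continuousAt hs)
        hcont.continuousAt) he hlim
      (tendsto_pastEnd_scale (c := fun s => (t' s, R' s)) hg'.nonempty hk h2) h0
      (fun s hs => disjoint_nhds_nhds.2 fun e => (hg'.R_pos _ hs).ne' (congrArg Prod.snd e))
      (fun s hs => h1 _ (hg.R_pos s hs))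
  rcases hpast with ⟨h1, -⟩ | ⟨tc, htc, h1, -⟩
  · exact main _ (disjoint_nhds_comap_fst_atBot _) (fun p _ => disjoint_nhds_comap_fst_atBot p)
      (tendsto_comap_iff.2 h1)
  · exact main _ (disjoint_nhds_nhds.2 fun e => htc.ne (congrArg Prod.fst e).symm)
      (fun p hp => disjoint_nhds_nhds.2 fun e => hp.ne' (congrArg Prod.snd e)) h1

end GeodesicFlow

/-! ### The explicit formula, continuity and the zeros of W. -/

/-- The self-similar coordinate `(1 - λ x)^(1/3)`. -/
noncomputable def coord (lam x : ℝ) : ℝ := (1 - lam * x) ^ (1 / 3 : ℝ)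

theorem coord_eq {lam u : ℝ} (hlam : lam ≠ 0) (hu : 0 < u) : coord lam ((1 - u ^ 3) / lam) = u := by
  rw [coord, one_sub_mul_div hlam, cube_rpow_third hu]

theorem continuous_coord (lam : ℝ) : Continuous (coord lam) :=
  Continuous.rpow_const (by fun_prop) fun _ => Or.inr (by norm_num)

theorem coord_pos {lam x : ℝ} (hlam : 0 < lam) (hx : x < 1 / lam) : 0 < coord lam x :=
  Real.rpow_pos_of_pos (one_sub_mul_pos hlam hx) _

theorem continuous_critRoot (lam u₁ : ℝ) : Continuous (critRoot lam u₁) := by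
  unfold critRoot critK polyP polyQ
  fun_prop

/-- The critical angle as a single continuous function. -/
noncomputable def critAngle (lam u₁ a₁ x : ℝ) : ℝ :=
  Real.arccos (critCos lam u₁ (min (coord lam x) a₁))

namespace Landscape

variable {lam a₂ u₁ a₁ a₀ : ℝ}

theorem sq_add_critK_pos (H : Landscape lam a₂ u₁ a₁ a₀) {u : ℝ} (hu : 0 < u) :
    0 < polyP lam u ^ 2 + critK lam u₁ u := by
  have := H.critK_pos hu
  positivity

theorem continuousAt_critCos (H : Landscape lam a₂ u₁ a₁ a₀) {u : ℝ} (hu : 0 < u) :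
    ContinuousAt (critCos lam u₁) u := by
  -- The sign jumps only at `u₁`, where the root vanishes.
  have h1 : Continuous fun u : ℝ => (if u₁ ≤ u then -1 else 1 : ℝ) * critRoot lam u₁ u := by
    have h2 : Continuous fun u : ℝ => if u₁ ≤ u then -critRoot lam u₁ u else critRoot lam u₁ u :=
      Continuous.if_le (continuous_critRoot lam u₁).neg (continuous_critRoot lam u₁) continuous_const
        continuous_id fun u (hu : u₁ = u) => by rw [← hu, H.critRoot_u₁, neg_zero]
    refine h2.congr fun u => ?_
    split_ifs <;> ring
  have h3 : ContinuousAt (fun u => (-(polyP lam u * polyQ u) +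
      (if u₁ ≤ u then -1 else 1 : ℝ) * critRoot lam u₁ u) / (polyP lam u ^ 2 + critK lam u₁ u)) u :=
    ContinuousAt.div (ContinuousAt.add (by unfold polyP polyQ; fun_prop) h1.continuousAt)
      (by unfold polyP critK; fun_prop) (H.sq_add_critK_pos hu).ne'
  refine h3.congr (Eventually.of_forall fun v => ?_)
  simp only [critCos, critRoot, critK]
  rcases lt_or_ge v u₁ with h | h
  · rw [if_neg (not_le.2 h), if_pos h]
  · rw [if_pos h, if_neg (not_lt.2 h)]

/-- This is `critDiscr_eq` at c = -1, where the left side is a multiple of (Q - P)². -/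
theorem critRoot_le (H : Landscape lam a₂ u₁ a₁ a₀) {u : ℝ} (hu : 0 < u) (h1 : u ≤ 1) :
    critRoot lam u₁ u ≤ polyP lam u ^ 2 + critK lam u₁ u - polyP lam u * polyQ u := by
  have hG := H.critG_nonneg hu h1
  have hk := H.critK_pos hu
  refine le_of_sq_le_sq ?_ (by nlinarith [sq_nonneg (polyP lam u - polyQ u)])
  rw [H.critRoot_sq hu h1]
  have h := critDiscr_eq (polyP lam u) (polyQ u) (critK lam u₁ u) (-1)
  have : 0 ≤ (polyP lam u ^ 2 + critK lam u₁ u) * (polyQ u - polyP lam u) ^ 2 :=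
    mul_nonneg (by positivity) (sq_nonneg _)
  nlinarith

theorem critCos_mem (H : Landscape lam a₂ u₁ a₁ a₀) {u : ℝ} (hu : 0 < u) (h1 : u ≤ 1) :
    critCos lam u₁ u ∈ Icc (-1) 1 := by
  have hR : 0 ≤ critRoot lam u₁ u := Real.sqrt_nonneg _
  have hle := H.critRoot_le hu h1
  have hk := H.sq_add_critK_pos hu
  have hp := polyP_pos H.lam_pos hu
  have hq : 0 ≤ polyQ u := mul_nonneg (by linarith) (sub_nonneg.2 (pow_le_one₀ hu.le h1))
  have hpq := mul_nonneg hp.le hq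
  have h := H.mul_critCos hu
  rw [mem_Icc, ← abs_le, ← mul_le_mul_iff_right₀ hk, ← abs_of_pos hk, ← abs_mul, abs_of_pos hk, mul_one, abs_le]
  split_ifs at h <;> constructor <;> linarith

theorem mul_critCos_of_le (H : Landscape lam a₂ u₁ a₁ a₀) {u : ℝ} (hu : 0 < u) (h1 : u ≤ u₁) :
    (polyP lam u ^ 2 + critK lam u₁ u) * critCos lam u₁ u + polyP lam u * polyQ u =
      critRoot lam u₁ u := by
  rw [H.mul_critCos hu]
  rcases h1.eq_or_lt with rfl | h
  · rw [H.critRoot_u₁, mul_zero]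
  · rw [if_pos h, one_mul]

theorem W_top (H : Landscape lam a₂ u₁ a₁ a₀) : W lam ((1 - u₁ ^ 3) / lam) = pot lam u₁ :=
  W_eq H.lam_pos.ne' H.u₁_pos

theorem betaC_sq (H : Landscape lam a₂ u₁ a₁ a₀) :
    betaC lam ((1 - u₁ ^ 3) / lam) ^ 2 = 1 / pot lam u₁ := by
  rw [betaC, H.W_top, div_pow, Real.sq_sqrt H.pot_u₁_pos.le, one_pow]

theorem Q_sq (H : Landscape lam a₂ u₁ a₁ a₀) {u : ℝ} (hu : 0 < u) (h1 : u ≤ 1) :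
    critK lam u₁ u * Q lam (betaC lam ((1 - u₁ ^ 3) / lam)) ((1 - u ^ 3) / lam) ^ 2 =
      polyP lam u ^ 2 - polyQ u ^ 2 + critK lam u₁ u := by
  have hw := H.pot_u₁_pos
  rw [Q, H.betaC_sq, W_eq H.lam_pos.ne' hu, Real.sq_sqrt, H.critG_eq hu, critK]
  · field_simp
  · rw [sub_nonneg, one_div_mul_eq_div, div_le_one hw]
    exact H.pot_le hu h1

theorem critRoot_eq (H : Landscape lam a₂ u₁ a₁ a₀) {u : ℝ} (hu : 0 < u) (h1 : u ≤ 1) :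
    critRoot lam u₁ u =
      critK lam u₁ u * Q lam (betaC lam ((1 - u₁ ^ 3) / lam)) ((1 - u ^ 3) / lam) := by
  have hk := H.critK_pos hu
  have hQ : 0 ≤ Q lam (betaC lam ((1 - u₁ ^ 3) / lam)) ((1 - u ^ 3) / lam) := Real.sqrt_nonneg _
  have hR : 0 ≤ critRoot lam u₁ u := Real.sqrt_nonneg _
  rw [← sq_eq_sq₀ hR (by positivity), H.critRoot_sq hu h1, ← H.Q_sq hu h1]
  ring

theorem cosUpper_eq (H : Landscape lam a₂ u₁ a₁ a₀) {u : ℝ} (h1 : u₁ ≤ u) (h2 : u ≤ a₁) :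
    cosUpper lam ((1 - u₁ ^ 3) / lam) ((1 - u ^ 3) / lam) = critCos lam u₁ u := by
  have hu : 0 < u := H.u₁_pos.trans_le h1
  have hu1 : u < 1 := h2.trans_lt H.a₁_lt
  have hl := H.lam_pos
  have hq := polyQ_pos hu hu1
  have hp := polyP_pos hl hu
  have hk := H.sq_add_critK_pos hu
  have hQ0 : 0 ≤ Q lam (betaC lam ((1 - u₁ ^ 3) / lam)) ((1 - u ^ 3) / lam) := Real.sqrt_nonneg _
  have h := H.mul_critCos hu
  have hQ := H.Q_sq hu hu1.le
  rw [if_neg (not_lt.2 h1), H.critRoot_eq hu hu1.le] at h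
  unfold cosUpper
  set Y := Q lam (betaC lam ((1 - u₁ ^ 3) / lam)) ((1 - u ^ 3) / lam)
  have hx : (1 - u ^ 3) / lam = polyQ u / (3 * lam * u) := by unfold polyQ; field_simp
  have hF : F lam ((1 - u ^ 3) / lam) = polyP lam u / (3 * lam * u) := by
    rw [F_eq hl.ne' hu]; unfold polyP; field_simp
  rw [hF, hx]
  have hden : polyQ u + polyP lam u * Y ≠ 0 := by positivity
  have e : (polyP lam u / (3 * lam * u) + polyQ u / (3 * lam * u) * Y) /
      (polyQ u / (3 * lam * u) + polyP lam u / (3 * lam * u) * Y) =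
      (polyP lam u + polyQ u * Y) / (polyQ u + polyP lam u * Y) := by
    rw [← mul_div_mul_left _ _ (show 3 * lam * u ≠ 0 by positivity)]
    congr 1 <;> field_simp
  rw [e, ← neg_div, div_eq_iff hden]
  apply mul_left_cancel₀ hk.ne'
  linear_combination (-(polyQ u + polyP lam u * Y)) * h + polyP lam u * hQ

theorem cosLower_eq (H : Landscape lam a₂ u₁ a₁ a₀) {u : ℝ} (hu : 0 < u) (h1 : u ≤ u₁) (h2 : u ≠ a₂) :
    cosLower lam ((1 - u₁ ^ 3) / lam) ((1 - u ^ 3) / lam) = critCos lam u₁ u := by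
  have ha : u < a₁ := h1.trans_lt H.u₁_lt
  have hu1 : u < 1 := ha.trans H.a₁_lt
  have hl := H.lam_pos
  have hq := polyQ_pos hu hu1
  have hp := polyP_pos hl hu
  have hk := H.sq_add_critK_pos hu
  have h := H.mul_critCos_of_le hu h1
  have hQ := H.Q_sq hu hu1.le
  rw [H.critRoot_eq hu hu1.le] at h
  unfold cosLower
  set Y := Q lam (betaC lam ((1 - u₁ ^ 3) / lam)) ((1 - u ^ 3) / lam)
  have hx : (1 - u ^ 3) / lam = polyQ u / (3 * lam * u) := by unfold polyQ; field_simp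
  have hF : F lam ((1 - u ^ 3) / lam) = polyP lam u / (3 * lam * u) := by
    rw [F_eq hl.ne' hu]; unfold polyP; field_simp
  rw [hF, hx]
  -- A vanishing denominator would force P = Q, which on (0, `u₁`] happens only at `a₂`.
  have hden : polyQ u - polyP lam u * Y ≠ 0 := by
    intro h0
    have h3 : (polyP lam u - polyQ u) *
        ((polyP lam u + polyQ u) * (polyP lam u ^ 2 + critK lam u₁ u)) = 0 := by
      linear_combination (-polyP lam u ^ 2) * hQ -
        critK lam u₁ u * (polyQ u + polyP lam u * Y) * h0
    have h4 : polyP lam u - polyQ u = 0 :=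
      (mul_eq_zero.1 h3).resolve_right (by positivity)
    rcases h2.lt_or_gt with h5 | h5
    · linarith [H.gt_of_lt u hu h5]
    · linarith [H.lt_of_mem u h5 ha]
  have e : (polyP lam u / (3 * lam * u) - polyQ u / (3 * lam * u) * Y) /
      (polyQ u / (3 * lam * u) - polyP lam u / (3 * lam * u) * Y) =
      (polyP lam u - polyQ u * Y) / (polyQ u - polyP lam u * Y) := by
    rw [← mul_div_mul_left _ _ (show 3 * lam * u ≠ 0 by positivity)]
    congr 1 <;> field_simp
  rw [e, ← neg_div, div_eq_iff hden]
  apply mul_left_cancel₀ hk.ne'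
  linear_combination (-(polyQ u - polyP lam u * Y)) * h + polyP lam u * hQ

/-- At `a₂`, P = Q and the root equals `critK`, so `critCos` is (K - P²)/(K + P²) with K = `critK`.
It is continuous there, although the quotient in `cosLower` is 0/0. -/
theorem cosLimit_eq (H : Landscape lam a₂ u₁ a₁ a₀) :
    cosLimit lam ((1 - u₁ ^ 3) / lam) ((1 - a₂ ^ 3) / lam) = critCos lam u₁ a₂ := by
  have ha := H.a₂_pos
  have hl := H.lam_pos
  have hk := H.critK_pos ha
  have hk2 := H.sq_add_critK_pos ha
  have hw := H.pot_u₁_pos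
  have h := H.mul_critCos_of_le ha H.a₂_lt.le
  rw [critRoot, ← H.eq_a₂, sub_self, zero_add, Real.sqrt_mul_self hk.le] at h
  have e : betaC lam ((1 - u₁ ^ 3) / lam) ^ 2 * (((1 - a₂ ^ 3) / lam) ^ 2 / S lam ((1 - a₂ ^ 3) / lam) ^ 2) =
      polyP lam a₂ ^ 2 / critK lam u₁ a₂ := by
    rw [H.betaC_sq, S_eq hl.ne' ha, H.eq_a₂, polyQ, critK]
    field_simp
    ring
  rw [cosLimit, e]
  have h2 : critCos lam u₁ a₂ =
      (critK lam u₁ a₂ - polyP lam a₂ ^ 2) / (polyP lam a₂ ^ 2 + critK lam u₁ a₂) := by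
    rw [eq_div_iff hk2.ne']; linarith
  rw [h2]
  field_simp
  ring

theorem critAngle_eq (H : Landscape lam a₂ u₁ a₁ a₀) {u : ℝ} (hu : 0 < u) :
    critAngle lam u₁ a₁ ((1 - u ^ 3) / lam) = Real.arccos (critCos lam u₁ (min u a₁)) := by
  rw [critAngle, coord_eq H.lam_pos.ne' hu]

theorem critAngle_of_ge (H : Landscape lam a₂ u₁ a₁ a₀) {u : ℝ} (hu : a₁ ≤ u) :
    critAngle lam u₁ a₁ ((1 - u ^ 3) / lam) = Real.pi := by
  rw [H.critAngle_eq (H.a₁_pos.trans_le hu), min_eq_right hu, H.critCos_a₁, Real.arccos_neg_one]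

theorem continuousAt_critAngle (H : Landscape lam a₂ u₁ a₁ a₀) {x : ℝ} (hx : x < 1 / lam) :
    ContinuousAt (critAngle lam u₁ a₁) x := by
  have h1 : ContinuousAt (fun x => min (coord lam x) a₁) x :=
    ((continuous_coord lam).min continuous_const).continuousAt
  have h2 := H.continuousAt_critCos (lt_min (coord_pos H.lam_pos hx) H.a₁_pos)
  exact Real.continuous_arccos.continuousAt.comp
    (ContinuousAt.comp (f := fun x => min (coord lam x) a₁) h2 h1)

theorem alphaHat_eq (H : Landscape lam a₂ u₁ a₁ a₀) {x : ℝ} (hx : x < 1 / lam)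
    (hne : x ≠ (1 - a₂ ^ 3) / lam) :
    alphaHat lam ((1 - a₁ ^ 3) / lam) ((1 - u₁ ^ 3) / lam) x = critAngle lam u₁ a₁ x := by
  obtain ⟨u, hu, rfl⟩ := exists_coord H.lam_pos hx
  unfold alphaHat
  simp only [coord_lt_iff H.lam_pos hu H.a₁_pos, coord_lt_iff H.lam_pos hu H.u₁_pos]
  split_ifs with h1 h2
  · exact (H.critAngle_of_ge h1.le).symm
  · rw [H.cosUpper_eq h2.le (not_lt.1 h1), H.critAngle_eq hu, min_eq_left (not_lt.1 h1)]
  · rw [H.cosLower_eq hu (not_lt.1 h2) (fun h => hne (by rw [h])), H.critAngle_eq hu,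
      min_eq_left (not_lt.1 h1)]

theorem critAngle_a₂ (H : Landscape lam a₂ u₁ a₁ a₀) :
    critAngle lam u₁ a₁ ((1 - a₂ ^ 3) / lam) =
      Real.arccos (cosLimit lam ((1 - u₁ ^ 3) / lam) ((1 - a₂ ^ 3) / lam)) := by
  rw [H.critAngle_eq H.a₂_pos, min_eq_left (H.a₂_lt.trans H.u₁_lt).le, H.cosLimit_eq]

theorem tendsto_cosLower (H : Landscape lam a₂ u₁ a₁ a₀) :
    Tendsto (cosLower lam ((1 - u₁ ^ 3) / lam)) (𝓝[≠] ((1 - a₂ ^ 3) / lam))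
      (𝓝 (cosLimit lam ((1 - u₁ ^ 3) / lam) ((1 - a₂ ^ 3) / lam))) := by
  have hl := H.lam_pos
  have h1 : ContinuousAt (fun x => critCos lam u₁ (coord lam x)) ((1 - a₂ ^ 3) / lam) := by
    refine ContinuousAt.comp (f := coord lam) (g := critCos lam u₁) ?_ (continuous_coord lam).continuousAt
    rw [coord_eq hl.ne' H.a₂_pos]
    exact H.continuousAt_critCos H.a₂_pos
  have h2 := h1.tendsto
  rw [coord_eq hl.ne' H.a₂_pos, ← H.cosLimit_eq] at h2
  refine (h2.mono_left nhdsWithin_le_nhds).congr' ?_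
  have h3 := (lt_mem_nhds ((coord_lt_iff hl H.u₁_pos H.a₂_pos).2 H.a₂_lt))
  have h4 := (gt_mem_nhds (coord_lt hl H.a₂_pos))
  filter_upwards [self_mem_nhdsWithin, mem_nhdsWithin_of_mem_nhds h3,
    mem_nhdsWithin_of_mem_nhds h4] with x hne h5 h6
  obtain ⟨u, hu, rfl⟩ := exists_coord hl h6
  rw [coord_eq hl.ne' hu, H.cosLower_eq hu ((coord_lt_iff hl H.u₁_pos hu).1 h5).le
    (fun h => hne (by rw [h]; rfl))]

theorem W_eq_zero_iff (H : Landscape lam a₂ u₁ a₁ a₀) {x : ℝ} (hx : x < 1 / lam) :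
    W lam x = 0 ↔ x = (1 - a₀ ^ 3) / lam ∨ x = (1 - a₁ ^ 3) / lam ∨ x = (1 - a₂ ^ 3) / lam := by
  have hl := H.lam_pos
  have ha0 : 0 < a₀ := one_pos.trans H.one_lt
  obtain ⟨u, hu, rfl⟩ := exists_coord hl hx
  have inj : ∀ {v : ℝ}, 0 < v → ((1 - u ^ 3) / lam = (1 - v ^ 3) / lam ↔ u = v) := fun {v} hv =>
    ⟨fun h => by rw [← coord_eq hl.ne' hu, h, coord_eq hl.ne' hv], fun h => by rw [h]⟩
  rw [inj ha0, inj H.a₁_pos, inj H.a₂_pos, W_eq hl.ne' hu]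
  have h := pot_mul hl.ne' hu.ne'
  constructor
  · intro h0
    rw [h0, mul_zero, sq_sub_sq] at h
    rcases mul_eq_zero.1 h.symm with h1 | h1
    · left
      rcases lt_trichotomy u a₀ with h2 | h2 | h2
      · linarith [H.add_pos u hu h2]
      · exact h2
      · linarith [H.add_neg u h2]
    · right
      rcases lt_trichotomy u a₁ with h2 | h2 | h2
      · right
        rcases lt_trichotomy u a₂ with h3 | h3 | h3
        · linarith [H.gt_of_lt u hu h3]
        · exact h3
        · linarith [H.lt_of_mem u h3 h2]
      · exact Or.inl h2
      · linarith [H.gt_of_gt u h2]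
  · rintro (rfl | rfl | rfl)
    · rw [pot, H.eq_a₀, neg_sq, sub_self, zero_div]
    · rw [pot, H.eq_a₁, sub_self, zero_div]
    · rw [pot, H.eq_a₂, sub_self, zero_div]

theorem isLocalMax_iff (H : Landscape lam a₂ u₁ a₁ a₀) {x : ℝ} (hx : x < 1 / lam) :
    IsLocalMax (W lam) x ↔ x = (1 - u₁ ^ 3) / lam := by
  have hl := H.lam_pos
  constructor
  · intro h
    obtain ⟨u, hu, rfl⟩ := exists_coord hl hx
    have hcont : ContinuousAt (fun v : ℝ => (1 - v ^ 3) / lam) u := by fun_prop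
    have h1 : IsLocalMax (pot lam) u := by
      have h2 : ∀ᶠ v in 𝓝 u, W lam ((1 - v ^ 3) / lam) ≤ W lam ((1 - u ^ 3) / lam) :=
        hcont.eventually h
      filter_upwards [h2, lt_mem_nhds hu] with v h3 hv
      rwa [W_eq hl.ne' hv, W_eq hl.ne' hu] at h3
    have h3 := h1.hasDerivAt_eq_zero (hasDerivAt_pot hl.ne' hu.ne')
    have h4 : slope lam u = 0 := by
      rw [neg_eq_zero, div_eq_zero_iff] at h3
      have h5 := h3.resolve_right (by positivity)
      exact (mul_eq_zero.1 h5).resolve_left (by positivity)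
    rcases lt_trichotomy u u₁ with h5 | rfl | h5
    · exact absurd h4 (H.slope_neg u hu h5).ne
    · rfl
    rcases le_or_gt u a₁ with h6 | h6
    · exact absurd h4 (H.slope_pos u h5 h6).ne'
    -- After a critical point beyond `a₁` the slope is negative, so the potential increases there;
    -- such a point is not a local maximum.
    exfalso
    have hmono : StrictMonoOn (pot lam) (Ici u) := by
      refine strictMonoOn_of_deriv_pos (convex_Ici u) (fun v hv =>
        (hasDerivAt_pot hl.ne' (hu.trans_le hv).ne').continuousAt.continuousWithinAt) fun v hv => ?_
      rw [interior_Ici] at hv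
      have hv0 : 0 < v := hu.trans hv
      rw [(hasDerivAt_pot hl.ne' hv0.ne').deriv, neg_pos]
      exact div_neg_of_neg_of_pos (mul_neg_of_pos_of_neg (by positivity)
        (H.slope_neg_of_zero u v h6 h4 hv)) (by positivity)
    have h7 : ∀ᶠ v in 𝓝[>] u, pot lam v ≤ pot lam u := h1.filter_mono nhdsWithin_le_nhds
    obtain ⟨v, hv, huv⟩ := (h7.and self_mem_nhdsWithin).exists
    exact absurd (hmono self_mem_Ici (le_of_lt huv) huv) (not_lt.2 hv)
  · rintro rfl
    -- Only x > 0, that is u < 1, is considered: W is unbounded as x → -∞, so the maximum is not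
    -- global.
    have h0 : 0 < (1 - u₁ ^ 3) / lam := div_pos (sub_pos.2
      (pow_lt_one₀ H.u₁_pos.le (H.u₁_lt.trans H.a₁_lt) (by norm_num))) hl
    filter_upwards [lt_mem_nhds h0, gt_mem_nhds hx] with y h1 h2
    obtain ⟨v, hv, rfl⟩ := exists_coord hl h2
    rw [W_eq hl.ne' hv, H.W_top]
    refine H.pot_le hv ?_
    by_contra hc
    have : 1 < v ^ 3 := one_lt_pow₀ (not_le.1 hc) (by norm_num)
    exact absurd h1 (not_lt.2 (div_nonpos_of_nonpos_of_nonneg (by linarith) hl.le))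

end Landscape

theorem cos_lt_cos_of_mem_Ioo {a α : ℝ} (ha : 0 ≤ a) (h : α ∈ Ioo a (2 * Real.pi - a)) :
    Real.cos α < Real.cos a := by
  rcases le_total α Real.pi with h1 | h1
  · exact Real.cos_lt_cos_of_nonneg_of_le_pi ha h1 h.1
  · rw [← Real.cos_two_pi_sub α]
    exact Real.cos_lt_cos_of_nonneg_of_le_pi ha (by linarith) (by linarith [h.2])

theorem cos_lt_cos_of_notMem_Icc {a α : ℝ} (ha : a ≤ Real.pi) (hα : α ∈ Icc 0 (2 * Real.pi))
    (h : α ∉ Icc a (2 * Real.pi - a)) : Real.cos a < Real.cos α := by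
  rcases lt_or_ge α a with h1 | h1
  · exact Real.cos_lt_cos_of_nonneg_of_le_pi hα.1 ha h1
  · have h2 : 2 * Real.pi - a < α := not_le.1 fun h2 => h ⟨h1, h2⟩
    rw [← Real.cos_two_pi_sub α]
    exact Real.cos_lt_cos_of_nonneg_of_le_pi (by linarith [hα.2]) ha (by linarith)

/-! ### Existence and uniqueness of the critical angle. -/

section CriticalAngle

variable {lam a₂ u₁ a₁ a₀ t R a b : ℝ}

/-- An angle strictly between the two would have to emanate by the first and originate by the
second. -/
theorem IsCriticalAngle.not_lt (hlam : 0 < lam) (ha : IsCriticalAngle lam t R a)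
    (hb : IsCriticalAngle lam t R b) : ¬ a < b := fun hab => by
  obtain ⟨α, h1, h2⟩ := exists_between hab
  have h3 := ha.1.1
  have h4 := hb.1.2
  exact not_originates_of_emanates hlam (ha.2.1 α ⟨h1, by linarith⟩)
    (hb.2.2 α ⟨by linarith, by linarith⟩ fun h => absurd h.1 (_root_.not_le.2 h2))

theorem Landscape.isCriticalAngle (H : Landscape lam a₂ u₁ a₁ a₀) (hR : 0 < R) (hx : t / R < 1 / lam) :
    IsCriticalAngle lam t R (critAngle lam u₁ a₁ (t / R)) := by
  obtain ⟨u, hu, ht⟩ := exists_coord H.lam_pos hx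
  rw [ht]
  rcases lt_or_ge a₁ u with h | h
  · rw [H.critAngle_of_ge h.le]
    -- The interval (π, 2π - π) is empty, so the first condition is void.
    exact ⟨⟨Real.pi_pos.le, le_rfl⟩, fun α hα => by linarith [hα.1, hα.2],
      fun α _ _ => originates_of_gt H hR hu ht (Or.inl h)⟩
  · rw [H.critAngle_eq hu, min_eq_left h]
    obtain ⟨h1, h2⟩ := H.critCos_mem hu (h.trans H.a₁_lt.le)
    refine ⟨⟨Real.arccos_nonneg _, Real.arccos_le_pi _⟩, fun α hα => ?_, fun α hα hα' => ?_⟩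
    · have := cos_lt_cos_of_mem_Ioo (Real.arccos_nonneg _) hα
      rw [Real.cos_arccos h1 h2] at this
      exact emanates_of_lt H hR hu ht h this
    · have := cos_lt_cos_of_notMem_Icc (Real.arccos_le_pi _) hα hα'
      rw [Real.cos_arccos h1 h2] at this
      exact originates_of_gt H hR hu ht (Or.inr this)

theorem Landscape.isCriticalAngle_iff (H : Landscape lam a₂ u₁ a₁ a₀) (hR : 0 < R)
    (hx : t / R < 1 / lam) : IsCriticalAngle lam t R a ↔ a = critAngle lam u₁ a₁ (t / R) := by
  have h := H.isCriticalAngle hR hx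
  refine ⟨fun ha => le_antisymm (not_lt.1 (h.not_lt H.lam_pos ha)) (not_lt.1 (ha.not_lt H.lam_pos h)), ?_⟩
  rintro rfl
  exact h

end CriticalAngle

end SelfSimilarDust

theorem mainTheorem4 (lam : ℝ) (hlam : 0 < lam) (hnaked : lam < SelfSimilarDust.lambdaStar) :
    ∃ J₀ J₁ xc J₂ : ℝ,
      -- the zeros of `W` and its local maximum
      J₀ < 0 ∧ 0 < J₁ ∧ J₁ < xc ∧ xc < J₂ ∧ J₂ < 1 / lam ∧
      (∀ x < 1 / lam, SelfSimilarDust.W lam x = 0 ↔ x = J₀ ∨ x = J₁ ∨ x = J₂) ∧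
      (∀ x < 1 / lam, IsLocalMax (SelfSimilarDust.W lam) x ↔ x = xc) ∧
      0 < SelfSimilarDust.W lam xc ∧
      -- the critical angle at the event `(t, R)` is given by the formula, with `x = t / R`
      (∀ t R : ℝ, 0 < R → t / R < 1 / lam → t / R ≠ J₂ → ∀ a : ℝ,
        SelfSimilarDust.IsCriticalAngle lam t R a ↔
          a = SelfSimilarDust.alphaHat lam J₁ xc (t / R)) ∧
      -- at `x = J₂`, where the formula is undefined, it is given by the limit of the formula
      (∀ t R : ℝ, 0 < R → t / R = J₂ → ∀ a : ℝ,
        SelfSimilarDust.IsCriticalAngle lam t R a ↔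
          a = Real.arccos (SelfSimilarDust.cosLimit lam xc J₂)) ∧
      -- before the Cauchy horizon no null geodesic at all comes from the singularity
      (∀ t R α : ℝ, 0 < R → t / R < J₁ →
        SelfSimilarDust.OriginatesFromFarPast lam t R α ∧
          ¬ SelfSimilarDust.EmanatesFromSingularity lam t R α) ∧
      -- continuity, and the limit at `J₂`
      ContinuousOn (SelfSimilarDust.alphaHat lam J₁ xc) (Set.Iio (1 / lam) \ {J₂}) ∧
      Tendsto (SelfSimilarDust.cosLower lam xc) (𝓝[≠] J₂)
        (𝓝 (SelfSimilarDust.cosLimit lam xc J₂)) ∧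
      Tendsto (SelfSimilarDust.alphaHat lam J₁ xc) (𝓝[≠] J₂)
        (𝓝 (Real.arccos (SelfSimilarDust.cosLimit lam xc J₂))) := by
  obtain ⟨a₂, u₁, a₁, a₀, H⟩ := SelfSimilarDust.exists_landscape hlam hnaked
  have ha0 : 0 < a₀ := one_pos.trans H.one_lt
  have hlt := H.a₁_lt
  have hJ₂ := SelfSimilarDust.coord_lt hlam H.a₂_pos
  refine ⟨(1 - a₀ ^ 3) / lam, (1 - a₁ ^ 3) / lam, (1 - u₁ ^ 3) / lam, (1 - a₂ ^ 3) / lam,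
    div_neg_of_neg_of_pos (sub_neg.2 (one_lt_pow₀ H.one_lt (by norm_num))) hlam,
    div_pos (sub_pos.2 (pow_lt_one₀ H.a₁_pos.le H.a₁_lt (by norm_num))) hlam,
    (SelfSimilarDust.coord_lt_iff hlam H.a₁_pos H.u₁_pos).2 H.u₁_lt,
    (SelfSimilarDust.coord_lt_iff hlam H.u₁_pos H.a₂_pos).2 H.a₂_lt, hJ₂,
    fun x hx => H.W_eq_zero_iff hx, fun x hx => H.isLocalMax_iff hx, ?_, ?_, ?_, ?_, ?_,
    H.tendsto_cosLower, ?_⟩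
  · rw [H.W_top]
    exact H.pot_u₁_pos
  · intro t R hR hx hne a
    rw [H.alphaHat_eq hx hne]
    exact H.isCriticalAngle_iff hR hx
  · intro t R hR hx a
    rw [← H.critAngle_a₂, ← hx]
    exact H.isCriticalAngle_iff hR (hx ▸ hJ₂)
  · intro t R α hR hx
    obtain ⟨u, hu, ht⟩ := SelfSimilarDust.exists_coord hlam
      (hx.trans (SelfSimilarDust.coord_lt hlam H.a₁_pos))
    rw [ht, SelfSimilarDust.coord_lt_iff hlam hu H.a₁_pos] at hx
    have h := SelfSimilarDust.originates_of_gt (α := α) H hR hu ht (Or.inl hx)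
    exact ⟨h, fun h' => SelfSimilarDust.not_originates_of_emanates hlam h' h⟩
  · refine ContinuousOn.congr (f := SelfSimilarDust.critAngle lam u₁ a₁)
      (fun x hx => (H.continuousAt_critAngle hx.1).continuousWithinAt)
      fun x hx => H.alphaHat_eq hx.1 hx.2
  · rw [← H.critAngle_a₂]
    refine ((H.continuousAt_critAngle hJ₂).tendsto.mono_left nhdsWithin_le_nhds).congr' ?_
    filter_upwards [self_mem_nhdsWithin, mem_nhdsWithin_of_mem_nhds (gt_mem_nhds hJ₂)] with x h1 h2
    exact (H.alphaHat_eq h2 h1).symm
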